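/- Let $n\ge 0$. For $m,k\ge 0$ let $\mathrm{Cob}^m_k$ be Bar-Natan's category of crossingless tangle diagrams in the square ($m$ top and $k$ bottom endpoints) and $\mathbb{Z}[\alpha]$-linear combinations of dotted cobordisms modulo isotopy rel boundary and the local relations: a sphere with $0,1,2,3$ dots equals $0,1,0,\alpha$; a cylinder equals the sum of two disks with a dot on the first plus the same with a dot on the second; a handle on a sheet equals twice a dot. A cobordism $S:q^k a\to q^l b$ has quantum degree $l-k-\chi(S)+(\text{number of endpoints})/2+2\cdot\#\text{dots}$, and $\deg\alpha=4$. Chain complexes over finite direct sums (or countable direct products) of shifted diagrams have differentials of bidegree $(1,0)$; $\operatorname{Hom}^\bullet(A,B)$ is the bigraded complex of homogeneous maps with differential $f\mapsto d_Bf-(-1)^{|f|}fd_A$; $|C\rangle:=\operatorname{Hom}^\bullet(\emptyset,C)$; $\otimes$ is vertical stacking (total complexes with the Koszul sign rule, formed with direct products), $\operatorname{Tr}$ the Markov closure, $(\ )^\vee$ the duality functor (reflection in the $x$-axis, reversing all degrees). All homotopies below have bidegree $(-1,0)$. Let $P=P_n$ be a universal projector on $n$ strands: a complex of finite direct sums of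 shifted diagrams in non-positive homological degrees whose degree zero chain group is the identity diagram $1_n$, with no other chain group containing $1_n$ (up to shift) as a summand, and which becomes contractible when composed with a turnback from above or from below. Let $\iota:1_n\to P$ be the inclusion of the degree zero chain group. A homotopy equivalence $\mu:P\otimes P\to P$ is called standard if $\mu\circ(\iota\otimes\iota)=\iota$ (where $1_n\otimes 1_n=1_n$). Let $\eta:\emptyset\to q^n\operatorname{Tr}(P)$ be $n$ parallel disks $\emptyset\to\operatorname{Tr}(1_n)$ followed by $\operatorname{Tr}(\iota)$, and put $$\phi:\operatorname{End}^\bullet(P)\to q^n|\operatorname{Tr}P\rangle,\qquad \phi(f)=\operatorname{Tr}(f)\circ\eta ,$$ $$\psi:q^n|\operatorname{Tr}P\rangle\to\operatorname{End}^\bullet(P),\qquad \psi(\zeta)=\bigl(P\xrightarrow{\zeta\sqcup 1}\operatorname{Tr}(P)\sqcup P\xrightarrow{\ s\ }P\otimes P\xrightarrow{\ \mu\ }P\bigr),$$ where $s$ consists of $n$ parallel saddles. Let $\Phi:\operatorname{End}^\bullet(P)\to q^n|\operatorname{Tr}(P\otimes P^\vee)\rangle$ be the duality map, given on matrix entries $f:a\to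 b$ by $f\mapsto\operatorname{Tr}(f\otimes 1_{a^\vee})\circ\eta_a$, where $\eta_a:\emptyset\to\operatorname{Tr}(a\otimes a^\vee)$ is the surface swept out by rotating $a$ (a disk for each arc and an annulus for each circle of $a$), and let $\Psi=|\operatorname{Tr}(1_P\otimes\iota^\vee)\rangle:q^n|\operatorname{Tr}(P\otimes P^\vee)\rangle\to q^n|\operatorname{Tr}P\rangle$. Then standard equivalences $\mu:P\otimes P\to P$ exist, and for each of them: 1. $\Phi$ is an isomorphism of bigraded chain complexes, $\Psi$ is a homotopy equivalence, and $\phi=\Psi\circ\Phi$. That is, $\phi$ is exactly the homotopy equivalence $\operatorname{End}^\bullet(P)\simeq q^n|\operatorname{Tr}P\rangle$ given by duality and absorption of $P^\vee$. 2. $\psi(\eta)\simeq 1_P$. 3. $\phi$ and $\psi$ are chain maps of bidegree $(0,0)$ and are mutually inverse homotopy equivalences of complexes of abelian groups. Consequently the saddle action $\psi$ of $q^n|\operatorname{Tr}P\rangle$ on $P$ agrees up to homotopy with the action given by any homotopy inverse of $\Psi\circ\Phi$, and $\eta$ acts as the unit up to homotopy. -/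

import Mathlib

open scoped Polynomial

noncomputable section

namespace BN

/-! ## Planar tangles

Diagrams in the square with `m` points on the top edge and `n` points on the bottom edge,
built from the elementary pictures by planar operations.  All of them are planar by construction,
and every properly embedded 1-submanifold of the square with this boundary is isotopic, relative to
its boundary, to one of them. -/

/-- Diagrams of crossingless tangles with `m` top points and `n` bottom points.
* `id n`: `n` vertical strands;
* `cap i`: `n` vertical strands and an arc joining the bottom points `i`, `i + 1`;
* `cup i`: `n` vertical strands and an arc joining the top points `i`, `i + 1`;
* `comp a b`: the picture `a ⊗ b`, `a` stacked on top of `b`;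
* `trace a`: the Markov closure `Tr(a)`, the `i`-th top point is joined to the `i`-th bottom point by
  an arc running around `a`;
* `beside c a`: the closed diagram `c` drawn next to `a`;
* `dual a`: the reflection of `a` in the horizontal axis. -/
inductive Tangle : ℕ → ℕ → Type
  | id (n : ℕ) : Tangle n n
  | cap {n : ℕ} (i : Fin (n + 1)) : Tangle n (n + 2)
  | cup {n : ℕ} (i : Fin (n + 1)) : Tangle (n + 2) n
  | comp {m k n : ℕ} (a : Tangle m k) (b : Tangle k n) : Tangle m n
  | trace {n : ℕ} (a : Tangle n n) : Tangle 0 0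
  | beside {m n : ℕ} (c : Tangle 0 0) (a : Tangle m n) : Tangle m n
  | dual {m n : ℕ} (a : Tangle m n) : Tangle n m

/-- The combinatorial 1-manifold underlying a diagram: a finite set of pieces of curve, a relation
saying which pieces are glued to each other, and the pieces that contain the boundary points. -/
structure Curve (m n : ℕ) where
  Pt : Type
  fin : Finite Pt
  adj : Pt → Pt → Prop
  top : Fin m → Pt
  bot : Fin n → Pt

/-- The `n + 2` end points on the side of `cap i` (or `cup i`) where the arc ends: the points `i` and
`i + 1` lie on the arc `none`, the remaining ones on the `n` vertical strands. -/
def pinch {n : ℕ} (i : Fin (n + 1)) (j : Fin (n + 2)) : Option (Fin n) :=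
  if h : j.val < i.val then some ⟨j.val, by omega⟩
  else if h' : j.val ≤ i.val + 1 then none
  else some ⟨j.val - 2, by omega⟩

/-- Gluing relation for `a ⊗ b`: the bottom points of `a` are glued to the top points of `b`. -/
inductive GlueAdj {m k n : ℕ} (A : Curve m k) (B : Curve k n) : A.Pt ⊕ B.Pt → A.Pt ⊕ B.Pt → Prop
  | left {x y : A.Pt} : A.adj x y → GlueAdj A B (.inl x) (.inl y)
  | right {x y : B.Pt} : B.adj x y → GlueAdj A B (.inr x) (.inr y)
  | glue (j : Fin k) : GlueAdj A B (.inl (A.bot j)) (.inr (B.top j))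

/-- Gluing relation for `Tr(a)`. -/
inductive TraceAdj {n : ℕ} (A : Curve n n) : A.Pt → A.Pt → Prop
  | old {x y : A.Pt} : A.adj x y → TraceAdj A x y
  | close (i : Fin n) : TraceAdj A (A.top i) (A.bot i)

/-- The 1-manifold underlying a diagram. -/
def Tangle.curve : {m n : ℕ} → Tangle m n → Curve m n
  | _, _, .id n => ⟨Fin n, inferInstance, fun _ _ => False, fun j => j, fun j => j⟩
  | _, _, .cap (n := n) i =>
      ⟨Option (Fin n), inferInstance, fun _ _ => False, fun j => some j, pinch i⟩
  | _, _, .cup (n := n) i =>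
      ⟨Option (Fin n), inferInstance, fun _ _ => False, pinch i, fun j => some j⟩
  | _, _, .comp a b =>
      { Pt := a.curve.Pt ⊕ b.curve.Pt
        fin := haveI := a.curve.fin; haveI := b.curve.fin; inferInstance
        adj := GlueAdj a.curve b.curve
        top := fun j => .inl (a.curve.top j)
        bot := fun j => .inr (b.curve.bot j) }
  | _, _, .trace a => ⟨a.curve.Pt, a.curve.fin, TraceAdj a.curve, Fin.elim0, Fin.elim0⟩
  | _, _, .beside c a =>
      { Pt := c.curve.Pt ⊕ a.curve.Pt
        fin := haveI := c.curve.fin; haveI := a.curve.fin; inferInstance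
        adj := Sum.LiftRel c.curve.adj a.curve.adj
        top := fun j => .inr (a.curve.top j)
        bot := fun j => .inr (a.curve.bot j) }
  | _, _, .dual a => ⟨a.curve.Pt, a.curve.fin, a.curve.adj, a.curve.bot, a.curve.top⟩

/-- The pieces of a diagram. -/
abbrev Tangle.Pt {m n : ℕ} (a : Tangle m n) : Type := a.curve.Pt

/-- The connected components (arcs and circles) of a diagram. -/
abbrev Tangle.Strand {m n : ℕ} (a : Tangle m n) : Type := Quot a.curve.adj

/-- The component of a piece of a diagram. -/
abbrev Tangle.strand {m n : ℕ} (a : Tangle m n) (x : a.Pt) : a.Strand := Quot.mk _ x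

/-- An identification of the components of two diagrams relative to the boundary. -/
structure Isotopy {m n : ℕ} (a b : Tangle m n) where
  equiv : a.Strand ≃ b.Strand
  top : ∀ j, equiv (a.strand (a.curve.top j)) = b.strand (b.curve.top j)
  bot : ∀ j, equiv (a.strand (a.curve.bot j)) = b.strand (b.curve.bot j)

namespace Isotopy

variable {m n : ℕ}

def refl (a : Tangle m n) : Isotopy a a := ⟨Equiv.refl _, fun _ => rfl, fun _ => rfl⟩

def symm {a b : Tangle m n} (e : Isotopy a b) : Isotopy b a :=
  ⟨e.equiv.symm, fun j => by rw [← e.top, Equiv.symm_apply_apply],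
    fun j => by rw [← e.bot, Equiv.symm_apply_apply]⟩

def ofEq {a b : Tangle m n} (h : a = b) : Isotopy a b := h ▸ refl a

/-- `a ⊗ 1_n ≅ a`. -/
def rightUnit (a : Tangle m n) : Isotopy (.comp a (.id n)) a where
  equiv :=
    { toFun := Quot.lift (Sum.elim a.strand (fun j => a.strand (a.curve.bot j))) (by
        rintro _ _ (h | h | j)
        · exact Quot.sound h
        · exact h.elim
        · rfl)
      invFun := Quot.lift (fun x => Quot.mk _ (Sum.inl x))
        (fun _ _ h => Quot.sound (GlueAdj.left h))
      left_inv := by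
        rintro ⟨x | j⟩
        · rfl
        · exact Quot.sound (GlueAdj.glue (A := a.curve) (B := (Tangle.id n).curve) j)
      right_inv := by
        rintro ⟨x⟩
        rfl }
  top _ := rfl
  bot _ := rfl

/-- `a ≅ ∅ ⊔ a`. -/
def emptyBeside (a : Tangle m n) : Isotopy a (.beside (.id 0) a) where
  equiv :=
    { toFun := Quot.lift (fun x => Quot.mk _ (Sum.inr x))
        (fun _ _ h => Quot.sound (Sum.LiftRel.inr h))
      invFun := Quot.lift (Sum.elim Fin.elim0 a.strand) (by
        rintro _ _ (h | h)
        · exact h.elim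
        · exact Quot.sound h)
      left_inv := by
        rintro ⟨x⟩
        rfl
      right_inv := by
        rintro ⟨x | x⟩
        · exact Fin.elim0 x
        · rfl }
  top _ := rfl
  bot _ := rfl

/-- `1_n` is its own reflection. -/
def dualId (n : ℕ) : Isotopy (.dual (.id n)) (.id n) :=
  ⟨Equiv.refl _, fun _ => rfl, fun _ => rfl⟩

end Isotopy

/-! ## Dotted cobordisms -/

/-- Dotted cobordisms between diagrams with the same boundary, built from elementary ones
(`birth`, `death`, `saddle`, `unsaddle`, `dot`, and the cylinder `cyl e` swept out by an isotopy) and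
a few standard composite pieces (`disks`, `merge`, `coev`) by stacking in the time direction (`comp`)
and by gluing in the plane (`hcomp`, `trace`, `beside`, `dual`).
* `disks n`: `n` parallel disks bounding the `n` circles of `Tr(1_n)`;
* `merge a b`: `n` parallel saddles joining the `n` closing arcs of `Tr(a)` to the `n` strands of `b`
  that end in its top points;
* `coev a`: the surface swept out by `a` when it is rotated to `a^∨`, bounded by `Tr(a ⊗ a^∨)`
  (a disk for every arc and an annulus for every circle of `a`);
* `dual f`: the image of `f` under `(x, y, z) ↦ (x, 1 - y, 1 - z)`. -/
inductive Cob : {m n : ℕ} → Tangle m n → Tangle m n → Type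
  | cyl {m n : ℕ} {a b : Tangle m n} (e : Isotopy a b) : Cob a b
  | dot {m n : ℕ} (a : Tangle m n) (p : a.Pt) : Cob a a
  | birth {n : ℕ} (i : Fin (n + 1)) : Cob (.id n) (.comp (.cap i) (.cup i))
  | death {n : ℕ} (i : Fin (n + 1)) : Cob (.comp (.cap i) (.cup i)) (.id n)
  | saddle {n : ℕ} (i : Fin (n + 1)) : Cob (.id (n + 2)) (.comp (.cup i) (.cap i))
  | unsaddle {n : ℕ} (i : Fin (n + 1)) : Cob (.comp (.cup i) (.cap i)) (.id (n + 2))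
  | disks (n : ℕ) : Cob (.id 0) (.trace (.id n))
  | merge {n k : ℕ} (a : Tangle n n) (b : Tangle n k) : Cob (.beside (.trace a) b) (.comp a b)
  | coev {m n : ℕ} (a : Tangle m n) : Cob (.id 0) (.trace (.comp a (.dual a)))
  | comp {m n : ℕ} {a b c : Tangle m n} (f : Cob a b) (g : Cob b c) : Cob a c
  | hcomp {m k n : ℕ} {a a' : Tangle m k} {b b' : Tangle k n} (f : Cob a a') (g : Cob b b') :
      Cob (.comp a b) (.comp a' b')
  | trace {n : ℕ} {a b : Tangle n n} (f : Cob a b) : Cob (.trace a) (.trace b)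
  | beside {m n : ℕ} {c c' : Tangle 0 0} {a a' : Tangle m n} (f : Cob c c') (g : Cob a a') :
      Cob (.beside c a) (.beside c' a')
  | dual {m n : ℕ} {a b : Tangle m n} (f : Cob a b) : Cob (.dual b) (.dual a)

/-- The combinatorial surface underlying a cobordism from `a` to `b`: a finite set of pieces of
surface, a relation saying which pieces are glued to each other, the pieces that contain the given
pieces of the source and of the target, the dots, and for each piece `wt = χ - (number of arcs of
the source)`, that is, births plus deaths minus saddles.  The number `wt` is additive under all
gluings, and a component `S` of the surface has `χ(S) = A + ∑ wt` where `A` is the number of arcs of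
the source in its boundary. -/
structure Surf {m n : ℕ} (a b : Tangle m n) where
  V : Type
  fin : Finite V
  adj : V → V → Prop
  wt : V → ℤ
  dots : V → ℕ
  src : a.Pt → V
  tgt : b.Pt → V

/-- Stacking two cobordisms: the pieces along the middle diagram are glued. -/
inductive StackAdj {m n : ℕ} {a b c : Tangle m n} (F : Surf a b) (G : Surf b c) :
    F.V ⊕ G.V → F.V ⊕ G.V → Prop
  | left {x y : F.V} : F.adj x y → StackAdj F G (.inl x) (.inl y)
  | right {x y : G.V} : G.adj x y → StackAdj F G (.inr x) (.inr y)
  | glue (x : b.Pt) : StackAdj F G (.inl (F.tgt x)) (.inr (G.src x))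

/-- Gluing two cobordisms in the plane, along the walls over the `k` common boundary points. -/
inductive PlaneAdj {m k n : ℕ} {a a' : Tangle m k} {b b' : Tangle k n} (F : Surf a a')
    (G : Surf b b') : F.V ⊕ G.V → F.V ⊕ G.V → Prop
  | left {x y : F.V} : F.adj x y → PlaneAdj F G (.inl x) (.inl y)
  | right {x y : G.V} : G.adj x y → PlaneAdj F G (.inr x) (.inr y)
  | src (j : Fin k) : PlaneAdj F G (.inl (F.src (a.curve.bot j))) (.inr (G.src (b.curve.top j)))
  | tgt (j : Fin k) : PlaneAdj F G (.inl (F.tgt (a'.curve.bot j))) (.inr (G.tgt (b'.curve.top j)))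

/-- Closing a cobordism: the walls over the top and bottom boundary points are glued. -/
inductive CloseAdj {n : ℕ} {a b : Tangle n n} (F : Surf a b) : F.V → F.V → Prop
  | old {x y : F.V} : F.adj x y → CloseAdj F x y
  | src (i : Fin n) : CloseAdj F (F.src (a.curve.top i)) (F.src (a.curve.bot i))
  | tgt (i : Fin n) : CloseAdj F (F.tgt (b.curve.top i)) (F.tgt (b.curve.bot i))

/-- Connectivity of the surface `merge a b`: that of `a ⊗ b` together with that of `Tr(a)`. -/
inductive MergeAdj {n k : ℕ} (a : Tangle n n) (b : Tangle n k) :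
    a.Pt ⊕ b.Pt → a.Pt ⊕ b.Pt → Prop
  | stack {x y : a.Pt ⊕ b.Pt} : (Tangle.comp a b).curve.adj x y → MergeAdj a b x y
  | close (i : Fin n) : MergeAdj a b (.inl (a.curve.top i)) (.inl (a.curve.bot i))

open Classical in
/-- The combinatorial surface underlying a cobordism. -/
def Cob.surf : {m n : ℕ} → {a b : Tangle m n} → Cob a b → Surf a b
  | _, _, a, b, .cyl e =>
      { V := b.Strand
        fin := haveI := b.curve.fin; inferInstance
        adj := fun _ _ => False
        wt := fun _ => 0
        dots := fun _ => 0
        src := fun x => e.equiv (a.strand x)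
        tgt := fun x => b.strand x }
  | _, _, _, _, .dot a p =>
      { V := a.Strand
        fin := haveI := a.curve.fin; inferInstance
        adj := fun _ _ => False
        wt := fun _ => 0
        dots := fun s => if s = a.strand p then 1 else 0
        src := fun x => a.strand x
        tgt := fun x => a.strand x }
  | _, _, _, _, .birth (n := n) _ =>
      { V := Option (Fin n)
        fin := inferInstance
        adj := fun _ _ => False
        wt := fun v => if v = none then 1 else 0
        dots := fun _ => 0
        src := fun j => some j
        tgt := Sum.elim (fun x => x) (fun x => x) }
  | _, _, _, _, .death (n := n) _ =>
      { V := Option (Fin n)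
        fin := inferInstance
        adj := fun _ _ => False
        wt := fun v => if v = none then 1 else 0
        dots := fun _ => 0
        src := Sum.elim (fun x => x) (fun x => x)
        tgt := fun j => some j }
  | _, _, _, _, .saddle (n := n) i =>
      { V := Option (Fin n)
        fin := inferInstance
        adj := fun _ _ => False
        wt := fun v => if v = none then -1 else 0
        dots := fun _ => 0
        src := pinch i
        tgt := Sum.elim (fun x => x) (fun x => x) }
  | _, _, _, _, .unsaddle (n := n) i =>
      { V := Option (Fin n)
        fin := inferInstance
        adj := fun _ _ => False
        wt := fun v => if v = none then -1 else 0
        dots := fun _ => 0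
        src := Sum.elim (fun x => x) (fun x => x)
        tgt := pinch i }
  | _, _, _, _, .disks n =>
      { V := Fin n
        fin := inferInstance
        adj := fun _ _ => False
        wt := fun _ => 1
        dots := fun _ => 0
        src := Fin.elim0
        tgt := fun x => x }
  | _, _, _, _, .merge (n := n) a b =>
      { V := a.Pt ⊕ b.Pt
        fin := haveI := a.curve.fin; haveI := b.curve.fin; inferInstance
        adj := MergeAdj a b
        wt := fun v => -(Nat.card {j : Fin n // Sum.inr (b.curve.top j) = v} : ℤ)
        dots := fun _ => 0
        src := fun x => x
        tgt := fun x => x }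
  | _, _, _, _, .coev (m := m) (n := n) a =>
      { V := a.Strand
        fin := haveI := a.curve.fin; inferInstance
        adj := fun _ _ => False
        wt := fun s => (((Nat.card {i : Fin m // a.strand (a.curve.top i) = s} +
          Nat.card {j : Fin n // a.strand (a.curve.bot j) = s}) / 2 : ℕ) : ℤ)
        dots := fun _ => 0
        src := Fin.elim0
        tgt := Sum.elim (fun x => a.strand x) (fun x => a.strand x) }
  | _, _, _, _, .comp f g =>
      { V := f.surf.V ⊕ g.surf.V
        fin := haveI := f.surf.fin; haveI := g.surf.fin; inferInstance
        adj := StackAdj f.surf g.surf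
        wt := Sum.elim f.surf.wt g.surf.wt
        dots := Sum.elim f.surf.dots g.surf.dots
        src := fun x => .inl (f.surf.src x)
        tgt := fun x => .inr (g.surf.tgt x) }
  | _, _, _, _, .hcomp f g =>
      { V := f.surf.V ⊕ g.surf.V
        fin := haveI := f.surf.fin; haveI := g.surf.fin; inferInstance
        adj := PlaneAdj f.surf g.surf
        wt := Sum.elim f.surf.wt g.surf.wt
        dots := Sum.elim f.surf.dots g.surf.dots
        src := Sum.map f.surf.src g.surf.src
        tgt := Sum.map f.surf.tgt g.surf.tgt }
  | _, _, _, _, .trace f =>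
      { V := f.surf.V
        fin := f.surf.fin
        adj := CloseAdj f.surf
        wt := f.surf.wt
        dots := f.surf.dots
        src := f.surf.src
        tgt := f.surf.tgt }
  | _, _, _, _, .beside f g =>
      { V := f.surf.V ⊕ g.surf.V
        fin := haveI := f.surf.fin; haveI := g.surf.fin; inferInstance
        adj := Sum.LiftRel f.surf.adj g.surf.adj
        wt := Sum.elim f.surf.wt g.surf.wt
        dots := Sum.elim f.surf.dots g.surf.dots
        src := Sum.map f.surf.src g.surf.src
        tgt := Sum.map f.surf.tgt g.surf.tgt }
  | _, _, _, _, .dual f =>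
      { V := f.surf.V
        fin := f.surf.fin
        adj := f.surf.adj
        wt := f.surf.wt
        dots := f.surf.dots
        src := f.surf.tgt
        tgt := f.surf.src }

/-- The quantum degree `-χ(S) + (m + n) / 2`, plus `2` for every dot. -/
def Cob.deg {m n : ℕ} {a b : Tangle m n} (f : Cob a b) : ℤ :=
  ∑ᶠ v : f.surf.V, (2 * (f.surf.dots v : ℤ) - f.surf.wt v)

/-- The connected components of a cobordism. -/
abbrev Cob.Sheet {m n : ℕ} {a b : Tangle m n} (f : Cob a b) : Type := Quot f.surf.adj

/-- The component containing a piece. -/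
abbrev Cob.sheet {m n : ℕ} {a b : Tangle m n} (f : Cob a b) (v : f.surf.V) : f.Sheet :=
  Quot.mk _ v

/-- Two dotted cobordisms from `a` to `b` are homeomorphic relative to their boundary: there is a
bijection of the components that is compatible with the boundary and preserves Euler characteristics
and numbers of dots.  (All these surfaces are orientable, with compatible orientations of the
boundary, so this is the classification of compact surfaces.) -/
def Homeo {m n : ℕ} {a b : Tangle m n} (f g : Cob a b) : Prop :=
  ∃ e : f.Sheet ≃ g.Sheet,
    (∀ x, e (f.sheet (f.surf.src x)) = g.sheet (g.surf.src x)) ∧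
    (∀ x, e (f.sheet (f.surf.tgt x)) = g.sheet (g.surf.tgt x)) ∧
    (∀ s, ∑ᶠ v : {v // f.sheet v = s}, f.surf.wt v = ∑ᶠ v : {v // g.sheet v = e s}, g.surf.wt v) ∧
    (∀ s, ∑ᶠ v : {v // f.sheet v = s}, f.surf.dots v =
      ∑ᶠ v : {v // g.sheet v = e s}, g.surf.dots v)

/-! ## The linear category: `ℤ[α]`-linear combinations modulo the local relations -/

/-- The identity cobordism. -/
abbrev Cob.one {m n : ℕ} (a : Tangle m n) : Cob a a := .cyl (.refl a)

/-- A circle in the empty diagram. -/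
abbrev circle : Tangle 0 0 := .comp (.cap 0) (.cup 0)

/-- The cylinder over the circle with `d` dots. -/
def circleDots : ℕ → Cob circle circle
  | 0 => .one circle
  | d + 1 => .comp (circleDots d) (.dot circle (.inl none))

/-- The sphere with `d` dots. -/
def sphere (d : ℕ) : Cob (.id 0) (.id 0) :=
  .comp (.birth 0) (.comp (circleDots d) (.death 0))

/-- The linear combinations of dotted cobordisms that are zero: the smallest family of
`ℤ[α]`-submodules (the formal parameter `α` is the variable `X`) that contains the differences of
homeomorphic cobordisms and the local relations, and is closed under stacking and under gluing in the
plane. -/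
inductive Null : {m n : ℕ} → {a b : Tangle m n} → (Cob a b →₀ ℤ[X]) → Prop
  | zero {m n : ℕ} {a b : Tangle m n} : Null (0 : Cob a b →₀ ℤ[X])
  | add {m n : ℕ} {a b : Tangle m n} {x y : Cob a b →₀ ℤ[X]} : Null x → Null y → Null (x + y)
  | smul {m n : ℕ} {a b : Tangle m n} (r : ℤ[X]) {x : Cob a b →₀ ℤ[X]} : Null x → Null (r • x)
  | homeo {m n : ℕ} {a b : Tangle m n} (f g : Cob a b) :
      Homeo f g → Null (.single f 1 - .single g 1)
  | sphere_zero : Null (.single (sphere 0) 1)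
  | sphere_one : Null (.single (sphere 1) 1 - .single (.one _) 1)
  | sphere_two : Null (.single (sphere 2) 1)
  | sphere_three : Null (.single (sphere 3) 1 - .single (.one _) Polynomial.X)
  | neck : Null (.single (.one circle) 1
      - .single (.comp (.comp (.death 0) (.birth 0)) (.dot circle (.inl none))) 1
      - .single (.comp (.dot circle (.inl none)) (.comp (.death 0) (.birth 0))) 1)
  | handle : Null
      (.single (.hcomp (.one (.cap (0 : Fin 1))) (.comp (.saddle 0) (.unsaddle 0))) 1
      - .single (.dot (.comp (.cap (0 : Fin 1)) (.id 2)) (.inl none)) 2)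
  | comp_left {m n : ℕ} {a b c : Tangle m n} {x : Cob a b →₀ ℤ[X]} (g : Cob b c) :
      Null x → Null (x.mapDomain fun f => f.comp g)
  | comp_right {m n : ℕ} {a b c : Tangle m n} (f : Cob a b) {y : Cob b c →₀ ℤ[X]} :
      Null y → Null (y.mapDomain fun g => f.comp g)
  | hcomp_left {m k n : ℕ} {a a' : Tangle m k} {b b' : Tangle k n} {x : Cob a a' →₀ ℤ[X]}
      (g : Cob b b') : Null x → Null (x.mapDomain fun f => f.hcomp g)
  | hcomp_right {m k n : ℕ} {a a' : Tangle m k} {b b' : Tangle k n} (f : Cob a a')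
      {y : Cob b b' →₀ ℤ[X]} : Null y → Null (y.mapDomain fun g => f.hcomp g)
  | trace {n : ℕ} {a b : Tangle n n} {x : Cob a b →₀ ℤ[X]} :
      Null x → Null (x.mapDomain fun f => f.trace)
  | beside_left {m n : ℕ} {c c' : Tangle 0 0} {a a' : Tangle m n} {x : Cob c c' →₀ ℤ[X]}
      (g : Cob a a') : Null x → Null (x.mapDomain fun f => f.beside g)
  | beside_right {m n : ℕ} {c c' : Tangle 0 0} {a a' : Tangle m n} (f : Cob c c')
      {y : Cob a a' →₀ ℤ[X]} : Null y → Null (y.mapDomain fun g => f.beside g)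
  | dual {m n : ℕ} {a b : Tangle m n} {x : Cob a b →₀ ℤ[X]} :
      Null x → Null (x.mapDomain fun f => f.dual)

/-- The submodule of linear combinations that are zero. -/
def nullSub {m n : ℕ} (a b : Tangle m n) : Submodule ℤ[X] (Cob a b →₀ ℤ[X]) where
  carrier := {x | Null x}
  zero_mem' := Null.zero
  add_mem' := Null.add
  smul_mem' := fun r _ h => Null.smul r h

/-- The morphisms `a → b` of all quantum degrees. -/
abbrev Hom {m n : ℕ} (a b : Tangle m n) : Type := (Cob a b →₀ ℤ[X]) ⧸ nullSub a b

/-- The class of a cobordism. -/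
def cob {m n : ℕ} {a b : Tangle m n} (f : Cob a b) : Hom a b :=
  (nullSub a b).mkQ (.single f 1)

/-- Bilinear extension of an operation on generators. -/
def lift₂ {A B C : Type} (F : A → B → C) (NA : Submodule ℤ[X] (A →₀ ℤ[X]))
    (NB : Submodule ℤ[X] (B →₀ ℤ[X])) (NC : Submodule ℤ[X] (C →₀ ℤ[X]))
    (hA : ∀ b, ∀ x ∈ NA, x.mapDomain (fun a => F a b) ∈ NC)
    (hB : ∀ a, ∀ y ∈ NB, y.mapDomain (F a) ∈ NC) :
    ((A →₀ ℤ[X]) ⧸ NA) →ₗ[ℤ[X]] ((B →₀ ℤ[X]) ⧸ NB) →ₗ[ℤ[X]] ((C →₀ ℤ[X]) ⧸ NC) :=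
  NA.liftQ
    (Finsupp.linearCombination ℤ[X] fun a =>
      NB.mapQ NC (Finsupp.lmapDomain ℤ[X] ℤ[X] (F a)) (Submodule.map_le_iff_le_comap.1 (by
        rintro _ ⟨y, hy, rfl⟩
        exact hB a y hy))) (by
    intro x hx
    rw [LinearMap.mem_ker]
    refine Submodule.linearMap_qext _ (Finsupp.lhom_ext' fun b => LinearMap.ext_ring ?_)
    have h : NC.mkQ (x.mapDomain fun a => F a b) = 0 :=
      (Submodule.Quotient.mk_eq_zero NC).2 (hA b x hx)
    rw [Finsupp.mapDomain, Finsupp.sum, map_sum] at h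
    rw [LinearMap.zero_comp, LinearMap.zero_comp, LinearMap.zero_apply, ← h,
      Finsupp.linearCombination_apply, Finsupp.sum, LinearMap.comp_apply, LinearMap.comp_apply,
      LinearMap.sum_apply]
    refine Finset.sum_congr rfl fun a _ => ?_
    rw [LinearMap.smul_apply, Finsupp.lsingle_apply, Submodule.mkQ_apply, Submodule.mapQ_apply,
      Finsupp.lmapDomain_apply, Finsupp.mapDomain_single, Submodule.mkQ_apply,
      ← Submodule.Quotient.mk_smul, Finsupp.smul_single, smul_eq_mul, mul_one])

namespace Hom

variable {m k n : ℕ}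

/-- The identity morphism. -/
def one (a : Tangle m n) : Hom a a := cob (.one a)

/-- The isomorphism induced by an isotopy. -/
def iso {a b : Tangle m n} (e : Isotopy a b) : Hom a b := cob (.cyl e)

/-- Composition: first `f`, then `g`. -/
def comp {a b c : Tangle m n} : Hom a b →ₗ[ℤ[X]] Hom b c →ₗ[ℤ[X]] Hom a c :=
  lift₂ Cob.comp _ _ _ (fun g _ h => Null.comp_left g h) (fun f _ h => Null.comp_right f h)

/-- The functor `⊗` on morphisms. -/
def hcomp {a a' : Tangle m k} {b b' : Tangle k n} :
    Hom a a' →ₗ[ℤ[X]] Hom b b' →ₗ[ℤ[X]] Hom (.comp a b) (.comp a' b') :=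
  lift₂ Cob.hcomp _ _ _ (fun g _ h => Null.hcomp_left g h) (fun f _ h => Null.hcomp_right f h)

/-- The functor `⊔` on morphisms. -/
def beside {c c' : Tangle 0 0} {a a' : Tangle m n} :
    Hom c c' →ₗ[ℤ[X]] Hom a a' →ₗ[ℤ[X]] Hom (.beside c a) (.beside c' a') :=
  lift₂ Cob.beside _ _ _ (fun g _ h => Null.beside_left g h) (fun f _ h => Null.beside_right f h)

/-- The functor `Tr` on morphisms. -/
def trace {a b : Tangle n n} : Hom a b →ₗ[ℤ[X]] Hom (.trace a) (.trace b) :=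
  Submodule.mapQ _ _ (Finsupp.lmapDomain ℤ[X] ℤ[X] Cob.trace) (fun _ h => Null.trace h)

/-- The contravariant duality functor on morphisms. -/
def dual {a b : Tangle m n} : Hom a b →ₗ[ℤ[X]] Hom (.dual b) (.dual a) :=
  Submodule.mapQ _ _ (Finsupp.lmapDomain ℤ[X] ℤ[X] Cob.dual) (fun _ h => Null.dual h)

/-- The morphisms of quantum degree `d` (where `α` has degree `4`). -/
def homog (a b : Tangle m n) (d : ℤ) : AddSubgroup (Hom a b) :=
  AddSubgroup.closure
    {x | ∃ (j : ℕ) (f : Cob a b), f.deg + 4 * j = d ∧ x = (Polynomial.X ^ j : ℤ[X]) • cob f}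

end Hom

/-! ## Chain complexes

A chain complex over the closure of the cobordism category under countable direct products (or finite
direct sums) is a family of shifted diagrams `q^(q i) (o i)`, `i ∈ I`, placed in homological degrees
`h i`, with a matrix of morphisms.  So the `k`-th chain group is the formal product of the
`q^(q i) (o i)` with `h i = k`. -/

structure Cx (m n : ℕ) where
  I : Type
  h : I → ℤ
  q : I → ℤ
  o : I → Tangle m n
  d : ∀ i j, Hom (o i) (o j)

/-- Matrices of morphisms. -/
abbrev Mat {m n : ℕ} (A B : Cx m n) : Type := ∀ i j, Hom (A.o i) (B.o j)

/-- Composition of matrices: first `f`, then `g`. -/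
def Mat.comp {m n : ℕ} {A B C : Cx m n} (f : Mat A B) (g : Mat B C) : Mat A C :=
  fun i k => ∑ᶠ j, Hom.comp (f i j) (g j k)

open Classical in
/-- The identity matrix. -/
def Mat.one {m n : ℕ} (A : Cx m n) : Mat A A :=
  fun i j => if h : i = j then Hom.iso (.ofEq (congrArg A.o h)) else 0

/-- `d` is a differential of bidegree `(1, 0)`: its entries are homogeneous, rows of the matrix are
finite, and `d ∘ d = 0`. -/
structure Cx.IsComplex {m n : ℕ} (A : Cx m n) : Prop where
  homog : ∀ i j, A.d i j ∈ Hom.homog (A.o i) (A.o j) (A.q i - A.q j)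
  deg : ∀ i j, A.d i j ≠ 0 → A.h j = A.h i + 1
  row : ∀ j, {i | A.d i j ≠ 0}.Finite
  sq : Mat.comp A.d A.d = 0

/-- The group of morphisms `A → B` of bidegree `(k, l)`: a matrix with finite rows, whose entries have
quantum degree `l` and raise the homological degree by `k`. -/
def HomBi {m n : ℕ} (A B : Cx m n) (k l : ℤ) : AddSubgroup (Mat A B) where
  carrier := {f | (∀ i j, f i j ∈ Hom.homog (A.o i) (B.o j) (A.q i - B.q j + l)) ∧
    (∀ i j, f i j ≠ 0 → B.h j = A.h i + k) ∧ ∀ j, {i | f i j ≠ 0}.Finite}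
  zero_mem' := ⟨fun _ _ => zero_mem _, fun _ _ h => absurd rfl h, fun _ => by simp⟩
  add_mem' := by
    rintro f g ⟨hf, hf', hf''⟩ ⟨hg, hg', hg''⟩
    refine ⟨fun i j => add_mem (hf i j) (hg i j), fun i j h => ?_, fun j => ?_⟩
    · by_cases h0 : f i j = 0
      · refine hg' i j fun h1 => h ?_
        simp [h0, h1]
      · exact hf' i j h0
    · refine ((hf'' j).union (hg'' j)).subset fun i h => ?_
      by_contra hc
      simp only [Set.mem_union, Set.mem_ofPred_eq, not_or, not_not] at hc
      exact h (by simp [hc.1, hc.2])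
  neg_mem' := by
    rintro f ⟨hf, hf', hf''⟩
    refine ⟨fun i j => neg_mem (hf i j), fun i j h => hf' i j fun h0 => h (by simp [h0]),
      fun j => (hf'' j).subset fun i h h0 => h (by simp [h0])⟩

/-- The differential of `Hom^•(A, B)` on maps of homological degree `k`:
`f ↦ d_B ∘ f - (-1)^k f ∘ d_A`. -/
def diff {m n : ℕ} {A B : Cx m n} (k : ℤ) (f : Mat A B) : Mat A B :=
  Mat.comp f B.d - Int.negOnePow k • Mat.comp A.d f

/-- Contractibility, by a homotopy of bidegree `(-1, 0)`. -/
def Cx.Contractible {m n : ℕ} (A : Cx m n) : Prop :=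
  ∃ H ∈ HomBi A A (-1) 0, diff (-1) H = Mat.one A

/-- Homotopy of maps of bidegree `(0, 0)`. -/
def MapHomotopic {m n : ℕ} {A B : Cx m n} (f g : Mat A B) : Prop :=
  ∃ H ∈ HomBi A B (-1) 0, f - g = diff (-1) H

/-- Chain maps of bidegree `(0, 0)`. -/
def IsChainMap {m n : ℕ} {A B : Cx m n} (f : Mat A B) : Prop :=
  f ∈ HomBi A B 0 0 ∧ diff 0 f = 0

/-- Homotopy equivalences. -/
def IsHomotopyEquiv {m n : ℕ} {A B : Cx m n} (f : Mat A B) : Prop :=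
  IsChainMap f ∧ ∃ g : Mat B A, IsChainMap g ∧
    MapHomotopic (Mat.comp f g) (Mat.one A) ∧ MapHomotopic (Mat.comp g f) (Mat.one B)

namespace Cx

variable {m k n : ℕ}

/-- A diagram, as a complex in degree zero. -/
def single (a : Tangle m n) : Cx m n := ⟨Unit, fun _ => 0, fun _ => 0, fun _ => a, fun _ _ => 0⟩

/-- The shift `q^s A`. -/
def qshift (s : ℤ) (A : Cx m n) : Cx m n := { A with q := fun i => A.q i + s }

/-- `A ⊗ B`, the total complex with the Koszul sign rule.  (All complexes being formal products, this
is the version with products; it agrees with the one with sums where only finitely many terms occur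
in each degree.) -/
def tensor (A : Cx m k) (B : Cx k n) : Cx m n where
  I := A.I × B.I
  h p := A.h p.1 + B.h p.2
  q p := A.q p.1 + B.q p.2
  o p := .comp (A.o p.1) (B.o p.2)
  d p p' := Hom.hcomp (A.d p.1 p'.1) (Mat.one B p.2 p'.2) +
    Int.negOnePow (A.h p.1) • Hom.hcomp (Mat.one A p.1 p'.1) (B.d p.2 p'.2)

/-- `Tr(A)`. -/
def trace (A : Cx n n) : Cx 0 0 := ⟨A.I, A.h, A.q, fun i => .trace (A.o i), fun i j => Hom.trace (A.d i j)⟩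

/-- `A^∨`: all diagrams are reflected, all degrees reversed, and the differential is `-(d_A)^∨`, where
`(f^∨)_i = (-1)^(i |f|) (f_(-i-|f|))^∨`. -/
def dual (A : Cx m n) : Cx n m where
  I := A.I
  h i := -A.h i
  q i := -A.q i
  o i := .dual (A.o i)
  d i j := -(Int.negOnePow (-A.h i) • Hom.dual (A.d j i))

/-- `A` kills turnbacks from above and from below. -/
def KillsTurnbacks : {n : ℕ} → Cx n n → Prop
  | 0, _ => True
  | 1, _ => True
  | n + 2, A => ∀ i : Fin (n + 1),
      (tensor (single (.cap i)) A).Contractible ∧ (tensor A (single (.cup i))).Contractible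

end Cx

/-- The complex `∅`. -/
abbrev empty : Cx 0 0 := .single (.id 0)

/-- Universal projectors on `n` strands: complexes of finite sums of shifted diagrams, concentrated in
non-positive homological degrees, that kill turnbacks, have chain group `1_n` (spanned by the index
`z`) in degree zero, and do not contain `1_n` (with any shift, with or without additional circles)
elsewhere. -/
structure UniversalProjector (n : ℕ) extends Cx n n where
  isComplex : toCx.IsComplex
  finite : ∀ k, {i | h i = k}.Finite
  nonpos : ∀ i, h i ≤ 0
  z : I
  z_q : q z = 0
  z_o : o z = .id n
  degree_zero : ∀ i, h i = 0 ↔ i = z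
  not_id : ∀ i, i ≠ z → ∃ j : Fin n,
    (o i).strand ((o i).curve.top j) ≠ (o i).strand ((o i).curve.bot j)
  kills : toCx.KillsTurnbacks

namespace UniversalProjector

variable {n : ℕ} (P : UniversalProjector n)

open Classical in
/-- The inclusion `ι : 1_n → P` of the chain group in degree zero. -/
def iota : Mat (.single (.id n)) P.toCx :=
  fun _ i => if h : i = P.z then Hom.iso (.ofEq (by rw [h, P.z_o]; rfl)) else 0

/-- The inclusion `1_n = 1_n ⊗ 1_n → P ⊗ P` of the chain group in degree zero. -/
def iotaTensor : Mat (.single (.id n)) (P.toCx.tensor P.toCx) :=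
  fun u p => Hom.comp (Hom.iso (Isotopy.rightUnit (.id n)).symm)
    (Hom.hcomp (P.iota u p.1) (P.iota u p.2))

/-- A standard equivalence `μ : P ⊗ P → P`. -/
def IsStandard (μ : Mat (P.toCx.tensor P.toCx) P.toCx) : Prop :=
  IsHomotopyEquiv μ ∧ Mat.comp P.iotaTensor μ = P.iota

/-- `q^n Tr(P)`. -/
abbrev unknot : Cx 0 0 := P.toCx.trace.qshift n

/-- `q^n Tr(P ⊗ P^∨)`, formed with direct products. -/
abbrev dualUnknot : Cx 0 0 := (P.toCx.tensor P.toCx.dual).trace.qshift n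

/-- `η : ∅ → q^n Tr(P)`: `n` parallel disks, followed by `Tr(ι)`. -/
def eta : Mat empty P.unknot :=
  fun _ i => Hom.comp (cob (.disks n)) (Hom.trace (P.iota () i))

/-- `φ(f) = Tr(f) ∘ η`. -/
def phi (f : Mat P.toCx P.toCx) : Mat empty P.unknot :=
  fun u j => ∑ᶠ i, Hom.comp (P.eta u i) (Hom.trace (f i j))

/-- The composite `P → Tr(P) ⊔ P → P ⊗ P` of `ζ ⊔ 1` and of `n` parallel saddles. -/
def saddleMap (ζ : Mat empty P.unknot) : Mat P.toCx (P.toCx.tensor P.toCx) :=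
  fun i p => Hom.comp (Hom.comp (Hom.iso (.emptyBeside (P.o i)))
    (Hom.beside (ζ () p.1) (Mat.one P.toCx i p.2))) (cob (.merge (P.o p.1) (P.o p.2)))

/-- `ψ(ζ)`: the saddle map followed by the merging of the two projectors. -/
def psi (μ : Mat (P.toCx.tensor P.toCx) P.toCx) (ζ : Mat empty P.unknot) : Mat P.toCx P.toCx :=
  Mat.comp (P.saddleMap ζ) μ

/-- The duality isomorphism `Φ : End(P) → q^n |P ⊗ P^∨⟩`, on matrix entries the bending
`f ↦ Tr(f ⊗ 1) ∘ η_a` of a morphism `f : a → b`. -/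
def duality (f : Mat P.toCx P.toCx) : Mat empty P.dualUnknot :=
  fun _ p => Hom.comp (cob (.coev (P.o p.2))) (Hom.trace (Hom.hcomp (f p.2 p.1) (Hom.one _)))

/-- The absorption map `Ψ = |Tr(1 ⊗ ι^∨)⟩ : q^n |Tr(P ⊗ P^∨)⟩ → q^n |Tr(P ⊗ 1_n^∨)⟩ = q^n |Tr(P)⟩`. -/
def absorb (ζ : Mat empty P.dualUnknot) : Mat empty P.unknot :=
  fun u j => ∑ᶠ i, Hom.comp (ζ u (j, i)) (Hom.trace (Hom.comp
    (Hom.hcomp (Hom.one (P.o j)) (Hom.comp (Hom.dual (P.iota () i)) (Hom.iso (.dualId n))))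
    (Hom.iso (.rightUnit (P.o j)))))

end UniversalProjector

/-! ## Maps between morphism complexes -/

section

variable {m n m' n' : ℕ} {A B : Cx m n} {A' B' : Cx m' n'}

/-- `F` restricts to homomorphisms `Hom^(k,l)(A, B) → Hom^(k+r,l)(A', B')` of abelian groups. -/
def IsGraded (r : ℤ) (F : ℤ → ℤ → Mat A B → Mat A' B') : Prop :=
  ∀ k l, (∀ f ∈ HomBi A B k l, F k l f ∈ HomBi A' B' (k + r) l) ∧
    ∀ f ∈ HomBi A B k l, ∀ g ∈ HomBi A B k l, F k l (f + g) = F k l f + F k l g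

/-- `F` is a chain map `Hom^•(A, B) → Hom^•(A', B')` of bidegree `(0, 0)`. -/
def IsDGMap (F : Mat A B → Mat A' B') : Prop :=
  IsGraded 0 (fun _ _ => F) ∧ ∀ k l, ∀ f ∈ HomBi A B k l, F (diff k f) = diff k (F f)

/-- Chain homotopy, of bidegree `(-1, 0)`, between maps `Hom^•(A, B) → Hom^•(A', B')`. -/
def DGHomotopic (F G : Mat A B → Mat A' B') : Prop :=
  ∃ H : ℤ → ℤ → Mat A B → Mat A' B', IsGraded (-1) H ∧ ∀ k l, ∀ f ∈ HomBi A B k l,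
    F f - G f = diff (k - 1) (H k l f) + H (k + 1) l (diff k f)

/-- `F` and `G` are mutually inverse homotopy equivalences of morphism complexes. -/
def AreHomotopyInverse (F : Mat A B → Mat A' B') (G : Mat A' B' → Mat A B) : Prop :=
  IsDGMap F ∧ IsDGMap G ∧ DGHomotopic (fun f => G (F f)) (fun f => f) ∧
    DGHomotopic (fun g => F (G g)) (fun g => g)

/-- `F` is an isomorphism of morphism complexes. -/
def IsDGIso (F : Mat A B → Mat A' B') : Prop :=
  IsDGMap F ∧ ∀ k l, Set.BijOn F (HomBi A B k l) (HomBi A' B' k l)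

end

end BN

end

/-! The proof has a topological, a homological and a formal layer.

Topology. Surfaces are compared through their sheets: `homeo_of_col` produces a homeomorphism from
two mutually inverse colorings together with identities between weighted counts. This gives all
identities of surfaces that are needed: functoriality and naturality of the planar operations, the
cancellation of disks against saddles (`Hom.disks_merge`, `Hom.disks_beside_merge`), the passage of
a cobordism around a rotated diagram (`Hom.coev_slide`), and the fact that bending a morphism `a →
b` into `∅ → Tr(b ⊗ a^∨)` is invertible (`Hom.unbend_bend`, `Hom.bend_unbend`). Applied to matrix
entries, bending is the isomorphism `Φ`.

Homology. By planarity (`Tangle.exists_turnback`) every summand of `P` other than `1_n` has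
turnbacks. A diagram with a turnback is, up to shift, a retract of one that factors through a cup
(`Hom.exists_turnback_retract`), so `P` kills it. The filtration argument `Cpx.contractible_tensor`
then shows that `P ⊗ P` and the product-total complex `P ⊗ P^∨` retract onto the summand `P ⊗ 1_n`.
For `P ⊗ P` the inclusion of this summand has a strict left inverse, and this makes a standard `μ`.
For `P ⊗ P^∨` the projection is a homotopy equivalence, and composing with its closure is `Ψ`. The
equality `φ = ΨΦ` is `UniversalProjector.phi_eq`: only the entries of `f` that start at `1_n`
matter, and a rotated `1_n` is a family of disks.

Formal part. Since `φ(f)` depends only on `f ∘ ι` and `φ` has a homotopy left inverse, two closed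
endomorphisms of `P` of bidegree `(0, 0)` with the same restriction to `1_n` are homotopic
(`htpc_of_unit_comp`). This settles both remaining points. Disks cancel saddles, so `ψ(η)` restricts
to `μ(ι ⊗ ι) = ι`, and therefore `ψ(η) ≃ 1`. Similarly `φ(ψ(ζ))` is `ζ` followed by the closure of
`μ ∘ (1 ⊗ ι)`, which also restricts to `ι`; hence `φψ ≃ 1`. If `Θ` is a homotopy left inverse of
`φ`, then `ψφ ≃ Θφψφ ≃ Θφ ≃ 1`. -/

noncomputable section

namespace BN

/-! ## Colorings of diagrams and of cobordisms -/

/-! ### Tagged points of diagrams and tagged pieces of surfaces -/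

section Points

variable {X : Type} {m k n : ℕ}

namespace Tangle

/-- All these tags are identity maps. They keep the points of a composite diagram in a normal form
that records the way it was built, so that colorings are evaluated by rewriting and need no
unfolding of `curve` and `surf`. -/
def idPt : Fin n ≃ (Tangle.id n).Pt := Equiv.refl _
def capPt (i : Fin (n + 1)) : Option (Fin n) ≃ (Tangle.cap i).Pt := Equiv.refl _
def cupPt (i : Fin (n + 1)) : Option (Fin n) ≃ (Tangle.cup i).Pt := Equiv.refl _
def compPt {a : Tangle m k} {b : Tangle k n} : a.Pt ⊕ b.Pt ≃ (Tangle.comp a b).Pt := Equiv.refl _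
def tracePt {a : Tangle n n} : a.Pt ≃ (Tangle.trace a).Pt := Equiv.refl _
def besidePt {b : Tangle 0 0} {a : Tangle m n} : b.Pt ⊕ a.Pt ≃ (Tangle.beside b a).Pt :=
  Equiv.refl _
def dualPt {a : Tangle m n} : a.Pt ≃ (Tangle.dual a).Pt := Equiv.refl _

@[simp] theorem top_id (j : Fin n) : (Tangle.id n).curve.top j = idPt j := rfl
@[simp] theorem bot_id (j : Fin n) : (Tangle.id n).curve.bot j = idPt j := rfl
@[simp] theorem top_cap (i : Fin (n + 1)) (j) : (Tangle.cap i).curve.top j = capPt i (some j) := rfl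
@[simp] theorem bot_cap (i : Fin (n + 1)) (j) :
    (Tangle.cap i).curve.bot j = capPt i (pinch i j) := rfl
@[simp] theorem top_cup (i : Fin (n + 1)) (j) :
    (Tangle.cup i).curve.top j = cupPt i (pinch i j) := rfl
@[simp] theorem bot_cup (i : Fin (n + 1)) (j) : (Tangle.cup i).curve.bot j = cupPt i (some j) := rfl
@[simp] theorem top_comp (a : Tangle m k) (b : Tangle k n) (j) :
    (Tangle.comp a b).curve.top j = compPt (.inl (a.curve.top j)) := rfl
@[simp] theorem bot_comp (a : Tangle m k) (b : Tangle k n) (j) :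
    (Tangle.comp a b).curve.bot j = compPt (.inr (b.curve.bot j)) := rfl
@[simp] theorem top_beside (b : Tangle 0 0) (a : Tangle m n) (j) :
    (Tangle.beside b a).curve.top j = besidePt (.inr (a.curve.top j)) := rfl
@[simp] theorem bot_beside (b : Tangle 0 0) (a : Tangle m n) (j) :
    (Tangle.beside b a).curve.bot j = besidePt (.inr (a.curve.bot j)) := rfl
@[simp] theorem top_dual (a : Tangle m n) (j) :
    (Tangle.dual a).curve.top j = dualPt (a.curve.bot j) := rfl
@[simp] theorem bot_dual (a : Tangle m n) (j) :
    (Tangle.dual a).curve.bot j = dualPt (a.curve.top j) := rfl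

@[simp] theorem forall_id {p : (Tangle.id n).Pt → Prop} : (∀ x, p x) ↔ ∀ j, p (idPt j) := Iff.rfl
@[simp] theorem forall_cap {i : Fin (n + 1)} {p : (Tangle.cap i).Pt → Prop} :
    (∀ x, p x) ↔ p (capPt i none) ∧ ∀ j, p (capPt i (some j)) := Option.forall
@[simp] theorem forall_cup {i : Fin (n + 1)} {p : (Tangle.cup i).Pt → Prop} :
    (∀ x, p x) ↔ p (cupPt i none) ∧ ∀ j, p (cupPt i (some j)) := Option.forall
@[simp] theorem forall_comp {a : Tangle m k} {b : Tangle k n} {p : (Tangle.comp a b).Pt → Prop} :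
    (∀ x, p x) ↔ (∀ x, p (compPt (.inl x))) ∧ ∀ x, p (compPt (.inr x)) := Sum.forall
@[simp] theorem forall_trace {a : Tangle n n} {p : (Tangle.trace a).Pt → Prop} :
    (∀ x, p x) ↔ ∀ x, p (tracePt x) := Iff.rfl
@[simp] theorem forall_beside {b : Tangle 0 0} {a : Tangle m n} {p : (Tangle.beside b a).Pt → Prop} :
    (∀ x, p x) ↔ (∀ x, p (besidePt (.inl x))) ∧ ∀ x, p (besidePt (.inr x)) := Sum.forall
@[simp] theorem forall_dual {a : Tangle m n} {p : (Tangle.dual a).Pt → Prop} :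
    (∀ x, p x) ↔ ∀ x, p (dualPt x) := Iff.rfl

def compElim {a : Tangle m k} {b : Tangle k n} (u : a.Pt → X) (v : b.Pt → X)
    (x : (Tangle.comp a b).Pt) : X := Sum.elim u v (compPt.symm x)
@[simp] theorem compElim_inl {a : Tangle m k} {b : Tangle k n} (u : a.Pt → X) (v : b.Pt → X) (x) :
    compElim u v (compPt (.inl x)) = u x := rfl
@[simp] theorem compElim_inr {a : Tangle m k} {b : Tangle k n} (u : a.Pt → X) (v : b.Pt → X) (x) :
    compElim u v (compPt (.inr x)) = v x := rfl
def besideElim {b : Tangle 0 0} {a : Tangle m n} (u : b.Pt → X) (v : a.Pt → X)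
    (x : (Tangle.beside b a).Pt) : X := Sum.elim u v (besidePt.symm x)
@[simp] theorem besideElim_inl {b : Tangle 0 0} {a : Tangle m n} (u : b.Pt → X) (v : a.Pt → X) (x) :
    besideElim u v (besidePt (.inl x)) = u x := rfl
@[simp] theorem besideElim_inr {b : Tangle 0 0} {a : Tangle m n} (u : b.Pt → X) (v : a.Pt → X) (x) :
    besideElim u v (besidePt (.inr x)) = v x := rfl

end Tangle

namespace Cob

open Tangle

section

variable {a b d : Tangle m n}

def cylV (e : Isotopy a b) : b.Strand ≃ (Cob.cyl e).surf.V := Equiv.refl _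
def dotV (p : a.Pt) : a.Strand ≃ (Cob.dot a p).surf.V := Equiv.refl _
def birthV (i : Fin (n + 1)) : Option (Fin n) ≃ (Cob.birth i).surf.V := Equiv.refl _
def deathV (i : Fin (n + 1)) : Option (Fin n) ≃ (Cob.death i).surf.V := Equiv.refl _
def disksV : Fin n ≃ (Cob.disks n).surf.V := Equiv.refl _
def mergeV {a : Tangle n n} {b : Tangle n k} : a.Pt ⊕ b.Pt ≃ (Cob.merge a b).surf.V := Equiv.refl _
def coevV : a.Strand ≃ (Cob.coev a).surf.V := Equiv.refl _
def compV {f : Cob a b} {g : Cob b d} : f.surf.V ⊕ g.surf.V ≃ (f.comp g).surf.V := Equiv.refl _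
def hcompV {a a' : Tangle m k} {b b' : Tangle k n} {f : Cob a a'} {g : Cob b b'} :
    f.surf.V ⊕ g.surf.V ≃ (f.hcomp g).surf.V := Equiv.refl _
def traceV {a b : Tangle n n} {f : Cob a b} : f.surf.V ≃ f.trace.surf.V := Equiv.refl _
def besideV {c c' : Tangle 0 0} {f : Cob c c'} {g : Cob a b} :
    f.surf.V ⊕ g.surf.V ≃ (f.beside g).surf.V := Equiv.refl _
def dualV {f : Cob a b} : f.surf.V ≃ f.dual.surf.V := Equiv.refl _

@[simp] theorem src_cyl (e : Isotopy a b) (x) :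
    (Cob.cyl e).surf.src x = cylV e (e.equiv (Quot.mk _ x)) := rfl
@[simp] theorem tgt_cyl (e : Isotopy a b) (x) : (Cob.cyl e).surf.tgt x = cylV e (Quot.mk _ x) := rfl
@[simp] theorem src_dot (p x : a.Pt) : (Cob.dot a p).surf.src x = dotV p (Quot.mk _ x) := rfl
@[simp] theorem tgt_dot (p x : a.Pt) : (Cob.dot a p).surf.tgt x = dotV p (Quot.mk _ x) := rfl
@[simp] theorem src_birth (i : Fin (n + 1)) (x) :
    (Cob.birth i).surf.src (idPt x) = birthV i (some x) := rfl
@[simp] theorem tgt_birth_inl (i : Fin (n + 1)) (x) :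
    (Cob.birth i).surf.tgt (compPt (.inl (capPt i x))) = birthV i x := rfl
@[simp] theorem tgt_birth_inr (i : Fin (n + 1)) (x) :
    (Cob.birth i).surf.tgt (compPt (.inr (cupPt i x))) = birthV i x := rfl
@[simp] theorem tgt_death (i : Fin (n + 1)) (x) :
    (Cob.death i).surf.tgt (idPt x) = deathV i (some x) := rfl
@[simp] theorem src_death_inl (i : Fin (n + 1)) (x) :
    (Cob.death i).surf.src (compPt (.inl (capPt i x))) = deathV i x := rfl
@[simp] theorem src_death_inr (i : Fin (n + 1)) (x) :
    (Cob.death i).surf.src (compPt (.inr (cupPt i x))) = deathV i x := rfl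
@[simp] theorem tgt_disks (x : Fin n) : (Cob.disks n).surf.tgt (tracePt (idPt x)) = disksV x := rfl
@[simp] theorem src_merge_inl (a : Tangle n n) (b : Tangle n k) (x) :
    (Cob.merge a b).surf.src (besidePt (.inl (tracePt x))) = mergeV (.inl x) := rfl
@[simp] theorem src_merge_inr (a : Tangle n n) (b : Tangle n k) (x) :
    (Cob.merge a b).surf.src (besidePt (.inr x)) = mergeV (.inr x) := rfl
@[simp] theorem tgt_merge (a : Tangle n n) (b : Tangle n k) (x) :
    (Cob.merge a b).surf.tgt (compPt x) = mergeV x := rfl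
@[simp] theorem tgt_coev_inl (a : Tangle m n) (x) :
    (Cob.coev a).surf.tgt (tracePt (compPt (.inl x))) = coevV (Quot.mk _ x) := rfl
@[simp] theorem tgt_coev_inr (a : Tangle m n) (x) :
    (Cob.coev a).surf.tgt (tracePt (compPt (.inr (dualPt x)))) = coevV (Quot.mk _ x) := rfl
@[simp] theorem src_comp (f : Cob a b) (g : Cob b d) (x) :
    (f.comp g).surf.src x = compV (.inl (f.surf.src x)) := rfl
@[simp] theorem tgt_comp (f : Cob a b) (g : Cob b d) (x) :
    (f.comp g).surf.tgt x = compV (.inr (g.surf.tgt x)) := rfl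
@[simp] theorem src_hcomp {a a' : Tangle m k} {b b' : Tangle k n} (f : Cob a a') (g : Cob b b') (x) :
    (f.hcomp g).surf.src (compPt x) = hcompV (Sum.map f.surf.src g.surf.src x) := rfl
@[simp] theorem tgt_hcomp {a a' : Tangle m k} {b b' : Tangle k n} (f : Cob a a') (g : Cob b b') (x) :
    (f.hcomp g).surf.tgt (compPt x) = hcompV (Sum.map f.surf.tgt g.surf.tgt x) := rfl
@[simp] theorem src_trace {a b : Tangle n n} (f : Cob a b) (x) :
    f.trace.surf.src (tracePt x) = traceV (f.surf.src x) := rfl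
@[simp] theorem tgt_trace {a b : Tangle n n} (f : Cob a b) (x) :
    f.trace.surf.tgt (tracePt x) = traceV (f.surf.tgt x) := rfl
@[simp] theorem src_beside {c c' : Tangle 0 0} (f : Cob c c') (g : Cob a b) (x) :
    (f.beside g).surf.src (besidePt x) = besideV (Sum.map f.surf.src g.surf.src x) := rfl
@[simp] theorem tgt_beside {c c' : Tangle 0 0} (f : Cob c c') (g : Cob a b) (x) :
    (f.beside g).surf.tgt (besidePt x) = besideV (Sum.map f.surf.tgt g.surf.tgt x) := rfl
@[simp] theorem src_dual (f : Cob a b) (x) :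
    f.dual.surf.src (dualPt x) = dualV (f.surf.tgt x) := rfl
@[simp] theorem tgt_dual (f : Cob a b) (x) :
    f.dual.surf.tgt (dualPt x) = dualV (f.surf.src x) := rfl

@[simp] theorem forall_cyl {e : Isotopy a b} {p : (Cob.cyl e).surf.V → Prop} :
    (∀ x, p x) ↔ ∀ x, p (cylV e (Quot.mk _ x)) := ⟨fun h _ => h _, fun h => by rintro ⟨x⟩; exact h x⟩
@[simp] theorem forall_disksV {p : (Cob.disks n).surf.V → Prop} :
    (∀ x, p x) ↔ ∀ j, p (disksV j) := Iff.rfl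
@[simp] theorem forall_mergeV {a : Tangle n n} {b : Tangle n k} {p : (Cob.merge a b).surf.V → Prop} :
    (∀ x, p x) ↔ (∀ x, p (mergeV (.inl x))) ∧ ∀ x, p (mergeV (.inr x)) := Sum.forall
@[simp] theorem forall_coevV {p : (Cob.coev a).surf.V → Prop} :
    (∀ x, p x) ↔ ∀ x, p (coevV (Quot.mk _ x)) := ⟨fun h _ => h _, fun h => by rintro ⟨x⟩; exact h x⟩
@[simp] theorem forall_compV {f : Cob a b} {g : Cob b d} {p : (f.comp g).surf.V → Prop} :
    (∀ x, p x) ↔ (∀ x, p (compV (.inl x))) ∧ ∀ x, p (compV (.inr x)) := Sum.forall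
@[simp] theorem forall_hcompV {a a' : Tangle m k} {b b' : Tangle k n} {f : Cob a a'} {g : Cob b b'}
    {p : (f.hcomp g).surf.V → Prop} :
    (∀ x, p x) ↔ (∀ x, p (hcompV (.inl x))) ∧ ∀ x, p (hcompV (.inr x)) := Sum.forall
@[simp] theorem forall_traceV {a b : Tangle n n} {f : Cob a b} {p : f.trace.surf.V → Prop} :
    (∀ x, p x) ↔ ∀ x, p (traceV x) := Iff.rfl
@[simp] theorem forall_besideV {c c' : Tangle 0 0} {f : Cob c c'} {g : Cob a b}
    {p : (f.beside g).surf.V → Prop} :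
    (∀ x, p x) ↔ (∀ x, p (besideV (.inl x))) ∧ ∀ x, p (besideV (.inr x)) := Sum.forall
@[simp] theorem forall_dualV {f : Cob a b} {p : f.dual.surf.V → Prop} :
    (∀ x, p x) ↔ ∀ x, p (dualV x) := Iff.rfl

def compElim {f : Cob a b} {g : Cob b d} (u : f.surf.V → X) (v : g.surf.V → X)
    (x : (f.comp g).surf.V) : X := Sum.elim u v (compV.symm x)
@[simp] theorem compElim_inl {f : Cob a b} {g : Cob b d} (u : f.surf.V → X) (v : g.surf.V → X) (x) :
    compElim u v (compV (.inl x)) = u x := rfl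
@[simp] theorem compElim_inr {f : Cob a b} {g : Cob b d} (u : f.surf.V → X) (v : g.surf.V → X) (x) :
    compElim u v (compV (.inr x)) = v x := rfl
def hcompElim {a a' : Tangle m k} {b b' : Tangle k n} {f : Cob a a'} {g : Cob b b'}
    (u : f.surf.V → X) (v : g.surf.V → X) (x : (f.hcomp g).surf.V) : X :=
  Sum.elim u v (hcompV.symm x)
@[simp] theorem hcompElim_inl {a a' : Tangle m k} {b b' : Tangle k n} {f : Cob a a'} {g : Cob b b'}
    (u : f.surf.V → X) (v : g.surf.V → X) (x) : hcompElim u v (hcompV (.inl x)) = u x := rfl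
@[simp] theorem hcompElim_inr {a a' : Tangle m k} {b b' : Tangle k n} {f : Cob a a'} {g : Cob b b'}
    (u : f.surf.V → X) (v : g.surf.V → X) (x) : hcompElim u v (hcompV (.inr x)) = v x := rfl
def besideElim {c c' : Tangle 0 0} {f : Cob c c'} {g : Cob a b}
    (u : f.surf.V → X) (v : g.surf.V → X) (x : (f.beside g).surf.V) : X :=
  Sum.elim u v (besideV.symm x)
@[simp] theorem besideElim_inl {c c' : Tangle 0 0} {f : Cob c c'} {g : Cob a b}
    (u : f.surf.V → X) (v : g.surf.V → X) (x) : besideElim u v (besideV (.inl x)) = u x := rfl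
@[simp] theorem besideElim_inr {c c' : Tangle 0 0} {f : Cob c c'} {g : Cob a b}
    (u : f.surf.V → X) (v : g.surf.V → X) (x) : besideElim u v (besideV (.inr x)) = v x := rfl
def mergeElim {a : Tangle n n} {b : Tangle n k} (u : a.Pt → X) (v : b.Pt → X)
    (x : (Cob.merge a b).surf.V) : X := Sum.elim u v (mergeV.symm x)
@[simp] theorem mergeElim_inl {a : Tangle n n} {b : Tangle n k} (u : a.Pt → X) (v : b.Pt → X) (x) :
    mergeElim u v (mergeV (.inl x)) = u x := rfl
@[simp] theorem mergeElim_inr {a : Tangle n n} {b : Tangle n k} (u : a.Pt → X) (v : b.Pt → X) (x) :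
    mergeElim u v (mergeV (.inr x)) = v x := rfl

end

end Cob

end Points

/-! ### Colorings as maps out of the set of components, and integrals along surfaces -/

section Coloring

open Tangle Cob

variable {X : Type} {m k n : ℕ}

/-- `c` is constant on the components of `a`. -/
def Tangle.IsCol (a : Tangle m n) (c : a.Pt → X) : Prop := ∀ ⦃x y⦄, a.curve.adj x y → c x = c y

/-- The function on components induced by a coloring. -/
def Tangle.desc (a : Tangle m n) (c : a.Pt → X) (h : a.IsCol c) : a.Strand → X := Quot.lift c h

@[simp] theorem Tangle.desc_mk (a : Tangle m n) (c : a.Pt → X) (h : a.IsCol c) (x : a.Pt) :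
    a.desc c h (Quot.mk _ x) = c x := rfl

theorem Tangle.isCol_strand (a : Tangle m n) (g : a.Strand → X) :
    a.IsCol fun x => g (Quot.mk _ x) := fun _ _ h => congrArg g (Quot.sound h)

@[simp] theorem Tangle.isCol_id (c : (Tangle.id n).Pt → X) : (Tangle.id n).IsCol c ↔ True :=
  iff_true_intro fun _ _ h => h.elim

@[simp] theorem Tangle.isCol_cap (i : Fin (n + 1)) (c : (Tangle.cap i).Pt → X) :
    (Tangle.cap i).IsCol c ↔ True := iff_true_intro fun _ _ h => h.elim

@[simp] theorem Tangle.isCol_cup (i : Fin (n + 1)) (c : (Tangle.cup i).Pt → X) :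
    (Tangle.cup i).IsCol c ↔ True := iff_true_intro fun _ _ h => h.elim

@[simp] theorem Tangle.isCol_comp (a : Tangle m k) (b : Tangle k n) (c : (Tangle.comp a b).Pt → X) :
    (Tangle.comp a b).IsCol c ↔ a.IsCol (fun x => c (compPt (.inl x))) ∧ b.IsCol (fun x => c (compPt (.inr x))) ∧
      ∀ j, c (compPt (.inl (a.curve.bot j))) = c (compPt (.inr (b.curve.top j))) := by
  refine ⟨fun h => ⟨fun _ _ e => h (GlueAdj.left e), fun _ _ e => h (GlueAdj.right e),
    fun j => h (GlueAdj.glue j)⟩, ?_⟩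
  rintro ⟨h1, h2, h3⟩ _ _ (e | e | j)
  exacts [h1 e, h2 e, h3 j]

@[simp] theorem Tangle.isCol_trace (a : Tangle n n) (c : (Tangle.trace a).Pt → X) :
    (Tangle.trace a).IsCol c ↔ a.IsCol (fun x => c (tracePt x)) ∧
      ∀ i, c (tracePt (a.curve.top i)) = c (tracePt (a.curve.bot i)) := by
  refine ⟨fun h => ⟨fun _ _ e => h (TraceAdj.old e), fun j => h (TraceAdj.close j)⟩, ?_⟩
  rintro ⟨h1, h3⟩ _ _ (e | j)
  exacts [h1 e, h3 j]

@[simp] theorem Tangle.isCol_beside (b : Tangle 0 0) (a : Tangle m n)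
    (c : (Tangle.beside b a).Pt → X) :
    (Tangle.beside b a).IsCol c ↔ b.IsCol (fun x => c (besidePt (.inl x))) ∧ a.IsCol (fun x => c (besidePt (.inr x))) := by
  refine ⟨fun h => ⟨fun _ _ e => h (Sum.LiftRel.inl e), fun _ _ e => h (Sum.LiftRel.inr e)⟩, ?_⟩
  rintro ⟨h1, h3⟩ _ _ (e | e)
  exacts [h1 e, h3 e]

@[simp] theorem Tangle.isCol_dual (a : Tangle m n) (c : (Tangle.dual a).Pt → X) :
    (Tangle.dual a).IsCol c ↔ a.IsCol (fun x => c (dualPt x)) := Iff.rfl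

/-- Isotopies from mutually inverse colorings. -/
def Isotopy.ofCol {a b : Tangle m n} (θ : a.Pt → b.Strand) (θ' : b.Pt → a.Strand)
    (hθ : a.IsCol θ) (hθ' : b.IsCol θ') (h1 : ∀ x, b.desc θ' hθ' (θ x) = a.strand x)
    (h2 : ∀ x, a.desc θ hθ (θ' x) = b.strand x)
    (ht : ∀ j, θ (a.curve.top j) = b.strand (b.curve.top j))
    (hb : ∀ j, θ (a.curve.bot j) = b.strand (b.curve.bot j)) : Isotopy a b where
  equiv := ⟨a.desc θ hθ, b.desc θ' hθ', by rintro ⟨x⟩; exact h1 x, by rintro ⟨x⟩; exact h2 x⟩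
  top := ht
  bot := hb

instance Cob.finite_V {a b : Tangle m n} (f : Cob a b) : Finite f.surf.V := f.surf.fin
instance Tangle.finite_pt (a : Tangle m n) : Finite a.Pt := a.curve.fin

/-- `c` is constant on the components of the surface. -/
def Cob.IsCol {a b : Tangle m n} (f : Cob a b) (c : f.surf.V → X) : Prop :=
  ∀ ⦃x y⦄, f.surf.adj x y → c x = c y

/-- The function on components induced by a coloring. -/
def Cob.desc {a b : Tangle m n} (f : Cob a b) (c : f.surf.V → X) (h : f.IsCol c) : f.Sheet → X :=
  Quot.lift c h

@[simp] theorem Cob.desc_mk {a b : Tangle m n} (f : Cob a b) (c : f.surf.V → X) (h : f.IsCol c)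
    (x : f.surf.V) : f.desc c h (Quot.mk _ x) = c x := rfl

theorem Cob.isCol_sheet {a b : Tangle m n} (f : Cob a b) :
    f.IsCol fun x => f.sheet x := fun _ _ h => Quot.sound h

@[simp] theorem Cob.isCol_cyl {a b : Tangle m n} (e : Isotopy a b) (c : (Cob.cyl e).surf.V → X) :
    (Cob.cyl e).IsCol c ↔ True := iff_true_intro fun _ _ h => h.elim
@[simp] theorem Cob.isCol_disks (c : (Cob.disks n).surf.V → X) :
    (Cob.disks n).IsCol c ↔ True := iff_true_intro fun _ _ h => h.elim
@[simp] theorem Cob.isCol_coev (a : Tangle m n) (c : (Cob.coev a).surf.V → X) :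
    (Cob.coev a).IsCol c ↔ True := iff_true_intro fun _ _ h => h.elim

@[simp] theorem Cob.isCol_merge (a : Tangle n n) (b : Tangle n k) (c : (Cob.merge a b).surf.V → X) :
    (Cob.merge a b).IsCol c ↔ a.IsCol (fun x => c (mergeV (.inl x))) ∧ b.IsCol (fun x => c (mergeV (.inr x))) ∧
      (∀ j, c (mergeV (.inl (a.curve.bot j))) = c (mergeV (.inr (b.curve.top j)))) ∧
      ∀ j, c (mergeV (.inl (a.curve.top j))) = c (mergeV (.inl (a.curve.bot j))) := by
  refine ⟨fun h => ⟨fun _ _ e => h (MergeAdj.stack (GlueAdj.left e)),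
    fun _ _ e => h (MergeAdj.stack (GlueAdj.right e)),
    fun j => h (MergeAdj.stack (GlueAdj.glue j)), fun j => h (MergeAdj.close j)⟩, ?_⟩
  rintro ⟨h1, h2, h3, h4⟩ _ _ ((e | e | j) | j)
  exacts [h1 e, h2 e, h3 j, h4 j]

@[simp] theorem Cob.isCol_comp {a b d : Tangle m n} (f : Cob a b) (g : Cob b d)
    (c : (Cob.comp f g).surf.V → X) :
    (Cob.comp f g).IsCol c ↔ f.IsCol (fun x => c (compV (.inl x))) ∧ g.IsCol (fun x => c (compV (.inr x))) ∧
      ∀ x, c (compV (.inl (f.surf.tgt x))) = c (compV (.inr (g.surf.src x))) := by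
  refine ⟨fun h => ⟨fun _ _ e => h (StackAdj.left e), fun _ _ e => h (StackAdj.right e),
    fun j => h (StackAdj.glue j)⟩, ?_⟩
  rintro ⟨h1, h2, h3⟩ _ _ (e | e | j)
  exacts [h1 e, h2 e, h3 j]

@[simp] theorem Cob.isCol_hcomp {a a' : Tangle m k} {b b' : Tangle k n} (f : Cob a a')
    (g : Cob b b') (c : (Cob.hcomp f g).surf.V → X) :
    (Cob.hcomp f g).IsCol c ↔ f.IsCol (fun x => c (hcompV (.inl x))) ∧ g.IsCol (fun x => c (hcompV (.inr x))) ∧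
      (∀ j, c (hcompV (.inl (f.surf.src (a.curve.bot j)))) = c (hcompV (.inr (g.surf.src (b.curve.top j))))) ∧
      ∀ j, c (hcompV (.inl (f.surf.tgt (a'.curve.bot j)))) = c (hcompV (.inr (g.surf.tgt (b'.curve.top j)))) := by
  refine ⟨fun h => ⟨fun _ _ e => h (PlaneAdj.left e), fun _ _ e => h (PlaneAdj.right e),
    fun j => h (PlaneAdj.src j), fun j => h (PlaneAdj.tgt j)⟩, ?_⟩
  rintro ⟨h1, h2, h3, h4⟩ _ _ (e | e | j | j)
  exacts [h1 e, h2 e, h3 j, h4 j]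

@[simp] theorem Cob.isCol_trace {a b : Tangle n n} (f : Cob a b) (c : (Cob.trace f).surf.V → X) :
    (Cob.trace f).IsCol c ↔ f.IsCol (fun x => c (traceV x)) ∧
      (∀ j, c (traceV (f.surf.src (a.curve.top j))) = c (traceV (f.surf.src (a.curve.bot j)))) ∧
      ∀ j, c (traceV (f.surf.tgt (b.curve.top j))) = c (traceV (f.surf.tgt (b.curve.bot j))) := by
  refine ⟨fun h => ⟨fun _ _ e => h (CloseAdj.old e), fun j => h (CloseAdj.src j),
    fun j => h (CloseAdj.tgt j)⟩, ?_⟩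
  rintro ⟨h1, h2, h3⟩ _ _ (e | j | j)
  exacts [h1 e, h2 j, h3 j]

@[simp] theorem Cob.isCol_beside {b b' : Tangle 0 0} {a a' : Tangle m n} (f : Cob b b')
    (g : Cob a a') (c : (Cob.beside f g).surf.V → X) :
    (Cob.beside f g).IsCol c ↔ f.IsCol (fun x => c (besideV (.inl x))) ∧ g.IsCol (fun x => c (besideV (.inr x))) := by
  refine ⟨fun h => ⟨fun _ _ e => h (Sum.LiftRel.inl e), fun _ _ e => h (Sum.LiftRel.inr e)⟩, ?_⟩
  rintro ⟨h1, h3⟩ _ _ (e | e)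
  exacts [h1 e, h3 e]

@[simp] theorem Cob.isCol_dual {a b : Tangle m n} (f : Cob a b) (c : (Cob.dual f).surf.V → X) :
    (Cob.dual f).IsCol c ↔ f.IsCol (fun x => c (dualV x)) := Iff.rfl

/-- The boundary conditions satisfied by all colorings of a cobordism. -/
structure Cob.BdCol {a b : Tangle m n} (f : Cob a b) (c : f.surf.V → X) : Prop where
  src : a.IsCol fun x => c (f.surf.src x)
  tgt : b.IsCol fun x => c (f.surf.tgt x)
  top : ∀ j, c (f.surf.src (a.curve.top j)) = c (f.surf.tgt (b.curve.top j))
  bot : ∀ j, c (f.surf.src (a.curve.bot j)) = c (f.surf.tgt (b.curve.bot j))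

/-- Each boundary curve, and each vertical wall over a boundary point, lies in a single sheet. The
induction is needed because a surface records its gluings only where they are made; the walls of a
stacked surface, for instance, are connected through the middle diagram. -/
theorem Cob.IsCol.bd : ∀ {m n : ℕ} {a b : Tangle m n} {f : Cob a b} {c : f.surf.V → X},
    f.IsCol c → f.BdCol c
  | _, _, a, b, .cyl e, c, _ =>
    ⟨fun _ _ h => congrArg (fun s => c (e.equiv s)) (Quot.sound h),
      fun _ _ h => congrArg c (Quot.sound h), fun j => congrArg c (e.top j),
      fun j => congrArg c (e.bot j)⟩
  | _, _, _, _, .dot a p, c, _ =>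
    ⟨fun _ _ h => congrArg c (Quot.sound h),
      fun _ _ h => congrArg c (Quot.sound h), fun _ => rfl, fun _ => rfl⟩
  | _, _, _, _, .birth i, c, _ =>
    ⟨fun _ _ h => h.elim, by rintro _ _ (h | h | j); exacts [h.elim, h.elim, rfl],
      fun _ => rfl, fun _ => rfl⟩
  | _, _, _, _, .death i, c, _ =>
    ⟨by rintro _ _ (h | h | j); exacts [h.elim, h.elim, rfl], fun _ _ h => h.elim,
      fun _ => rfl, fun _ => rfl⟩
  | _, _, _, _, .saddle i, c, _ =>
    ⟨fun _ _ h => h.elim, by rintro _ _ (h | h | j); exacts [h.elim, h.elim, rfl],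
      fun _ => rfl, fun _ => rfl⟩
  | _, _, _, _, .unsaddle i, c, _ =>
    ⟨by rintro _ _ (h | h | j); exacts [h.elim, h.elim, rfl], fun _ _ h => h.elim,
      fun _ => rfl, fun _ => rfl⟩
  | _, _, _, _, .disks n, c, _ =>
    ⟨fun _ _ h => h.elim, by rintro _ _ (h | j); exacts [h.elim, rfl],
      fun j => j.elim0, fun j => j.elim0⟩
  | _, _, _, _, .merge a b, c, h => by
    obtain ⟨h1, h2, h3, h4⟩ := (Cob.isCol_merge a b c).1 h
    exact ⟨(Tangle.isCol_beside _ _ _).2 ⟨(Tangle.isCol_trace _ _).2 ⟨h1, h4⟩, h2⟩,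
      (Tangle.isCol_comp _ _ _).2 ⟨h1, h2, h3⟩, fun j => ((h4 j).trans (h3 j)).symm,
      fun j => rfl⟩
  | _, _, _, _, .coev a, c, _ =>
    ⟨fun _ _ h => h.elim, (Tangle.isCol_trace _ _).2 ⟨(Tangle.isCol_comp _ _ _).2
      ⟨fun _ _ h => congrArg c (Quot.sound h), fun _ _ h => congrArg c (Quot.sound h),
      fun _ => rfl⟩, fun _ => rfl⟩, fun j => j.elim0, fun j => j.elim0⟩
  | _, _, _, _, .comp f g, c, h => by
    obtain ⟨h1, h2, h3⟩ := (Cob.isCol_comp f g c).1 h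
    exact ⟨h1.bd.src, h2.bd.tgt, fun j => (h1.bd.top j).trans ((h3 _).trans (h2.bd.top j)),
      fun j => (h1.bd.bot j).trans ((h3 _).trans (h2.bd.bot j))⟩
  | _, _, _, _, .hcomp f g, c, h => by
    obtain ⟨h1, h2, h3, h4⟩ := (Cob.isCol_hcomp f g c).1 h
    exact ⟨(Tangle.isCol_comp _ _ _).2 ⟨h1.bd.src, h2.bd.src, h3⟩,
      (Tangle.isCol_comp _ _ _).2 ⟨h1.bd.tgt, h2.bd.tgt, h4⟩, h1.bd.top, h2.bd.bot⟩
  | _, _, _, _, .trace f, c, h => by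
    obtain ⟨h1, h2, h3⟩ := (Cob.isCol_trace f c).1 h
    exact ⟨(Tangle.isCol_trace _ _).2 ⟨h1.bd.src, h2⟩, (Tangle.isCol_trace _ _).2 ⟨h1.bd.tgt, h3⟩,
      fun j => j.elim0, fun j => j.elim0⟩
  | _, _, _, _, .beside f g, c, h => by
    obtain ⟨h1, h2⟩ := (Cob.isCol_beside f g c).1 h
    exact ⟨(Tangle.isCol_beside _ _ _).2 ⟨h1.bd.src, h2.bd.src⟩,
      (Tangle.isCol_beside _ _ _).2 ⟨h1.bd.tgt, h2.bd.tgt⟩, h2.bd.top, h2.bd.bot⟩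
  | _, _, _, _, .dual f, c, h =>
    have h1 := ((Cob.isCol_dual f c).1 h).bd
    ⟨h1.tgt, h1.src, fun j => (h1.bot j).symm, fun j => (h1.top j).symm⟩

/-! ## Integrals of weights and numbers of dots -/

theorem finsum_sum_type {α β M : Type} [Finite α] [Finite β] [AddCommMonoid M] (f : α ⊕ β → M) :
    ∑ᶠ x, f x = ∑ᶠ x, f (.inl x) + ∑ᶠ x, f (.inr x) := by
  have := Fintype.ofFinite α
  have := Fintype.ofFinite β
  simp [finsum_eq_sum_of_fintype]

/-- The integral of a function against the weights. -/
def Cob.wtInt {a b : Tangle m n} (f : Cob a b) (g : f.surf.V → ℤ) : ℤ := ∑ᶠ v, f.surf.wt v * g v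

/-- The integral of a function against the dots. -/
def Cob.dotInt {a b : Tangle m n} (f : Cob a b) (g : f.surf.V → ℤ) : ℤ :=
  ∑ᶠ v, (f.surf.dots v : ℤ) * g v

section

variable {a b : Tangle m n}

@[simp] theorem Cob.wtInt_cyl (e : Isotopy a b) (g) : (Cob.cyl e).wtInt g = 0 := by
  simp [wtInt, Cob.surf]
@[simp] theorem Cob.dotInt_cyl (e : Isotopy a b) (g) : (Cob.cyl e).dotInt g = 0 := by
  simp [dotInt, Cob.surf]
@[simp] theorem Cob.wtInt_dot (p : a.Pt) (g) : (Cob.dot a p).wtInt g = 0 := by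
  simp [wtInt, Cob.surf]
@[simp] theorem Cob.dotInt_dot (p : a.Pt) (g : (Cob.dot a p).surf.V → ℤ) :
    (Cob.dot a p).dotInt g = g (dotV p (a.strand p)) := by
  classical
  refine (finsum_eq_single _ (a.strand p) ?_).trans ?_
  · intro x hx
    have : (Cob.dot a p).surf.dots x = 0 := if_neg hx
    simp [this]
  · have : (Cob.dot a p).surf.dots (a.strand p) = 1 := if_pos rfl
    simp [this]; rfl
@[simp] theorem Cob.wtInt_birth (i : Fin (n + 1)) (g : (Cob.birth i).surf.V → ℤ) :
    (Cob.birth i).wtInt g = g (birthV i none) := by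
  refine (finsum_eq_single _ none ?_).trans ?_
  · intro x hx
    have : (Cob.birth i).surf.wt x = 0 := if_neg hx
    simp [this]
  · have : (Cob.birth i).surf.wt none = 1 := by simp [Cob.surf]
    simp [this]; rfl
@[simp] theorem Cob.wtInt_death (i : Fin (n + 1)) (g : (Cob.death i).surf.V → ℤ) :
    (Cob.death i).wtInt g = g (deathV i none) := by
  refine (finsum_eq_single _ none ?_).trans ?_
  · intro x hx
    have : (Cob.death i).surf.wt x = 0 := if_neg hx
    simp [this]
  · have : (Cob.death i).surf.wt none = 1 := by simp [Cob.surf]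
    simp [this]; rfl
@[simp] theorem Cob.dotInt_birth (i : Fin (n + 1)) (g) : (Cob.birth i).dotInt g = 0 := by
  simp [dotInt, Cob.surf]
@[simp] theorem Cob.dotInt_death (i : Fin (n + 1)) (g) : (Cob.death i).dotInt g = 0 := by
  simp [dotInt, Cob.surf]
@[simp] theorem Cob.wtInt_disks (g : (Cob.disks n).surf.V → ℤ) :
    (Cob.disks n).wtInt g = ∑ j, g (disksV j) := by
  refine (finsum_congr fun x => ?_).trans (finsum_eq_sum_of_fintype (α := Fin n) g)
  exact one_mul _
@[simp] theorem Cob.dotInt_disks (g) : (Cob.disks n).dotInt g = 0 := by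
  simp [dotInt, Cob.surf]
@[simp] theorem Cob.dotInt_coev (a : Tangle m n) (g) : (Cob.coev a).dotInt g = 0 := by
  simp [dotInt, Cob.surf]
@[simp] theorem Cob.dotInt_merge (a : Tangle n n) (b : Tangle n k) (g) :
    (Cob.merge a b).dotInt g = 0 := by
  simp [dotInt, Cob.surf]

/-- Weights that count the points of a fiber integrate to a sum along the map. This evaluates the
weights of `merge` and `coev`, which count boundary points. -/
theorem finsum_card_fiber_mul {ι α : Type} [Fintype ι] [Finite α] (u : ι → α) (g : α → ℤ) :
    ∑ᶠ v, (Nat.card {j : ι // u j = v} : ℤ) * g v = ∑ j, g (u j) := by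
  classical
  have := Fintype.ofFinite α
  rw [finsum_eq_sum_of_fintype, ← Finset.sum_fiberwise (s := Finset.univ) (g := u)]
  refine Finset.sum_congr rfl fun v _ => ?_
  rw [Finset.sum_congr rfl (g := fun _ => g v) (by simp +contextual), Finset.sum_const,
    Nat.card_eq_fintype_card, Fintype.card_subtype, nsmul_eq_mul]

@[simp] theorem Cob.wtInt_merge (a : Tangle n n) (b : Tangle n k) (g : (Cob.merge a b).surf.V → ℤ) :
    (Cob.merge a b).wtInt g = -∑ j, g (mergeV (.inr (b.curve.top j))) := by
  refine Eq.trans ?_ (congrArg _ (finsum_card_fiber_mul (fun j => Sum.inr (b.curve.top j)) g))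
  rw [← finsum_neg_distrib]
  exact finsum_congr fun v => neg_mul _ _

@[simp] theorem Cob.wtInt_comp {d : Tangle m n} (f : Cob a b) (f' : Cob b d) (g) :
    (f.comp f').wtInt g = f.wtInt (fun v => g (compV (.inl v))) + f'.wtInt (fun v => g (compV (.inr v))) :=
  finsum_sum_type (α := f.surf.V) (β := f'.surf.V) _
@[simp] theorem Cob.dotInt_comp {d : Tangle m n} (f : Cob a b) (f' : Cob b d) (g) :
    (f.comp f').dotInt g = f.dotInt (fun v => g (compV (.inl v))) + f'.dotInt (fun v => g (compV (.inr v))) :=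
  finsum_sum_type (α := f.surf.V) (β := f'.surf.V) _
@[simp] theorem Cob.wtInt_hcomp {a a' : Tangle m k} {b b' : Tangle k n} (f : Cob a a')
    (f' : Cob b b') (g) :
    (f.hcomp f').wtInt g = f.wtInt (fun v => g (hcompV (.inl v))) + f'.wtInt (fun v => g (hcompV (.inr v))) :=
  finsum_sum_type (α := f.surf.V) (β := f'.surf.V) _
@[simp] theorem Cob.dotInt_hcomp {a a' : Tangle m k} {b b' : Tangle k n} (f : Cob a a')
    (f' : Cob b b') (g) :
    (f.hcomp f').dotInt g = f.dotInt (fun v => g (hcompV (.inl v))) + f'.dotInt (fun v => g (hcompV (.inr v))) :=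
  finsum_sum_type (α := f.surf.V) (β := f'.surf.V) _
@[simp] theorem Cob.wtInt_beside {c c' : Tangle 0 0} (f : Cob c c') (f' : Cob a b) (g) :
    (f.beside f').wtInt g = f.wtInt (fun v => g (besideV (.inl v))) + f'.wtInt (fun v => g (besideV (.inr v))) :=
  finsum_sum_type (α := f.surf.V) (β := f'.surf.V) _
@[simp] theorem Cob.dotInt_beside {c c' : Tangle 0 0} (f : Cob c c') (f' : Cob a b) (g) :
    (f.beside f').dotInt g = f.dotInt (fun v => g (besideV (.inl v))) + f'.dotInt (fun v => g (besideV (.inr v))) :=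
  finsum_sum_type (α := f.surf.V) (β := f'.surf.V) _
@[simp] theorem Cob.wtInt_trace {a b : Tangle n n} (f : Cob a b) (g) :
    f.trace.wtInt g = f.wtInt fun v => g (traceV v) := rfl
@[simp] theorem Cob.dotInt_trace {a b : Tangle n n} (f : Cob a b) (g) :
    f.trace.dotInt g = f.dotInt fun v => g (traceV v) := rfl
@[simp] theorem Cob.wtInt_dual (f : Cob a b) (g) : f.dual.wtInt g = f.wtInt fun v => g (dualV v) := rfl
@[simp] theorem Cob.dotInt_dual (f : Cob a b) (g) : f.dual.dotInt g = f.dotInt fun v => g (dualV v) := rfl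

theorem Cob.deg_eq (f : Cob a b) : f.deg = 2 * f.dotInt (fun _ => 1) - f.wtInt (fun _ => 1) := by
  have := Fintype.ofFinite f.surf.V
  simp only [deg, dotInt, wtInt, finsum_eq_sum_of_fintype, mul_one, Finset.sum_sub_distrib,
    Finset.mul_sum]

open Classical in
theorem finsum_fiber {α β : Type} (u : α → β) (s : β) (w : α → ℤ) :
    ∑ᶠ v : {v // u v = s}, w v = ∑ᶠ v, w v * if u v = s then 1 else 0 := by
  have h := finsum_set_coe_eq_finsum_mem (f := w) {v | u v = s}
  refine h.trans ((finsum_mem_def _ _).trans (finsum_congr fun v => ?_))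
  by_cases hv : u v = s <;> simp [Set.indicator, hv]

/-- Mutually inverse colorings are the same as a bijection of sheets. Equality of Euler
characteristics and dots sheet by sheet is replaced by equality of integrals for an arbitrary test
function `u`, of which the indicator of a sheet is a special case; such integrals are additive under
every gluing and can be computed piece by piece. -/
theorem homeo_of_col {f g : Cob a b} (θ : f.surf.V → g.Sheet) (θ' : g.surf.V → f.Sheet)
    (hθ : f.IsCol θ) (hθ' : g.IsCol θ') (h1 : ∀ v, g.desc θ' hθ' (θ v) = f.sheet v)
    (h2 : ∀ v, f.desc θ hθ (θ' v) = g.sheet v)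
    (hs : ∀ x, θ (f.surf.src x) = g.sheet (g.surf.src x))
    (ht : ∀ x, θ (f.surf.tgt x) = g.sheet (g.surf.tgt x))
    (hw : ∀ u : g.Sheet → ℤ, f.wtInt (fun v => u (θ v)) = g.wtInt (fun v => u (g.sheet v)))
    (hd : ∀ u : g.Sheet → ℤ, f.dotInt (fun v => u (θ v)) = g.dotInt (fun v => u (g.sheet v))) :
    Homeo f g := by
  classical
  let e : f.Sheet ≃ g.Sheet :=
    ⟨f.desc θ hθ, g.desc θ' hθ', by rintro ⟨x⟩; exact h1 x, by rintro ⟨x⟩; exact h2 x⟩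
  have he : ∀ v s, f.sheet v = s ↔ θ v = e s := fun v s =>
    e.apply_eq_iff_eq.symm.trans Iff.rfl
  refine ⟨e, hs, ht, fun s => ?_, fun s => ?_⟩
  · rw [finsum_fiber, finsum_fiber]
    simp only [he]
    exact hw fun x => if x = e s then 1 else 0
  · have := hd fun x => if x = e s then 1 else 0
    simp only [Cob.dotInt] at this
    zify
    rw [finsum_fiber _ _ (fun v => (f.surf.dots v : ℤ)),
      finsum_fiber _ _ (fun v => (g.surf.dots v : ℤ))]
    simp only [he]
    exact this

end

end Coloring

/-! ### Isotopies, and homeomorphisms for stacking and planar gluing -/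

section Homeos
open Tangle Cob
variable {X : Type} {m k n : ℕ}

@[simp] theorem Isotopy.ofCol_equiv_mk {a b : Tangle m n} (θ : a.Pt → b.Strand)
    (θ' : b.Pt → a.Strand) (hθ hθ' h1 h2 ht hb) (x) :
    (Isotopy.ofCol θ θ' hθ hθ' h1 h2 ht hb).equiv (Quot.mk _ x) = θ x := rfl
@[simp] theorem Isotopy.refl_equiv (a : Tangle m n) (x) : (Isotopy.refl a).equiv x = x := rfl
@[simp] theorem Isotopy.rightUnit_inl (a : Tangle m n) (x) :
    (Isotopy.rightUnit a).equiv (Quot.mk _ (compPt (.inl x))) = Quot.mk _ x := rfl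
@[simp] theorem Isotopy.rightUnit_inr (a : Tangle m n) (j) :
    (Isotopy.rightUnit a).equiv (Quot.mk _ (compPt (.inr (idPt j)))) =
      Quot.mk _ (a.curve.bot j) := rfl
@[simp] theorem Isotopy.rightUnit_symm (a : Tangle m n) (x) :
    (Isotopy.rightUnit a).symm.equiv (Quot.mk _ x) = Quot.mk _ (compPt (.inl x)) := rfl
@[simp] theorem Isotopy.emptyBeside_mk (a : Tangle m n) (x) :
    (Isotopy.emptyBeside a).equiv (Quot.mk _ x) = Quot.mk _ (besidePt (.inr x)) := rfl
@[simp] theorem Isotopy.dualId_mk (j : Fin n) :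
    (Isotopy.dualId n).equiv (Quot.mk _ (dualPt (idPt j))) = Quot.mk _ (idPt j) := rfl

@[ext] theorem Isotopy.ext {a b : Tangle m n} {e e' : Isotopy a b}
    (h : ∀ x, e.equiv (Quot.mk _ x) = e'.equiv (Quot.mk _ x)) : e = e' := by
  obtain ⟨e, _, _⟩ := e
  obtain ⟨e', _, _⟩ := e'
  have : e = e' := Equiv.ext (by rintro ⟨x⟩; exact h x)
  subst this
  rfl

/-- Composition of isotopies. -/
def Isotopy.trans {a b c : Tangle m n} (e : Isotopy a b) (e' : Isotopy b c) : Isotopy a c :=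
  ⟨e.equiv.trans e'.equiv, fun j => (congrArg _ (e.top j)).trans (e'.top j),
    fun j => (congrArg _ (e.bot j)).trans (e'.bot j)⟩

@[simp] theorem Isotopy.trans_equiv {a b c : Tangle m n} (e : Isotopy a b) (e' : Isotopy b c) (x) :
    (e.trans e').equiv x = e'.equiv (e.equiv x) := rfl

theorem Isotopy.trans_symm {a b : Tangle m n} (e : Isotopy a b) : e.trans e.symm = .refl a :=
  Isotopy.ext fun _ => e.equiv.symm_apply_apply _

theorem Isotopy.symm_trans {a b : Tangle m n} (e : Isotopy a b) : e.symm.trans e = .refl b :=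
  Isotopy.ext fun _ => e.equiv.apply_symm_apply _

/-- `1_m ⊗ a ≅ a`. -/
def Isotopy.leftUnit (a : Tangle m n) : Isotopy (.comp (.id m) a) a := by
  have H1 := (Tangle.comp (.id m) a).isCol_strand id
  have H2 := a.isCol_strand id
  refine Isotopy.ofCol
    (compElim (fun j => Quot.mk _ (a.curve.top (idPt.symm j))) fun x => Quot.mk _ x)
    (fun x => Quot.mk _ (compPt (.inr x))) ?_ ?_ ?_ ?_ ?_ ?_
  · simp at H2 ⊢; grind
  · simp at H1 ⊢; grind
  · simp at H1 ⊢; grind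
  · simp
  · simp
  · simp

/-- `(a ⊗ b) ⊗ c ≅ a ⊗ (b ⊗ c)`. -/
def Isotopy.assoc {l : ℕ} (a : Tangle m k) (b : Tangle k n) (c : Tangle n l) :
    Isotopy (.comp (.comp a b) c) (.comp a (.comp b c)) := by
  have H1 := (Tangle.comp (.comp a b) c).isCol_strand id
  have H2 := (Tangle.comp a (.comp b c)).isCol_strand id
  refine Isotopy.ofCol
    (compElim (compElim (fun x => Quot.mk _ (compPt (.inl x)))
      fun x => Quot.mk _ (compPt (.inr (compPt (.inl x)))))
      fun x => Quot.mk _ (compPt (.inr (compPt (.inr x)))))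
    (compElim (fun x => Quot.mk _ (compPt (.inl (compPt (.inl x)))))
      (compElim (fun x => Quot.mk _ (compPt (.inl (compPt (.inr x)))))
        fun x => Quot.mk _ (compPt (.inr x)))) ?_ ?_ ?_ ?_ ?_ ?_
  · simp at H2 ⊢; grind
  · simp at H1 ⊢; grind
  · simp
  · simp
  · simp
  · simp

@[simp] theorem Isotopy.leftUnit_inl (a : Tangle m n) (j) :
    (Isotopy.leftUnit a).equiv (Quot.mk _ (compPt (.inl (idPt j)))) =
      Quot.mk _ (a.curve.top j) := rfl
@[simp] theorem Isotopy.leftUnit_inr (a : Tangle m n) (x) :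
    (Isotopy.leftUnit a).equiv (Quot.mk _ (compPt (.inr x))) = Quot.mk _ x := rfl
@[simp] theorem Isotopy.leftUnit_symm (a : Tangle m n) (x) :
    (Isotopy.leftUnit a).symm.equiv (Quot.mk _ x) = Quot.mk _ (compPt (.inr x)) := rfl
@[simp] theorem Isotopy.assoc_1 {l : ℕ} (a : Tangle m k) (b : Tangle k n) (c : Tangle n l) (x) :
    (Isotopy.assoc a b c).equiv (Quot.mk _ (compPt (.inl (compPt (.inl x))))) =
      Quot.mk _ (compPt (.inl x)) := rfl
@[simp] theorem Isotopy.assoc_2 {l : ℕ} (a : Tangle m k) (b : Tangle k n) (c : Tangle n l) (x) :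
    (Isotopy.assoc a b c).equiv (Quot.mk _ (compPt (.inl (compPt (.inr x))))) =
      Quot.mk _ (compPt (.inr (compPt (.inl x)))) := rfl
@[simp] theorem Isotopy.assoc_3 {l : ℕ} (a : Tangle m k) (b : Tangle k n) (c : Tangle n l) (x) :
    (Isotopy.assoc a b c).equiv (Quot.mk _ (compPt (.inr x))) =
      Quot.mk _ (compPt (.inr (compPt (.inr x)))) := rfl

def Cob.cylElim {a b : Tangle m n} {e : Isotopy a b} (u : b.Pt → X) (h : b.IsCol u)
    (v : (Cob.cyl e).surf.V) : X := b.desc u h ((cylV e).symm v)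
@[simp] theorem Cob.cylElim_mk {a b : Tangle m n} {e : Isotopy a b} (u : b.Pt → X) (h : b.IsCol u)
    (x) : cylElim (e := e) u h (cylV e (Quot.mk _ x)) = u x := rfl
def Cob.coevElim {a : Tangle m n} (u : a.Pt → X) (h : a.IsCol u)
    (v : (Cob.coev a).surf.V) : X := a.desc u h (coevV.symm v)
@[simp] theorem Cob.coevElim_mk {a : Tangle m n} (u : a.Pt → X) (h : a.IsCol u)
    (x) : coevElim u h (coevV (Quot.mk _ x)) = u x := rfl

/-- The model for all homeomorphisms below: each surface is colored by the sheets of the other one,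
and the gluing relations required of one coloring are those satisfied by the tautological coloring
of the other surface (`H1`, `H2`). -/
theorem Homeo.assoc {a b c d : Tangle m n} (f : Cob a b) (g : Cob b c) (h : Cob c d) :
    Homeo ((f.comp g).comp h) (f.comp (g.comp h)) := by
  have H1 := ((f.comp g).comp h).isCol_sheet
  have H2 := (f.comp (g.comp h)).isCol_sheet
  have B1 := H1.bd
  have B2 := H2.bd
  refine homeo_of_col
    (compElim (compElim (fun v => Quot.mk _ (compV (.inl v)))
      fun v => Quot.mk _ (compV (.inr (compV (.inl v)))))
      fun v => Quot.mk _ (compV (.inr (compV (.inr v)))))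
    (compElim (fun v => Quot.mk _ (compV (.inl (compV (.inl v)))))
      (compElim (fun v => Quot.mk _ (compV (.inl (compV (.inr v)))))
        fun v => Quot.mk _ (compV (.inr v))))
    ?_ ?_ ?_ ?_ ?_ ?_ ?_ ?_
  · clear H1 B1 B2; simp at H2 ⊢; grind
  · clear H2 B1 B2; simp at H1 ⊢; grind
  · simp
  · simp
  · simp
  · simp
  · simp [add_assoc]
  · simp [add_assoc]

theorem Homeo.interchange {a b c : Tangle m k} {a' b' c' : Tangle k n} (f : Cob a b) (g : Cob b c)
    (f' : Cob a' b') (g' : Cob b' c') :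
    Homeo ((f.comp g).hcomp (f'.comp g')) ((f.hcomp f').comp (g.hcomp g')) := by
  have H1 := ((f.comp g).hcomp (f'.comp g')).isCol_sheet
  have H2 := ((f.hcomp f').comp (g.hcomp g')).isCol_sheet
  refine homeo_of_col
    (hcompElim (compElim (fun v => Quot.mk _ (compV (.inl (hcompV (.inl v)))))
        fun v => Quot.mk _ (compV (.inr (hcompV (.inl v)))))
      (compElim (fun v => Quot.mk _ (compV (.inl (hcompV (.inr v)))))
        fun v => Quot.mk _ (compV (.inr (hcompV (.inr v))))))
    (compElim (hcompElim (fun v => Quot.mk _ (hcompV (.inl (compV (.inl v)))))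
        fun v => Quot.mk _ (hcompV (.inr (compV (.inl v)))))
      (hcompElim (fun v => Quot.mk _ (hcompV (.inl (compV (.inr v)))))
        fun v => Quot.mk _ (hcompV (.inr (compV (.inr v))))))
    ?_ ?_ ?_ ?_ ?_ ?_ ?_ ?_
  · clear H1; simp at H2 ⊢; grind
  · clear H2; simp at H1 ⊢
    -- The right-hand surface is glued over the middle level as well, the left-hand one only over
    -- its source and target. The walls of the four pieces transport the relation to the middle
    -- level.
    have := H1.1.1.bd.bot
    have := H1.1.2.1.bd.bot
    have := H1.2.1.1.bd.top
    have := H1.2.1.2.1.bd.top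
    grind
  · simp
  · simp
  · simp
  · simp
  · intro; simp; ring
  · intro; simp; ring

theorem Homeo.one_comp {a b : Tangle m n} (f : Cob a b) : Homeo ((Cob.one a).comp f) f := by
  have H1 := ((Cob.one a).comp f).isCol_sheet
  have H2 := f.isCol_sheet
  have h := H2.bd.src
  refine homeo_of_col
    (compElim (cylElim (fun x => Quot.mk _ (f.surf.src x)) h) fun v => Quot.mk _ v)
    (fun v => Quot.mk _ (compV (.inr v)))
    ?_ ?_ ?_ ?_ ?_ ?_ ?_ ?_
  · clear H1; simp at H2 ⊢; grind
  · clear H2; simp at H1 ⊢; grind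
  · simp at H1 ⊢; grind
  · simp
  · simp
  · simp
  · simp
  · simp

theorem Homeo.comp_one {a b : Tangle m n} (f : Cob a b) : Homeo (f.comp (Cob.one b)) f := by
  have H1 := (f.comp (Cob.one b)).isCol_sheet
  have H2 := f.isCol_sheet
  have h := H2.bd.tgt
  refine homeo_of_col
    (compElim (fun v => Quot.mk _ v) (cylElim (fun x => Quot.mk _ (f.surf.tgt x)) h))
    (fun v => Quot.mk _ (compV (.inl v)))
    ?_ ?_ ?_ ?_ ?_ ?_ ?_ ?_
  · clear H1; simp at H2 ⊢; grind
  · clear H2; simp at H1 ⊢; grind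
  · simp at H1 ⊢; grind
  · simp
  · simp
  · simp
  · simp
  · simp

theorem Homeo.cyl_comp_cyl {a b c : Tangle m n} (e : Isotopy a b) (e' : Isotopy b c) :
    Homeo ((Cob.cyl e).comp (.cyl e')) (.cyl (e.trans e')) := by
  have H1 := ((Cob.cyl e).comp (.cyl e')).isCol_sheet
  refine homeo_of_col
    (compElim (fun v => Quot.mk _ (cylV _ (e'.equiv ((cylV e).symm v))))
      fun v => Quot.mk _ (cylV _ ((cylV e').symm v)))
    (fun v => Quot.mk _ (compV (.inr (cylV e' ((cylV _).symm v)))))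
    ?_ ?_ ?_ ?_ ?_ ?_ ?_ ?_
  · simp
  · simp
  · simp at H1 ⊢; grind
  · simp
  · simp
  · simp
  · simp
  · simp

theorem Homeo.one_hcomp_one (a : Tangle m k) (b : Tangle k n) :
    Homeo ((Cob.one a).hcomp (Cob.one b)) (Cob.one (.comp a b)) := by
  have H1 := ((Cob.one a).hcomp (Cob.one b)).isCol_sheet
  have H2 := (Cob.one (.comp a b)).isCol_sheet.bd
  have h := H2.src
  have h' := H1.bd.tgt
  simp at h
  refine homeo_of_col
    (hcompElim (cylElim _ h.1) (cylElim _ h.2.1)) (cylElim _ h')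
    ?_ ?_ ?_ ?_ ?_ ?_ ?_ ?_
  · simp; grind
  · simp 
  · simp
  · simp
  · simp
  · simp
  · simp
  · simp
end Homeos

/-! ### Closure, disjoint union, duality and units -/

section Homeos
open Tangle Cob
variable {X : Type} {m k n : ℕ}

theorem Homeo.trace_comp {a b c : Tangle n n} (f : Cob a b) (g : Cob b c) :
    Homeo (f.comp g).trace (f.trace.comp g.trace) := by
  have H1 := (f.comp g).trace.isCol_sheet
  have H2 := (f.trace.comp g.trace).isCol_sheet
  refine homeo_of_col
    (fun v => compElim (fun v => Quot.mk _ (compV (.inl (traceV v))))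
      (fun v => Quot.mk _ (compV (.inr (traceV v)))) (traceV.symm v))
    (compElim (fun v => Quot.mk _ (traceV (compV (.inl (traceV.symm v)))))
      fun v => Quot.mk _ (traceV (compV (.inr (traceV.symm v)))))
    ?_ ?_ ?_ ?_ ?_ ?_ ?_ ?_
  · clear H1; simp at H2 ⊢; grind
  · clear H2; simp at H1 ⊢
    have B1 := H1.1.1.bd
    have := B1.top
    have := B1.bot
    grind
  · simp
  · simp
  · simp
  · simp
  · simp
  · simp

theorem Homeo.trace_one (a : Tangle n n) : Homeo (Cob.one a).trace (Cob.one (.trace a)) := by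
  have H1 := (Cob.one a).trace.isCol_sheet
  have H2 := (Cob.one (.trace a)).isCol_sheet.bd
  have h := H2.src
  have h' := H1.bd.tgt
  simp at h
  refine homeo_of_col
    (fun v => cylElim _ h.1 (traceV.symm v)) (cylElim _ h')
    ?_ ?_ ?_ ?_ ?_ ?_ ?_ ?_
  all_goals simp
  grind

theorem Homeo.beside_comp {a b c : Tangle 0 0} {a' b' c' : Tangle m n} (f : Cob a b) (g : Cob b c)
    (f' : Cob a' b') (g' : Cob b' c') :
    Homeo ((f.comp g).beside (f'.comp g')) ((f.beside f').comp (g.beside g')) := by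
  have H1 := ((f.comp g).beside (f'.comp g')).isCol_sheet
  have H2 := ((f.beside f').comp (g.beside g')).isCol_sheet
  refine homeo_of_col
    (Cob.besideElim (compElim (fun v => Quot.mk _ (compV (.inl (besideV (.inl v)))))
        fun v => Quot.mk _ (compV (.inr (besideV (.inl v)))))
      (compElim (fun v => Quot.mk _ (compV (.inl (besideV (.inr v)))))
        fun v => Quot.mk _ (compV (.inr (besideV (.inr v))))))
    (compElim (Cob.besideElim (fun v => Quot.mk _ (besideV (.inl (compV (.inl v)))))
        fun v => Quot.mk _ (besideV (.inr (compV (.inl v)))))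
      (Cob.besideElim (fun v => Quot.mk _ (besideV (.inl (compV (.inr v)))))
        fun v => Quot.mk _ (besideV (.inr (compV (.inr v))))))
    ?_ ?_ ?_ ?_ ?_ ?_ ?_ ?_
  · clear H1; simp at H2 ⊢; grind
  · clear H2; simp at H1 ⊢; grind
  · simp
  · simp
  · simp
  · simp
  · intro; simp; ring
  · intro; simp; ring

theorem Homeo.one_beside_one (b : Tangle 0 0) (a : Tangle m n) :
    Homeo ((Cob.one b).beside (Cob.one a)) (Cob.one (.beside b a)) := by
  have H1 := ((Cob.one b).beside (Cob.one a)).isCol_sheet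
  have H2 := (Cob.one (.beside b a)).isCol_sheet.bd
  have h := H2.src
  have h' := H1.bd.tgt
  simp at h
  refine homeo_of_col
    (Cob.besideElim (cylElim _ h.1) (cylElim _ h.2)) (cylElim _ h')
    ?_ ?_ ?_ ?_ ?_ ?_ ?_ ?_
  all_goals simp

theorem Homeo.dual_comp {a b c : Tangle m n} (f : Cob a b) (g : Cob b c) :
    Homeo (f.comp g).dual (g.dual.comp f.dual) := by
  have H1 := (f.comp g).dual.isCol_sheet
  have H2 := (g.dual.comp f.dual).isCol_sheet
  refine homeo_of_col
    (fun v => compElim (fun v => Quot.mk _ (compV (.inr (dualV v))))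
      (fun v => Quot.mk _ (compV (.inl (dualV v)))) (dualV.symm v))
    (compElim (fun v => Quot.mk _ (dualV (compV (.inr (dualV.symm v)))))
      fun v => Quot.mk _ (dualV (compV (.inl (dualV.symm v)))))
    ?_ ?_ ?_ ?_ ?_ ?_ ?_ ?_
  · clear H1; simp at H2 ⊢; grind
  · clear H2; simp at H1 ⊢; grind
  · simp
  · simp
  · simp
  · simp
  · intro; simp; ring
  · intro; simp; ring

theorem Homeo.dual_one (a : Tangle m n) : Homeo (Cob.one a).dual (Cob.one (.dual a)) := by
  have H1 := (Cob.one a).dual.isCol_sheet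
  have H2 := (Cob.one (.dual a)).isCol_sheet.bd
  have h := H2.src
  have h' := H1.bd.tgt
  simp at h
  refine homeo_of_col
    (fun v => cylElim _ h (dualV.symm v)) (cylElim _ h')
    ?_ ?_ ?_ ?_ ?_ ?_ ?_ ?_
  all_goals simp

theorem Homeo.rightUnit {a b : Tangle m n} (f : Cob a b) :
    Homeo ((f.hcomp (.one (.id n))).comp (.cyl (.rightUnit b)))
      ((Cob.cyl (.rightUnit a)).comp f) := by
  have H1 := ((f.hcomp (.one (.id n))).comp (.cyl (.rightUnit b))).isCol_sheet
  have H2 := ((Cob.cyl (.rightUnit a)).comp f).isCol_sheet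
  have h2 := H2.bd.tgt
  have h1 := H1.bd.src
  simp at h1 h2
  refine homeo_of_col
    (compElim (hcompElim (fun v => Quot.mk _ (compV (.inr v)))
      (cylElim (fun j => Quot.mk _ (compV (.inr (f.surf.tgt (b.curve.bot (idPt.symm j)))))) (by simp)))
      (cylElim (fun x => Quot.mk _ (compV (.inr (f.surf.tgt x)))) h2))
    (compElim (cylElim _ h1.1) fun v => Quot.mk _ (compV (.inl (hcompV (.inl v)))))
    ?_ ?_ ?_ ?_ ?_ ?_ ?_ ?_
  · clear H1; simp at H2 ⊢
    have := H2.1.bd.bot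
    grind
  · simp at H1 ⊢; grind
  · simp at H1 ⊢
    grind
  · simp at H2 ⊢
    grind
  · simp at H2 ⊢
    have := H2.1.bd.bot
    grind
  · simp
  · simp
  · simp

theorem Homeo.emptyBeside {a b : Tangle m n} (f : Cob a b) :
    Homeo (f.comp (.cyl (.emptyBeside b)))
      ((Cob.cyl (.emptyBeside a)).comp ((Cob.one (.id 0)).beside f)) := by
  have H1 := (f.comp (.cyl (.emptyBeside b))).isCol_sheet
  have H2 := ((Cob.cyl (.emptyBeside a)).comp ((Cob.one (.id 0)).beside f)).isCol_sheet
  have h2 := H2.bd.tgt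
  have h1 := H1.bd.src
  simp at h1 h2
  refine homeo_of_col
    (compElim (fun v => Quot.mk _ (compV (.inr (besideV (.inr v)))))
      (cylElim (Tangle.besideElim (fun j => (idPt.symm j).elim0)
        fun x => Quot.mk _ (compV (.inr (besideV (.inr (f.surf.tgt x)))))) (by simp; grind)))
    (compElim (cylElim (Tangle.besideElim (fun j => (idPt.symm j).elim0) fun x => Quot.mk _ (compV (.inl (f.surf.src x)))) (by simp; grind))
      -- The cylinder over the empty diagram has no sheets, since a representative of one would be
      -- an element of `Fin 0`.
      (Cob.besideElim (fun j => ((idPt.symm ((cylV _).symm j).exists_rep.choose)).elim0) fun v => Quot.mk _ (compV (.inl v))))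
    ?_ ?_ ?_ ?_ ?_ ?_ ?_ ?_
  · clear H1; simp at H2 ⊢
    grind
  · simp at H1 ⊢; grind
  · simp at H1 ⊢
    grind
  · simp at H2 ⊢
    grind
  · simp at H2 ⊢
    grind
  · simp
  · simp
  · simp
end Homeos

/-! ### Planarity: holonomy, turnbacks, and end points of components -/

section Planarity

open Tangle Cob

variable {X : Type} {m k n : ℕ}

theorem pinch_zero_zero : pinch (0 : Fin (n + 1)) 0 = none := by simp [pinch]
theorem pinch_zero_one : pinch (0 : Fin (n + 1)) 1 = none := by simp [pinch]
theorem pinch_zero_succ (j : Fin n) : pinch (0 : Fin (n + 1)) j.succ.succ = some j := by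
  simp [pinch]
theorem pinch_succ_zero (i : Fin (n + 1)) : pinch i.succ 0 = some 0 := by simp [pinch]
theorem pinch_succ_succ (i : Fin (n + 1)) (j : Fin (n + 2)) :
    pinch i.succ j.succ = (pinch i j).map Fin.succ := by
  unfold pinch
  by_cases h : j.val < i.val
  · simp [h]
  · by_cases h' : j.val ≤ i.val + 1
    · simp [h, h']
    · simp [h, h']
      omega

/-- The two ends of an arc are adjacent, so their colors multiply to `1` and drop out of the
product. The induction removes the strands to the left of the arc. -/
theorem prod_pinch {H : Type} [Group H] : ∀ {n : ℕ} (i : Fin (n + 1)) (u : Option (Fin n) → H),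
    u none * u none = 1 →
      (List.ofFn fun j => u (pinch i j)).prod = (List.ofFn fun j => u (some j)).prod
  | n, ⟨0, _⟩, u, h => by
    change (List.ofFn fun j => u (pinch (0 : Fin (n + 1)) j)).prod = _
    simp [List.ofFn_succ, pinch_zero_zero, pinch_zero_one, pinch_zero_succ, ← mul_assoc, h]
  | n + 1, ⟨i + 1, hi⟩, u, h => by
    change (List.ofFn fun j => u (pinch (Fin.succ ⟨i, by omega⟩) j)).prod = _
    have := prod_pinch (⟨i, by omega⟩ : Fin (n + 1)) (fun x => u (x.map Fin.succ)) h
    rw [List.ofFn_succ, List.prod_cons, List.ofFn_succ (f := fun j => u (some j)), List.prod_cons]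
    simp only [pinch_succ_zero, pinch_succ_succ]
    rw [this]
    rfl

/-- Planarity: for every coloring by involutions of a group, the product of the colors along the top
is the product along the bottom. -/
theorem Tangle.holonomy {H : Type} [Group H] : ∀ {m n : ℕ} (a : Tangle m n) (c : a.Pt → H),
    a.IsCol c → (∀ x, c x * c x = 1) →
      (List.ofFn fun j => c (a.curve.top j)).prod = (List.ofFn fun j => c (a.curve.bot j)).prod
  | _, _, .id n, c, _, _ => rfl
  | _, _, .cap i, c, _, h => (prod_pinch i c (h _)).symm
  | _, _, .cup i, c, _, h => prod_pinch i c (h _)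
  | _, _, .comp a b, c, hc, h => by
    simp only [isCol_comp] at hc
    refine (a.holonomy _ hc.1 fun x => h _).trans (Eq.trans ?_ (b.holonomy _ hc.2.1 fun x => h _))
    simp only [hc.2.2]
  | _, _, .trace a, c, _, _ => rfl
  | _, _, .beside b a, c, hc, h => by
    simp only [isCol_beside] at hc
    exact a.holonomy _ hc.2 fun x => h _
  | _, _, .dual a, c, hc, h => (a.holonomy c hc h).symm

/-- The number of end points of a component. -/
def Tangle.ends (a : Tangle m n) (s : a.Strand) : ℕ :=
  Nat.card {i : Fin m // a.strand (a.curve.top i) = s} +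
    Nat.card {j : Fin n // a.strand (a.curve.bot j) = s}

/-- Color the component by `-1` and all others by `1`: the holonomy compares the parities of the
numbers of its ends at the top and at the bottom. -/
theorem Tangle.even_ends (a : Tangle m n) (s : a.Strand) : Even (a.ends s) := by
  classical
  have h := a.holonomy (fun x => if a.strand x = s then (-1 : ℤˣ) else 1)
    (a.isCol_strand fun t => if t = s then (-1 : ℤˣ) else 1) (fun x => by split_ifs <;> simp)
  rw [List.prod_ofFn, List.prod_ofFn, Finset.prod_ite, Finset.prod_ite] at h
  simp only [Finset.prod_const, one_pow, mul_one] at h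
  rw [ends, Nat.card_eq_fintype_card, Nat.card_eq_fintype_card, Fintype.card_subtype,
    Fintype.card_subtype]
  have := congrArg (fun x : ℤˣ => (x : ℤ)) h
  simp only [Units.val_pow_eq_pow_val, Units.val_neg, Units.val_one] at this
  rw [Nat.even_add]
  rw [← neg_one_pow_eq_one_iff_even (R := ℤ) (by decide), this,
    neg_one_pow_eq_one_iff_even (by decide)]

/-- The weight of a component is half its number of ends, and the division is exact by `even_ends`.
Doubling spreads the integral over the end points, where it can be compared with saddles and walls.
-/
theorem Cob.two_mul_wtInt_coev (a : Tangle m n) (g : (Cob.coev a).surf.V → ℤ) :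
    2 * (Cob.coev a).wtInt g = ∑ i, g (coevV (Quot.mk _ (a.curve.top i))) +
      ∑ j, g (coevV (Quot.mk _ (a.curve.bot j))) := by
  have : Finite a.Strand := Quot.finite _
  have key (u : a.Strand → ℤ) : 2 * ∑ᶠ s, ((a.ends s / 2 : ℕ) : ℤ) * u s =
      ∑ i, u (Quot.mk _ (a.curve.top i)) + ∑ j, u (Quot.mk _ (a.curve.bot j)) := by
    rw [← finsum_card_fiber_mul (fun i => a.strand (a.curve.top i)) u,
      ← finsum_card_fiber_mul (fun i => a.strand (a.curve.bot i)) u,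
      ← finsum_add_distrib (Set.toFinite _) (Set.toFinite _), mul_finsum]
    refine finsum_congr fun s => ?_
    obtain ⟨r, hr⟩ := a.even_ends s
    rw [← add_mul, ← Nat.cast_add]
    change _ = ((a.ends s : ℕ) : ℤ) * _
    rw [hr, ← mul_assoc]
    congr 1
    push_cast
    omega
  exact key g

/-! ### Reduced words in a free product of groups of order two -/

section Words

variable {S : Type}

open Classical in
/-- Left multiplication of a reduced word by a letter. -/
def toggle (s : S) : List S → List S
  | [] => [s]
  | t :: l => if t = s then l else s :: t :: l

theorem toggle_isChain (s : S) {l : List S} (h : l.IsChain (· ≠ ·)) :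
    (toggle s l).IsChain (· ≠ ·) := by
  cases l with
  | nil => simp [toggle]
  | cons t l =>
    by_cases h' : t = s
    · simpa [toggle, h'] using h.tail
    · simpa [toggle, h'] using List.isChain_cons_cons.2 ⟨Ne.symm h', h⟩

theorem toggle_toggle (s : S) {l : List S} (h : l.IsChain (· ≠ ·)) : toggle s (toggle s l) = l := by
  cases l with
  | nil => simp [toggle]
  | cons t l =>
    by_cases h' : t = s
    · subst h'
      cases l with
      | nil => simp [toggle]
      | cons u l =>
        have := (List.isChain_cons_cons.1 h).1
        simp [toggle, Ne.symm this]
    · simp [toggle, h']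

/-- A letter either lengthens the reduced word by one or cancels its first letter, so full length is
reached only if no cancellation ever takes place. -/
theorem length_foldr_toggle (w : List S) : (w.foldr toggle []).length ≤ w.length ∧
    ((w.foldr toggle []).length = w.length → w.foldr toggle [] = w) := by
  induction w with
  | nil => simp
  | cons s w ih =>
    rw [List.foldr_cons]
    cases h : w.foldr toggle [] with
    | nil =>
      rw [h] at ih
      simp [toggle]
    | cons t l =>
      rw [h] at ih
      by_cases h' : t = s
      · simp [toggle, h'] at ih ⊢
        exact ⟨by omega, fun h => by omega⟩
      · simp [toggle, h'] at ih ⊢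
        exact ih

theorem foldr_toggle_of_isChain {w : List S} (h : w.IsChain (· ≠ ·)) : w.foldr toggle [] = w := by
  induction w with
  | nil => rfl
  | cons s w ih =>
    rw [List.foldr_cons, ih h.tail]
    cases w with
    | nil => rfl
    | cons t w => simp [toggle, Ne.symm (List.isChain_cons_cons.1 h).1]

/-- The permutation of the reduced words given by a letter. -/
def letter (s : S) : Equiv.Perm {l : List S // l.IsChain (· ≠ ·)} where
  toFun l := ⟨toggle s l.1, toggle_isChain s l.2⟩
  invFun l := ⟨toggle s l.1, toggle_isChain s l.2⟩
  left_inv l := Subtype.ext (toggle_toggle s l.2)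
  right_inv l := Subtype.ext (toggle_toggle s l.2)

/-- Van der Waerden's trick: the free product of groups of order two enters only through its action
on reduced words, and acting on the empty word reads off the reduced form of a product. -/
theorem prod_letter (w : List S) :
    ((w.map letter).prod ⟨[], List.isChain_nil⟩).1 = w.foldr toggle [] := by
  induction w with
  | nil => rfl
  | cons s w ih =>
    rw [List.map_cons, List.prod_cons, Equiv.Perm.mul_apply, List.foldr_cons, ← ih]
    rfl

end Words

/-- A diagram that is not the identity has a turnback at the bottom. -/
theorem Tangle.exists_turnback (a : Tangle n n)
    (h : ∃ j, a.strand (a.curve.top j) ≠ a.strand (a.curve.bot j)) :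
    ∃ (i : ℕ) (hi : i + 1 < n), a.strand (a.curve.bot ⟨i, by omega⟩) =
      a.strand (a.curve.bot ⟨i + 1, hi⟩) := by
  by_contra hc
  push Not at hc
  -- With each piece colored by the involution of its component, planarity says that the words of
  -- components read along the top and along the bottom have the same reduced form.
  have hol := a.holonomy (fun x => letter (a.strand x)) (a.isCol_strand letter)
    fun x => Equiv.ext fun l => Subtype.ext (toggle_toggle _ l.2)
  have h1 : (List.ofFn fun j => a.strand (a.curve.top j)).foldr toggle [] =
      (List.ofFn fun j => a.strand (a.curve.bot j)).foldr toggle [] := by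
    rw [← prod_letter, ← prod_letter, List.map_ofFn, List.map_ofFn]
    have := congrArg (fun p => (p ⟨[], List.isChain_nil⟩).1) hol
    exact this
  have h2 : (List.ofFn fun j => a.strand (a.curve.bot j)).IsChain (· ≠ ·) := by
    rw [List.isChain_iff_getElem]
    intro i hi
    simp only [List.length_ofFn] at hi
    simpa using hc i hi
  rw [foldr_toggle_of_isChain h2] at h1
  -- Without a turnback the bottom word is already reduced. The top word has the same length `n` and
  -- the same reduced form, so nothing cancels in it and the two words agree letter by letter.
  have h3 := (length_foldr_toggle (List.ofFn fun j => a.strand (a.curve.top j))).2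
    (by rw [h1]; simp)
  rw [h1] at h3
  obtain ⟨j, hj⟩ := h
  exact hj (congrFun (List.ofFn_injective h3) j).symm

/-! ### Every component has at most two end points -/

/-- A connected graph has at most one vertex more than it has edges; loops and parallel edges named
by `E` only help. -/
theorem card_fiber_le_card_edges {V E : Type} [Finite V] [Finite E] (e : E → V × V)
    {r : V → V → Prop} (hr : ∀ u v, r u v → ∃ j, e j = (u, v)) (C : Quot r) :
    Nat.card {v // Quot.mk r v = C} ≤ Nat.card {j // Quot.mk r (e j).1 = C} + 1 := by
  classical
  obtain ⟨v₀, rfl⟩ := C.exists_rep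
  let G := SimpleGraph.fromRel r
  have reach : ∀ u v, Quot.mk r u = Quot.mk r v → G.Reachable u v := by
    intro u v h
    have h' := Quot.eqvGen_exact h
    clear h
    induction h' with
    | rel x y h =>
      by_cases hxy : x = y
      · rw [hxy]
      · exact (SimpleGraph.fromRel_adj r x y |>.2 ⟨hxy, .inl h⟩).reachable
    | refl x => rfl
    | symm x y _ ih => exact ih.symm
    | trans x y z _ _ ih1 ih2 =>
      exact ih1.trans ih2
  have adj : ∀ u v, G.Adj u v → Quot.mk r u = Quot.mk r v := by
    intro u v h
    rcases ((SimpleGraph.fromRel_adj r u v).1 h).2 with h | h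
    exacts [Quot.sound h, (Quot.sound h).symm]
  have reach' : ∀ u v, G.Reachable u v → Quot.mk r u = Quot.mk r v := by
    rintro u v ⟨p⟩
    induction p with
    | nil => rfl
    | cons h _ ih => exact (adj _ _ h).trans ih
  let c := G.connectedComponentMk v₀
  have hc : ∀ v, v ∈ c.supp ↔ Quot.mk r v = Quot.mk r v₀ := fun v => by
    rw [SimpleGraph.ConnectedComponent.mem_supp_iff, SimpleGraph.ConnectedComponent.eq]
    exact ⟨reach' _ _, reach _ _⟩
  have h1 := c.connected_toSimpleGraph.card_vert_le_card_edgeSet_add_one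
  have h2 : Nat.card c = Nat.card {v // Quot.mk r v = Quot.mk r v₀} :=
    Nat.card_congr (Equiv.subtypeEquivRight hc)
  rw [← h2]
  refine h1.trans (Nat.add_le_add_right ?_ 1)
  have h3 : ∀ ed : c.toSimpleGraph.edgeSet, ∃ j : {j // Quot.mk r (e j).1 = Quot.mk r v₀},
      s((e j.1).1, (e j.1).2) = ed.1.map Subtype.val := by
    rintro ⟨ed, hed⟩
    induction ed with
    | _ u v =>
    have huv : G.Adj u.1 v.1 := hed
    rcases ((SimpleGraph.fromRel_adj r _ _).1 huv).2 with h | h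
    · obtain ⟨j, hj⟩ := hr _ _ h
      exact ⟨⟨j, by rw [hj]; exact (hc _).1 u.2⟩, by simp [hj]⟩
    · obtain ⟨j, hj⟩ := hr _ _ h
      exact ⟨⟨j, by rw [hj]; exact (hc _).1 v.2⟩, by simp [hj, Sym2.eq_swap]⟩
  choose F hF using h3
  refine Nat.card_le_card_of_injective F fun x y hxy => Subtype.ext ?_
  refine Sym2.map.injective Subtype.val_injective ?_
  rw [← hF, ← hF, hxy]


open Classical in
theorem card_eq_sum_ite {ι : Type} [Fintype ι] (p : ι → Prop) :
    (Nat.card {j // p j} : ℤ) = ∑ j, if p j then 1 else 0 := by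
  rw [Nat.card_eq_fintype_card, Fintype.card_subtype, Finset.sum_boole]

theorem Tangle.sum_ends_mul (a : Tangle m n) (u : a.Strand → ℤ) :
    ∑ᶠ s, (a.ends s : ℤ) * u s = ∑ i, u (Quot.mk _ (a.curve.top i)) +
      ∑ j, u (Quot.mk _ (a.curve.bot j)) := by
  have : Finite a.Strand := Quot.finite _
  rw [← finsum_card_fiber_mul (fun i => a.strand (a.curve.top i)) u,
    ← finsum_card_fiber_mul (fun i => a.strand (a.curve.bot i)) u,
    ← finsum_add_distrib (Set.toFinite _) (Set.toFinite _)]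
  refine finsum_congr fun s => ?_
  rw [← add_mul, ← Nat.cast_add]
  rfl

theorem card_pinch_none (i : Fin (n + 1)) : Nat.card {j // pinch i j = none} ≤ 2 := by
  rw [Nat.card_eq_fintype_card, Fintype.card_subtype]
  refine (Finset.card_le_card (t := {i.castSucc, i.succ}) fun j hj => ?_).trans Finset.card_le_two
  simp only [Finset.mem_filter, Finset.mem_univ, true_and] at hj
  unfold pinch at hj
  split_ifs at hj
  simp only [Finset.mem_insert, Finset.mem_singleton, Fin.ext_iff, Fin.val_castSucc, Fin.val_succ]
  omega

theorem pinch_eq_some_inj (i : Fin (n + 1)) {j j' : Fin (n + 2)} {t : Fin n}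
    (h : pinch i j = some t) (h' : pinch i j' = some t) : j = j' := by
  unfold pinch at h h'
  simp only [Fin.ext_iff] at *
  split_ifs at h h' <;> simp [Fin.ext_iff] at h h' <;> omega

theorem finsum_le {α : Type} [Finite α] {u v : α → ℤ} (h : ∀ x, u x ≤ v x) :
    ∑ᶠ x, u x ≤ ∑ᶠ x, v x := by
  have := Fintype.ofFinite α
  rw [finsum_eq_sum_of_fintype, finsum_eq_sum_of_fintype]
  exact Finset.sum_le_sum fun x _ => h x

/-- Take the graph whose vertices are the components of `a` and of `b` and whose edges are the `k`
gluing points. If a connected component has `V` vertices and `E` edges, its vertices have at most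
`2V` ends in all, every edge uses up two of them, and `V ≤ E + 1`; so at most two ends remain. -/
theorem Tangle.ends_comp_le (a : Tangle m k) (b : Tangle k n) (ha : ∀ s, a.ends s ≤ 2)
    (hb : ∀ s, b.ends s ≤ 2) (s : (Tangle.comp a b).Strand) : (Tangle.comp a b).ends s ≤ 2 := by
  classical
  have : Finite a.Strand := Quot.finite _
  have : Finite b.Strand := Quot.finite _
  let e : Fin k → (a.Strand ⊕ b.Strand) × (a.Strand ⊕ b.Strand) := fun j =>
    (.inl (a.strand (a.curve.bot j)), .inr (b.strand (b.curve.top j)))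
  let r : a.Strand ⊕ b.Strand → a.Strand ⊕ b.Strand → Prop := fun u v => ∃ j, e j = (u, v)
  let c : (Tangle.comp a b).Pt → Quot r := compElim (fun x => Quot.mk r (.inl (a.strand x)))
    fun x => Quot.mk r (.inr (b.strand x))
  have hc : (Tangle.comp a b).IsCol c := by
    rw [isCol_comp]
    exact ⟨a.isCol_strand fun s => Quot.mk r (.inl s), b.isCol_strand fun s => Quot.mk r (.inr s),
      fun j => Quot.sound ⟨j, rfl⟩⟩
  let C := (Tangle.comp a b).desc c hc s
  have h0 := card_fiber_le_card_edges e (r := r) (fun _ _ h => h) C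
  let g : a.Strand ⊕ b.Strand → ℤ := fun v => if Quot.mk r v = C then 1 else 0
  have hg : ∀ v, 0 ≤ g v := fun v => by simp only [g]; split_ifs <;> simp
  have h1 := a.sum_ends_mul fun s => g (.inl s)
  have h2 := b.sum_ends_mul fun s => g (.inr s)
  have h3 : ∑ᶠ s, (a.ends s : ℤ) * g (.inl s) ≤ ∑ᶠ s, 2 * g (.inl s) :=
    finsum_le fun s => mul_le_mul_of_nonneg_right (by exact_mod_cast ha s) (hg _)
  have h4 : ∑ᶠ s, (b.ends s : ℤ) * g (.inr s) ≤ ∑ᶠ s, 2 * g (.inr s) :=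
    finsum_le fun s => mul_le_mul_of_nonneg_right (by exact_mod_cast hb s) (hg _)
  have h5 : (Nat.card {v // Quot.mk r v = C} : ℤ) = ∑ᶠ s, g (.inl s) + ∑ᶠ s, g (.inr s) := by
    have := Fintype.ofFinite a.Strand
    have := Fintype.ofFinite b.Strand
    rw [card_eq_sum_ite, Fintype.sum_sum_type, finsum_eq_sum_of_fintype, finsum_eq_sum_of_fintype]
  have h6 : (Nat.card {j // Quot.mk r (e j).1 = C} : ℤ) = ∑ j, g (.inl (a.strand (a.curve.bot j))) :=
    card_eq_sum_ite _
  have h7 : ∀ j, g (.inl (a.strand (a.curve.bot j))) = g (.inr (b.strand (b.curve.top j))) :=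
    fun j => by
      have : Quot.mk r (.inl (a.strand (a.curve.bot j))) = Quot.mk r (.inr (b.strand (b.curve.top j))) :=
        Quot.sound ⟨j, rfl⟩
      simp only [g, this]
  have h8 : (Nat.card {i // (Tangle.comp a b).strand ((Tangle.comp a b).curve.top i) = s} : ℤ) ≤
      ∑ i, g (.inl (a.strand (a.curve.top i))) := by
    rw [card_eq_sum_ite]
    refine Finset.sum_le_sum fun i _ => ?_
    split_ifs with h
    · subst h
      simp only [g, C]
      exact (if_pos rfl).ge
    · exact hg _
  have h9 : (Nat.card {i // (Tangle.comp a b).strand ((Tangle.comp a b).curve.bot i) = s} : ℤ) ≤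
      ∑ i, g (.inr (b.strand (b.curve.bot i))) := by
    rw [card_eq_sum_ite]
    refine Finset.sum_le_sum fun i _ => ?_
    split_ifs with h
    · subst h
      simp only [g, C]
      exact (if_pos rfl).ge
    · exact hg _
  rw [← mul_finsum] at h3 h4
  simp only [← h7] at h2
  unfold ends
  zify at h0 ⊢
  linarith

theorem Tangle.ends_le_two : ∀ {m n : ℕ} (a : Tangle m n) (s : a.Strand), a.ends s ≤ 2
  | _, _, .id n, s => by
    obtain ⟨x⟩ := s
    have h (j y : Fin n) (hj : (Tangle.id n).strand (idPt j) = (Tangle.id n).strand (idPt y)) :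
        j = y := congrArg ((Tangle.id n).desc idPt.symm (by simp)) hj
    have h1 : Nat.card {j : Fin n // (Tangle.id n).strand (idPt j) = Quot.mk _ x} ≤ 1 := by
      rw [Finite.card_le_one_iff_subsingleton]
      exact ⟨fun j j' => Subtype.ext ((h _ _ j.2).trans (h _ _ j'.2).symm)⟩
    exact add_le_add h1 h1
  | _, _, .cap (n := n) i, s => by
    obtain ⟨x⟩ := s
    have h (x y) (hj : (Tangle.cap i).strand x = (Tangle.cap i).strand y) :
        (capPt i).symm x = (capPt i).symm y :=
      congrArg ((Tangle.cap i).desc (capPt i).symm (by simp)) hj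
    rcases x with _ | x
    · have h1 : Nat.card {j : Fin n // (Tangle.cap i).strand (capPt i (some j)) =
          Quot.mk _ (capPt i none)} ≤ 0 := by
        rw [Nat.le_zero, Finite.card_eq_zero_iff]
        exact ⟨fun j => by simpa using h _ _ j.2⟩
      have h2 : Nat.card {j // (Tangle.cap i).strand (capPt i (pinch i j)) =
          Quot.mk _ (capPt i none)} ≤ 2 :=
        (Nat.card_le_card_of_injective (β := {j // pinch i j = none})
          (fun j => ⟨j.1, by simpa using h _ _ j.2⟩)
          fun j j' h => Subtype.ext (by simpa using h)).trans (card_pinch_none i)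
      exact add_le_add h1 h2
    · have h1 : Nat.card {j : Fin n // (Tangle.cap i).strand (capPt i (some j)) =
          Quot.mk _ (capPt i (some x))} ≤ 1 := by
        rw [Finite.card_le_one_iff_subsingleton]
        exact ⟨fun j j' => Subtype.ext (Option.some_injective _
          ((h _ _ j.2).trans (h _ _ j'.2).symm))⟩
      have h2 : Nat.card {j // (Tangle.cap i).strand (capPt i (pinch i j)) =
          Quot.mk _ (capPt i (some x))} ≤ 1 := by
        rw [Finite.card_le_one_iff_subsingleton]
        exact ⟨fun j j' => Subtype.ext (pinch_eq_some_inj i (h _ _ j.2) (h _ _ j'.2))⟩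
      exact add_le_add h1 h2
  | _, _, .cup i, s => by
    exact (Nat.add_comm _ _).trans_le ((Tangle.cap i).ends_le_two s)
  | _, _, .comp a b, s => ends_comp_le a b a.ends_le_two b.ends_le_two s
  | _, _, .trace a, s => by simp [ends]
  | _, _, .beside b a, s => by
    obtain ⟨x⟩ := s
    have h (x y) (hj : (Tangle.beside b a).strand x = (Tangle.beside b a).strand y) :
        Tangle.besideElim (fun _ => none) (fun x => some (a.strand x)) x =
        Tangle.besideElim (fun _ => none) (fun x => some (a.strand x)) y :=
      congrArg ((Tangle.beside b a).desc (Tangle.besideElim (fun _ => none)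
        fun x => some (a.strand x)) ((isCol_beside _ _ _).2
          ⟨fun _ _ _ => rfl, a.isCol_strand fun s => some s⟩)) hj
    rcases x with x | x
    · have h1 : Nat.card {j // (Tangle.beside b a).strand ((Tangle.beside b a).curve.top j) =
          Quot.mk _ (besidePt (.inl x))} ≤ 0 := by
        rw [Nat.le_zero, Finite.card_eq_zero_iff]
        exact ⟨fun j => by simpa using h _ _ j.2⟩
      have h2 : Nat.card {j // (Tangle.beside b a).strand ((Tangle.beside b a).curve.bot j) =
          Quot.mk _ (besidePt (.inl x))} ≤ 0 := by
        rw [Nat.le_zero, Finite.card_eq_zero_iff]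
        exact ⟨fun j => by simpa using h _ _ j.2⟩
      exact (add_le_add h1 h2).trans (by simp)
    · refine le_trans (add_le_add ?_ ?_) (a.ends_le_two (a.strand x))
      · exact Nat.card_le_card_of_injective
          (fun j => ⟨j.1, Option.some_injective _ (h _ (besidePt (.inr x)) j.2)⟩)
          fun j j' h => Subtype.ext (by simpa using h)
      · exact Nat.card_le_card_of_injective
          (fun j => ⟨j.1, Option.some_injective _ (h _ (besidePt (.inr x)) j.2)⟩)
          fun j j' h => Subtype.ext (by simpa using h)
  | _, _, .dual a, s => by
    exact (Nat.add_comm _ _).trans_le (a.ends_le_two s)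

end Planarity

/-! ### Naturality of saddles, disks and rotations -/

section Homeos
open Tangle Cob
variable {X : Type} {m k n : ℕ}

theorem Homeo.tensor_assoc {l : ℕ} {a a' : Tangle m k} {b b' : Tangle k n} {c c' : Tangle n l}
    (f : Cob a a') (g : Cob b b') (h : Cob c c') :
    Homeo (((f.hcomp g).hcomp h).comp (.cyl (.assoc a' b' c')))
      ((Cob.cyl (.assoc a b c)).comp (f.hcomp (g.hcomp h))) := by
  have H1 := (((f.hcomp g).hcomp h).comp (.cyl (.assoc a' b' c'))).isCol_sheet
  have H2 := ((Cob.cyl (.assoc a b c)).comp (f.hcomp (g.hcomp h))).isCol_sheet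
  have h2 := H2.bd.tgt
  have h1 := H1.bd.src
  simp at h1 h2
  refine homeo_of_col
    (compElim (hcompElim (hcompElim (fun v => Quot.mk _ (compV (.inr (hcompV (.inl v)))))
        fun v => Quot.mk _ (compV (.inr (hcompV (.inr (hcompV (.inl v)))))))
        fun v => Quot.mk _ (compV (.inr (hcompV (.inr (hcompV (.inr v)))))))
      (cylElim (Tangle.compElim
          (fun x => Quot.mk _ (compV (.inr (hcompV (.inl (f.surf.tgt x))))))
          (Tangle.compElim (fun x => Quot.mk _ (compV (.inr (hcompV (.inr (hcompV (.inl (g.surf.tgt x))))))))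
          fun x => Quot.mk _ (compV (.inr (hcompV (.inr (hcompV (.inr (h.surf.tgt x)))))))))
        (by simp; grind)))
    (compElim (cylElim (Tangle.compElim
          (fun x => Quot.mk _ (compV (.inl (hcompV (.inl (hcompV (.inl (f.surf.src x))))))))
          (Tangle.compElim (fun x => Quot.mk _ (compV (.inl (hcompV (.inl (hcompV (.inr (g.surf.src x))))))))
          fun x => Quot.mk _ (compV (.inl (hcompV (.inr (h.surf.src x)))))))
        (by simp; grind))
      (hcompElim (fun v => Quot.mk _ (compV (.inl (hcompV (.inl (hcompV (.inl v)))))))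
        (hcompElim (fun v => Quot.mk _ (compV (.inl (hcompV (.inl (hcompV (.inr v)))))))
        fun v => Quot.mk _ (compV (.inl (hcompV (.inr v)))))))
    ?_ ?_ ?_ ?_ ?_ ?_ ?_ ?_
  · clear H1; simp at H2 ⊢; grind
  · clear H2; simp at H1 ⊢; grind
  · clear H2; simp at H1 ⊢; grind
  · clear H1; simp at H2 ⊢; grind
  · clear H1; simp at H2 ⊢; grind
  · simp
  · intro; simp; ring
  · intro; simp; ring

theorem Homeo.merge {a a' : Tangle n n} {b b' : Tangle n k} (f : Cob a a') (g : Cob b b') :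
    Homeo ((f.trace.beside g).comp (.merge a' b')) ((Cob.merge a b).comp (f.hcomp g)) := by
  have H1 := ((f.trace.beside g).comp (.merge a' b')).isCol_sheet
  have H2 := ((Cob.merge a b).comp (f.hcomp g)).isCol_sheet
  have h2 := H2.bd.tgt
  have h1 := H1.bd.src
  simp at h1 h2
  refine homeo_of_col
    (compElim (Cob.besideElim (fun v => Quot.mk _ (compV (.inr (hcompV (.inl (traceV.symm v))))))
        fun v => Quot.mk _ (compV (.inr (hcompV (.inr v)))))
      (mergeElim (fun x => Quot.mk _ (compV (.inr (hcompV (.inl (f.surf.tgt x))))))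
        fun x => Quot.mk _ (compV (.inr (hcompV (.inr (g.surf.tgt x)))))))
    (compElim (mergeElim (fun x => Quot.mk _ (compV (.inl (besideV (.inl (traceV (f.surf.src x)))))))
        fun x => Quot.mk _ (compV (.inl (besideV (.inr (g.surf.src x))))))
      (hcompElim (fun v => Quot.mk _ (compV (.inl (besideV (.inl (traceV v))))))
        fun v => Quot.mk _ (compV (.inl (besideV (.inr v))))))
    ?_ ?_ ?_ ?_ ?_ ?_ ?_ ?_
  · clear H1; simp at H2 ⊢
    have B1 := H2.2.1.1.bd
    have B2 := H2.2.1.2.1.bd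
    have := B1.top
    have := B1.bot
    have := B2.top
    grind
  · clear H2; simp at H1 ⊢
    have B1 := H1.1.1.1.bd
    have B2 := H1.1.2.bd
    have := B1.top
    have := B1.bot
    have := B2.top
    grind
  · clear H2; simp at H1 ⊢; grind
  · clear H1; simp at H2 ⊢; grind
  · clear H1; simp at H2 ⊢; grind
  · simp
  · intro u
    simp at H2 ⊢
    have := H2.2.1.2.1.bd.top
    -- On one side the saddles sit at the top points of `b'`, on the other at those of `b`. The
    -- walls of `g` put both into the same sheets.
    have h : ∀ x, u (((Cob.merge a b).comp (f.hcomp g)).sheet (compV (.inr (hcompV (.inr (g.surf.tgt (b'.curve.top x))))))) =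
       u (((Cob.merge a b).comp (f.hcomp g)).sheet (compV (.inl (mergeV (.inr (b.curve.top x)))))) := fun x => by grind
    simp [h]
    ring
  · intro; simp

/-- A disk attached to a strand by a band retracts into the strand: the weight `1` of each disk
cancels the weight `-1` of its saddle. -/
theorem Homeo.disks_merge (a : Tangle n k) :
    Homeo (((Cob.cyl (.emptyBeside a)).comp ((Cob.disks n).beside (.one a))).comp
      (.merge (.id n) a)) (.cyl (Isotopy.leftUnit a).symm) := by
  have H1 := (((Cob.cyl (.emptyBeside a)).comp ((Cob.disks n).beside (.one a))).comp
      (.merge (.id n) a)).isCol_sheet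
  have H2 := (Cob.cyl (Isotopy.leftUnit a).symm).isCol_sheet
  have h2 := H2.bd.tgt
  have h1 := H1.bd.tgt
  simp at h1 h2
  refine homeo_of_col
    (compElim (compElim (cylElim (Tangle.besideElim (fun j => (idPt.symm j).elim0)
        fun x => Quot.mk _ (cylV _ (Quot.mk _ (compPt (.inr x))))) (by simp; exact h2.1))
      (Cob.besideElim (fun j => Quot.mk _ (cylV _ (Quot.mk _ (compPt (.inl (idPt (disksV.symm j)))))))
        (cylElim (fun x => Quot.mk _ (cylV _ (Quot.mk _ (compPt (.inr x))))) h2.1)))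
      (mergeElim (fun j => Quot.mk _ (cylV _ (Quot.mk _ (compPt (.inl j)))))
        fun x => Quot.mk _ (cylV _ (Quot.mk _ (compPt (.inr x))))))
    (cylElim (fun x => Quot.mk _ (compV (.inr (mergeV (compPt.symm x))))) (by simp; grind))
    ?_ ?_ ?_ ?_ ?_ ?_ ?_ ?_
  · clear H1; simp at H2 h2 ⊢; grind
  · simp
  · clear H2; simp at H1 ⊢; grind
  · simp at ⊢
  · simp
  · simp
  · intro u
    simp at h2 ⊢
    simp [h2]
  · intro; simp

/-- Here the disks fill the circles of the closed-up source `1_n`, and they are banded to the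
boundary of `f`. They are absorbed as before, so only `f` is left. This is the surface behind the
computation of `φ(ψ(ζ))`. -/
theorem Homeo.disks_beside_merge {b : Tangle n n} (f : Cob (.id 0) (.trace b)) :
    Homeo ((Cob.disks n).comp (Cob.trace (((Cob.cyl (.emptyBeside (.id n))).comp
      (f.beside (.one (.id n)))).comp (.merge b (.id n)))))
      (f.comp (Cob.trace (.cyl (Isotopy.rightUnit b).symm))) := by
  have H1 := ((Cob.disks n).comp (Cob.trace (((Cob.cyl (.emptyBeside (.id n))).comp
      (f.beside (.one (.id n)))).comp (.merge b (.id n))))).isCol_sheet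
  have H2 := (f.comp (Cob.trace (.cyl (Isotopy.rightUnit b).symm))).isCol_sheet
  have h2 := H2.bd.tgt
  have h1 := H1.bd.tgt
  simp at h1 h2
  refine homeo_of_col
    (compElim (fun j => Quot.mk _ (compV (.inr (traceV (cylV _ (Quot.mk _ (compPt (.inr (idPt (disksV.symm j)))))))))) 
      fun v => compElim (compElim (cylElim (Tangle.besideElim (fun j => (idPt.symm j).elim0)
        fun x => Quot.mk _ (compV (.inr (traceV (cylV _ (Quot.mk _ (compPt (.inr x)))))))) (by simp))
      (Cob.besideElim (fun v => Quot.mk _ (compV (.inl v)))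
        (cylElim (fun x => Quot.mk _ (compV (.inr (traceV (cylV _ (Quot.mk _ (compPt (.inr x)))))))) (by simp))))
      (mergeElim (fun x => Quot.mk _ (compV (.inl (f.surf.tgt (tracePt x)))))
        fun x => Quot.mk _ (compV (.inr (traceV (cylV _ (Quot.mk _ (compPt (.inr x)))))))) (traceV.symm v))
    (compElim (fun v => Quot.mk _ (compV (.inr (traceV (compV (.inl (compV (.inr (besideV (.inl v)))))))))) 
      fun v => cylElim (fun x => Quot.mk _ (compV (.inr (traceV (compV (.inr (mergeV (compPt.symm x)))))))) (by simp; grind) (traceV.symm v))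
    ?_ ?_ ?_ ?_ ?_ ?_ ?_ ?_
  · clear H1; simp at H2 h2 ⊢
    have := H2.1.bd.tgt
    simp at this
    grind
  · clear H2; simp at H1 ⊢
    grind
  · clear H2; simp at H1 ⊢; grind
  · simp at H2 ⊢
    grind
  · simp
  · simp at H2 ⊢
    grind
  · intro u
    simp
  · intro; simp

theorem Homeo.coev_id (n : ℕ) :
    Homeo ((Cob.coev (.id n)).comp (Cob.trace (((Cob.one (.id n)).hcomp (.cyl (.dualId n))).comp
      (.cyl (.rightUnit (.id n)))))) (.disks n) := by
  have H1 := ((Cob.coev (.id n)).comp (Cob.trace (((Cob.one (.id n)).hcomp (.cyl (.dualId n))).comp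
      (.cyl (.rightUnit (.id n)))))).isCol_sheet
  have H2 := (Cob.disks n).isCol_sheet
  refine homeo_of_col
    (compElim (coevElim (fun j => Quot.mk _ (disksV (idPt.symm j))) (by simp))
      fun v => compElim (hcompElim (cylElim (fun j => Quot.mk _ (disksV (idPt.symm j))) (by simp))
        (cylElim (fun j => Quot.mk _ (disksV (idPt.symm j))) (by simp)))
        (cylElim (fun j => Quot.mk _ (disksV (idPt.symm j))) (by simp)) (traceV.symm v))
    (fun j => Quot.mk _ (compV (.inl (coevV (Quot.mk _ (idPt (disksV.symm j)))))))
    ?_ ?_ ?_ ?_ ?_ ?_ ?_ ?_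
  · simp
  · clear H2; simp at H1 ⊢
  · clear H2; simp at H1 ⊢; grind
  · simp
  · simp
  · simp
  · intro u
    have := Cob.two_mul_wtInt_coev (.id n) (fun v => u (coevElim (a := .id n) (fun j => (Cob.disks n).sheet (disksV (idPt.symm j))) (by simp) v))
    simp at this ⊢
    linarith
  · intro; simp

/-- A cobordism on one half of a rotated diagram can be pushed around to the other half, where it
appears reflected. The weights of the two rotations match because both are concentrated on the end
points, which the walls of `g` identify. -/
theorem Homeo.coev_slide {a a' : Tangle m n} (g : Cob a a') :
    Homeo ((Cob.coev a).comp (Cob.trace (g.hcomp (.one (.dual a)))))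
      ((Cob.coev a').comp (Cob.trace ((Cob.one a').hcomp g.dual))) := by
  have H1 := ((Cob.coev a).comp (Cob.trace (g.hcomp (.one (.dual a))))).isCol_sheet
  have H2 := ((Cob.coev a').comp (Cob.trace ((Cob.one a').hcomp g.dual))).isCol_sheet
  have h2 := H2
  have h1 := H1
  simp at h1 h2
  have B1 := h1.1.1.1.bd
  have B2 := h2.1.1.1.bd
  have C1 := B1.tgt
  have C2 := B2.src
  refine homeo_of_col
    (compElim (coevElim (fun x => Quot.mk _ (compV (.inr (traceV (hcompV (.inr (dualV (g.surf.src x)))))))) C2)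
      fun v => hcompElim (fun v => Quot.mk _ (compV (.inr (traceV (hcompV (.inr (dualV v)))))))
        (cylElim (fun x => Quot.mk _ (compV (.inr (traceV (hcompV (.inr (dualV (g.surf.src (dualPt.symm x))))))))) (by simp; exact C2)) (traceV.symm v))
    (compElim (coevElim (fun x => Quot.mk _ (compV (.inr (traceV (hcompV (.inl (g.surf.tgt x))))))) C1)
      fun v => hcompElim (cylElim (fun x => Quot.mk _ (compV (.inr (traceV (hcompV (.inl (g.surf.tgt x))))))) C1) 
        (fun v => Quot.mk _ (compV (.inr (traceV (hcompV (.inl (dualV.symm v))))))) (traceV.symm v))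
    ?_ ?_ ?_ ?_ ?_ ?_ ?_ ?_
  · have := B2.top
    have := B2.bot
    clear H1 h1; simp at H2 ⊢
    grind
  · have := B1.top
    have := B1.bot
    clear H2 h2; simp at H1 ⊢
    grind
  · clear H2 h2; simp at H1 ⊢; grind
  · clear H1 h1; simp at H2 ⊢; grind
  · simp
  · clear H1 h1; simp at H2 ⊢; grind
  · intro u
    have e1 := Cob.two_mul_wtInt_coev a (fun v => u (coevElim (fun x => ((Cob.coev a').comp (Cob.trace ((Cob.one a').hcomp g.dual))).sheet (compV (.inr (traceV (hcompV (.inr (dualV (g.surf.src x)))))))) C2 v))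
    have e2 := Cob.two_mul_wtInt_coev a' (fun v => u (((Cob.coev a').comp (Cob.trace ((Cob.one a').hcomp g.dual))).sheet (compV (.inl v))))
    have t1 : ∀ i, u (((Cob.coev a').comp (Cob.trace ((Cob.one a').hcomp g.dual))).sheet (compV (.inr (traceV (hcompV (.inr (dualV (g.surf.src (a.curve.top i))))))))) =
       u (((Cob.coev a').comp (Cob.trace ((Cob.one a').hcomp g.dual))).sheet (compV (.inl (coevV (Quot.mk _ (a'.curve.top i)))))) := by
      have := B2.top
      clear H1 h1; simp at H2 ⊢; grind
    have t2 : ∀ i, u (((Cob.coev a').comp (Cob.trace ((Cob.one a').hcomp g.dual))).sheet (compV (.inr (traceV (hcompV (.inr (dualV (g.surf.src (a.curve.bot i))))))))) =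
       u (((Cob.coev a').comp (Cob.trace ((Cob.one a').hcomp g.dual))).sheet (compV (.inl (coevV (Quot.mk _ (a'.curve.bot i)))))) := by
      have := B2.bot
      clear H1 h1; simp at H2 ⊢; grind
    simp [t1, t2] at e1 e2 ⊢
    linarith
  · intro; simp
end Homeos

/-! ### Bending a cobordism into the closure, and its inverse -/

section Bending
open Tangle Cob
variable {X : Type} {m k n : ℕ}

/-- `(b ⊗ a^∨) ⊗ a ≅ b ⊗ ((a^∨ ⊗ a^∨^∨) ⊗ 1)^∨`. -/
def Isotopy.unbend (a b : Tangle m n) : Isotopy (.comp (.comp b (.dual a)) a)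
    (.comp b (.dual (.comp (.comp (.dual a) (.dual (.dual a))) (.id n)))) := by
  have H1 := (Tangle.comp (.comp b (.dual a)) a).isCol_strand id
  have H2 := (Tangle.comp b
    (.dual (.comp (.comp (.dual a) (.dual (.dual a))) (.id n)))).isCol_strand id
  refine Isotopy.ofCol
    (compElim (compElim (fun x => Quot.mk _ (compPt (.inl x)))
      fun x => Quot.mk _ (compPt (.inr (dualPt (compPt (.inl (compPt (.inr (dualPt x)))))))))
      fun x => Quot.mk _ (compPt (.inr (dualPt (compPt (.inl (compPt (.inl (dualPt x)))))))))
    (compElim (fun x => Quot.mk _ (compPt (.inl (compPt (.inl x)))))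
      fun x => compElim (compElim (fun x => Quot.mk _ (compPt (.inr (dualPt.symm x))))
        fun x => Quot.mk _ (compPt (.inl (compPt (.inr (dualPt.symm x))))))
        (fun j => Quot.mk _ (compPt (.inl (compPt (.inl (b.curve.bot (idPt.symm j)))))))
        (dualPt.symm x)) ?_ ?_ ?_ ?_ ?_ ?_
  · simp at H2 ⊢; grind
  · simp at H1 ⊢; grind
  · simp
  · simp at H2 ⊢; grind
  · simp
  · simp

/-- `b ⊗ 1^∨ ≅ b`. -/
def Isotopy.rightDualUnit (b : Tangle m n) : Isotopy (.comp b (.dual (.id n))) b := by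
  have H1 := (Tangle.comp b (.dual (.id n))).isCol_strand id
  have H2 := b.isCol_strand id
  refine Isotopy.ofCol
    (compElim (fun x => Quot.mk _ x) fun j => Quot.mk _ (b.curve.bot (idPt.symm (dualPt.symm j))))
    (fun x => Quot.mk _ (compPt (.inl x))) ?_ ?_ ?_ ?_ ?_ ?_
  · simp at H2 ⊢; grind
  · simp at H1 ⊢; grind
  · simp at H1 ⊢; grind
  · simp
  · simp
  · simp

@[simp] theorem Isotopy.unbend_1 (a b : Tangle m n) (x) :
    (Isotopy.unbend a b).equiv (Quot.mk _ (compPt (.inl (compPt (.inl x))))) =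
      Quot.mk _ (compPt (.inl x)) := rfl
@[simp] theorem Isotopy.unbend_2 (a b : Tangle m n) (x) :
    (Isotopy.unbend a b).equiv (Quot.mk _ (compPt (.inl (compPt (.inr (dualPt x)))))) =
      Quot.mk _ (compPt (.inr (dualPt (compPt (.inl (compPt (.inr (dualPt (dualPt x))))))))) := rfl
@[simp] theorem Isotopy.unbend_3 (a b : Tangle m n) (x) :
    (Isotopy.unbend a b).equiv (Quot.mk _ (compPt (.inr x))) =
      Quot.mk _ (compPt (.inr (dualPt (compPt (.inl (compPt (.inl (dualPt x)))))))) := rfl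
@[simp] theorem Isotopy.rightDualUnit_inl (b : Tangle m n) (x) :
    (Isotopy.rightDualUnit b).equiv (Quot.mk _ (compPt (.inl x))) = Quot.mk _ x := rfl
@[simp] theorem Isotopy.rightDualUnit_inr (b : Tangle m n) (j) :
    (Isotopy.rightDualUnit b).equiv (Quot.mk _ (compPt (.inr (dualPt (idPt j))))) =
      Quot.mk _ (b.curve.bot j) := rfl

/-- The surface swept out by `a^∨`, with a band to each of the strands of `1_n`. -/
def Cob.halfTurn (a : Tangle m n) :
    Cob (.id n) (.comp (.comp (.dual a) (.dual (.dual a))) (.id n)) :=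
  ((Cob.cyl (.emptyBeside (.id n))).comp ((Cob.coev (.dual a)).beside (.one (.id n)))).comp
    (.merge (.comp (.dual a) (.dual (.dual a))) (.id n))

section

variable {a : Tangle m n}

/-- The coloring of a half turn. -/
def Cob.halfTurnCol (α : a.Pt → X) (hα : a.IsCol α) (ι : Fin n → X) : (halfTurn a).surf.V → X :=
  compElim (compElim
      (cylElim (Tangle.besideElim (fun j => (idPt.symm j).elim0) (fun j => ι (idPt.symm j)))
        (by simp))
      (Cob.besideElim (coevElim (fun x => α (dualPt.symm x)) (by simpa using hα))
        (cylElim (fun j => ι (idPt.symm j)) (by simp))))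
      (mergeElim (Tangle.compElim (fun x => α (dualPt.symm x))
        fun x => α (dualPt.symm (dualPt.symm x))) (fun j => ι (idPt.symm j)))

variable (α : a.Pt → X) (hα : a.IsCol α) (ι : Fin n → X)

@[simp] theorem Cob.halfTurnCol_src (j) :
    halfTurnCol α hα ι ((halfTurn a).surf.src (idPt j)) = ι j := rfl
@[simp] theorem Cob.halfTurnCol_tgt_1 (x) : halfTurnCol α hα ι ((halfTurn a).surf.tgt
    (compPt (.inl (compPt (.inl (dualPt x)))))) = α x := rfl
@[simp] theorem Cob.halfTurnCol_tgt_2 (x) : halfTurnCol α hα ι ((halfTurn a).surf.tgt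
    (compPt (.inl (compPt (.inr (dualPt (dualPt x))))))) = α x := rfl
@[simp] theorem Cob.halfTurnCol_tgt_3 (j) : halfTurnCol α hα ι ((halfTurn a).surf.tgt
    (compPt (.inr (idPt j)))) = ι j := rfl

theorem Cob.halfTurnCol_congr {α α' : a.Pt → X} {hα : a.IsCol α} {hα' : a.IsCol α'}
    {ι ι' : Fin n → X} (h : ∀ x, α x = α' x) (h' : ∀ j, ι j = ι' j) (v) :
    halfTurnCol α hα ι v = halfTurnCol α' hα' ι' v := by
  obtain rfl := funext h
  obtain rfl := funext h'
  rfl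

theorem Cob.isCol_halfTurnCol (h : ∀ j, α (a.curve.bot j) = ι j) :
    (halfTurn a).IsCol (halfTurnCol α hα ι) := by
  unfold halfTurnCol halfTurn
  simp
  grind

theorem Cob.IsCol.halfTurn {c : (halfTurn a).surf.V → X} (hc : (halfTurn a).IsCol c) :
    (∀ x, c ((Cob.halfTurn a).surf.tgt (compPt (.inl (compPt (.inr (dualPt (dualPt x))))))) =
      c ((Cob.halfTurn a).surf.tgt (compPt (.inl (compPt (.inl (dualPt x))))))) ∧
    (∀ j, c ((Cob.halfTurn a).surf.tgt (compPt (.inl (compPt (.inl (dualPt (a.curve.bot j))))))) =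
      c ((Cob.halfTurn a).surf.src (idPt j))) ∧
    ∀ j, c ((Cob.halfTurn a).surf.tgt (compPt (.inr (idPt j)))) =
      c ((Cob.halfTurn a).surf.src (idPt j)) := by
  revert c
  unfold Cob.halfTurn
  intro c hc
  simp at hc ⊢
  grind

/-- Every piece of a half turn belongs to a rotated strand of `a` or to a strand of `1_n`, so its
color can be read off on the boundary. This allows half turns to be handled without unfolding them.
-/
theorem Cob.IsCol.eq_halfTurnCol {c : (Cob.halfTurn a).surf.V → X} (hc : (Cob.halfTurn a).IsCol c)
    (h : a.IsCol fun x => c ((Cob.halfTurn a).surf.tgt (compPt (.inl (compPt (.inl (dualPt x))))))) :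
    ∀ v, c v = halfTurnCol
      (fun x => c ((Cob.halfTurn a).surf.tgt (compPt (.inl (compPt (.inl (dualPt x)))))))
      h (fun j => c ((Cob.halfTurn a).surf.src (idPt j))) v := by
  revert c
  unfold halfTurnCol Cob.halfTurn
  intro c hc h
  simp at hc ⊢
  grind

theorem Cob.two_mul_wtInt_halfTurn {c : (Cob.halfTurn a).surf.V → ℤ}
    (hc : (Cob.halfTurn a).IsCol c) :
    2 * (Cob.halfTurn a).wtInt c =
      ∑ j, c ((Cob.halfTurn a).surf.tgt (compPt (.inl (compPt (.inl (dualPt (a.curve.top j))))))) +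
      ∑ j, c ((Cob.halfTurn a).surf.tgt (compPt (.inl (compPt (.inl (dualPt (a.curve.bot j))))))) -
      2 * ∑ j, c ((Cob.halfTurn a).surf.src (idPt j)) := by
  revert c
  unfold Cob.halfTurn
  intro c hc
  have e := Cob.two_mul_wtInt_coev (.dual a) fun x => c (compV (.inl (compV (.inr (besideV (.inl x))))))
  simp at hc e ⊢
  have t1 : ∀ x, c (compV (.inl (compV (.inr (besideV (.inl (coevV (Quot.mk _ (dualPt x)))))))))
    = c (compV (.inr (mergeV (.inl (compPt (.inl (dualPt x))))))) := by grind
  have t2 : ∀ j, c (compV (.inr (mergeV (.inr (idPt j))))) = 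
    c (compV (.inl (compV (.inl (cylV _ (Quot.mk _ (besidePt (.inr (idPt j))))))))) := by grind
  simp only [t1] at e
  simp only [t2]
  linarith

theorem Cob.dotInt_halfTurn (c : (halfTurn a).surf.V → ℤ) : (halfTurn a).dotInt c = 0 := by
  revert c
  unfold halfTurn
  intro c
  simp

end

/-- The inverse of bending. -/
def Cob.unbend {a b : Tangle m n} (f : Cob (.id 0) (.trace (.comp b (.dual a)))) : Cob a b :=
  ((Cob.cyl (.emptyBeside a)).comp (f.beside (.one a))).comp
    ((Cob.merge (.comp b (.dual a)) a).comp
      ((Cob.cyl (.unbend a b)).comp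
        (((Cob.one b).hcomp (halfTurn a).dual).comp (.cyl (.rightDualUnit b)))))

/-- The pieces of a surface in its unbending. -/
def Cob.unbendV {a b : Tangle m n} (f : Cob (.id 0) (.trace (.comp b (.dual a)))) (v : f.surf.V) :
    f.unbend.surf.V := compV (.inl (compV (.inr (besideV (.inl v)))))

/-- The coloring of an unbending. -/
def Cob.unbendCol {a b : Tangle m n} {f : Cob (.id 0) (.trace (.comp b (.dual a)))}
    (γ : f.surf.V → X) (α : a.Pt → X) (β : b.Pt → X) (hα : a.IsCol α) (hβ : b.IsCol β)
    (hb : ∀ j, α (a.curve.bot j) = β (b.curve.bot j)) :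
    f.unbend.surf.V → X :=
  compElim (compElim (cylElim (Tangle.besideElim (fun j => (idPt.symm j).elim0) α)
      (by simpa using hα))
    (Cob.besideElim γ (cylElim α hα)))
  (compElim (mergeElim (Tangle.compElim β fun x => α (dualPt.symm x)) α)
  (compElim (cylElim (Tangle.compElim β fun x => Tangle.compElim (Tangle.compElim
      (fun x => α (dualPt.symm x)) fun x => α (dualPt.symm (dualPt.symm x)))
      (fun j => β (b.curve.bot (idPt.symm j))) (dualPt.symm x))
      (by simp; grind))
  (compElim (hcompElim (cylElim β hβ) fun v => halfTurnCol α hα (fun j => β (b.curve.bot j))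
      (dualV.symm v)) (cylElim β hβ))))

section

variable {a b : Tangle m n} {f : Cob (.id 0) (.trace (.comp b (.dual a)))}
    (γ : f.surf.V → X) (α : a.Pt → X) (β : b.Pt → X) (hα : a.IsCol α) (hβ : b.IsCol β)
    (hb : ∀ j, α (a.curve.bot j) = β (b.curve.bot j))

@[simp] theorem Cob.unbendCol_src (x) : unbendCol γ α β hα hβ hb (f.unbend.surf.src x) = α x := rfl
@[simp] theorem Cob.unbendCol_tgt (x) : unbendCol γ α β hα hβ hb (f.unbend.surf.tgt x) = β x := rfl
@[simp] theorem Cob.unbendCol_unbendV (x) :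
    unbendCol γ α β hα hβ hb (f.unbendV x) = γ x := rfl

theorem Cob.isCol_unbendCol (hγ : f.IsCol γ)
    (ht : ∀ j, α (a.curve.top j) = β (b.curve.top j))
    (h1 : ∀ x, γ (f.surf.tgt (tracePt (compPt (.inl x)))) = β x)
    (h2 : ∀ x, γ (f.surf.tgt (tracePt (compPt (.inr (dualPt x))))) = α x) :
    f.unbend.IsCol (unbendCol γ α β hα hβ hb) := by
  have := isCol_halfTurnCol α hα _ hb
  unfold unbendCol unbend
  simp [*]

theorem Cob.IsCol.unbend {c : f.unbend.surf.V → X} (hc : f.unbend.IsCol c) :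
    f.IsCol (fun v => c (f.unbendV v)) ∧
    (∀ x, c (f.unbend.surf.src x) = c (f.unbendV (f.surf.tgt (tracePt (compPt (.inr (dualPt x))))))) ∧
    (∀ x, c (f.unbend.surf.tgt x) = c (f.unbendV (f.surf.tgt (tracePt (compPt (.inl x)))))) := by
  revert c
  unfold unbendV Cob.unbend
  intro c hc
  simp at hc ⊢
  have h := hc.2.1.2.1.1.1.1.halfTurn
  grind

-- Outside `f` the unbending consists of cylinders, saddles and a half turn, all of which meet
-- sheets of its source or of its target.
set_option maxHeartbeats 1600000 in
theorem Cob.IsCol.eq_unbendCol {c : f.unbend.surf.V → X} (hc : f.unbend.IsCol c) (v) :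
    c v = unbendCol (f := f) (fun v => c (f.unbendV v)) (fun x => c (f.unbend.surf.src x))
      (fun x => c (f.unbend.surf.tgt x)) hc.bd.src hc.bd.tgt hc.bd.bot v := by
  revert v
  have h1 := hc.bd.src
  have h2 := hc.bd.bot
  revert c
  unfold unbendCol unbendV Cob.unbend
  intro c hc h1 h2
  simp at hc h1 h2 ⊢
  have h := hc.2.1.2.1.1.1.1.halfTurn
  have h3 : a.IsCol fun x => c (compV (.inr (compV (.inr (compV (.inr (compV (.inl (hcompV
      (.inr (dualV ((Cob.halfTurn a).surf.tgt (compPt (.inl (compPt (.inl (dualPt x))))))))))))))))) := by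
    have := hc.2.1.2.1.1.1.1.bd.tgt
    simp at this
    exact this.1.1
  have h' := hc.2.1.2.1.1.1.1.eq_halfTurnCol h3
  have e1 : ∀ x, c (compV (.inr (compV (.inr (compV (.inr (compV (.inl (hcompV
      (.inr (dualV ((Cob.halfTurn a).surf.tgt (compPt (.inl (compPt (.inl (dualPt x))))))))))))))))) =
      c (compV (.inl (compV (.inl (cylV _ (Quot.mk _ (besidePt (.inr x)))))))) := by grind
  have e2 : ∀ j, c (compV (.inr (compV (.inr (compV (.inr (compV (.inl (hcompV
      (.inr (dualV ((Cob.halfTurn a).surf.src (idPt j))))))))))))) =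
      c (compV (.inr (compV (.inr (compV (.inr (compV (.inr
        (cylV _ (Quot.mk _ (b.curve.bot j))))))))))) := by grind
  have key := fun v => (h' v).trans (halfTurnCol_congr (hα' := h1) e1 e2 v)
  simp only [← key]
  clear key h' h3 h1
  repeat' apply And.intro
  all_goals intro x
  all_goals first | trivial | rfl | (change c _ = c _; clear e1 e2; grind)

/-- The saddles join the source `a` to the half `a^∨` of the boundary of `f`, and the half `b` runs
through to the target. So `f` alone determines the coloring, and the composites of colorings in
`unbend_bend` and `bend_unbend` need to be checked only there. -/
theorem Cob.IsCol.unbend_ext {c c' : f.unbend.surf.V → X} (hc : f.unbend.IsCol c)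
    (hc' : f.unbend.IsCol c') (h : ∀ v, c (f.unbendV v) = c' (f.unbendV v)) (v) : c v = c' v := by
  have e1 : (fun v => c (f.unbendV v)) = fun v => c' (f.unbendV v) := funext h
  have e2 : (fun x => c (f.unbend.surf.src x)) = fun x => c' (f.unbend.surf.src x) :=
    funext fun x => by rw [hc.unbend.2.1, hc'.unbend.2.1, h]
  have e3 : (fun x => c (f.unbend.surf.tgt x)) = fun x => c' (f.unbend.surf.tgt x) :=
    funext fun x => by rw [hc.unbend.2.2, hc'.unbend.2.2, h]
  rw [hc.eq_unbendCol, hc'.eq_unbendCol]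
  simp only [e1, e2, e3]

-- After doubling, the saddles that merge `a` contribute `-2` at every top end, and the half turn
-- contributes `1` at every top end and `1 - 2` at every bottom end. The total is the opposite of
-- `two_mul_wtInt_coev`, and this is why bending and unbending cancel.
set_option maxHeartbeats 1600000 in
theorem Cob.two_mul_wtInt_unbend {c : f.unbend.surf.V → ℤ} (hc : f.unbend.IsCol c) :
    2 * f.unbend.wtInt c = 2 * f.wtInt (fun v => c (f.unbendV v)) -
      ∑ j, c (f.unbend.surf.src (a.curve.top j)) - ∑ j, c (f.unbend.surf.src (a.curve.bot j)) := by
  revert c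
  unfold unbendV Cob.unbend
  intro c hc
  have h1 := hc.bd.bot
  simp at hc h1 ⊢
  have h := hc.2.1.2.1.1.1.1.halfTurn
  have h' := two_mul_wtInt_halfTurn hc.2.1.2.1.1.1.1
  have e1 : ∀ x, c (compV (.inr (compV (.inr (compV (.inr (compV (.inl (hcompV
      (.inr (dualV ((Cob.halfTurn a).surf.tgt (compPt (.inl (compPt (.inl (dualPt x))))))))))))))))) =
      c (compV (.inl (compV (.inl (cylV _ (Quot.mk _ (besidePt (.inr x)))))))) := by grind
  have e2 : ∀ j, c (compV (.inr (compV (.inr (compV (.inr (compV (.inl (hcompV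
      (.inr (dualV ((Cob.halfTurn a).surf.src (idPt j))))))))))))) =
      c (compV (.inl (compV (.inl (cylV _ (Quot.mk _ (besidePt (.inr (a.curve.bot j))))))))) := by grind
  have e3 : ∀ x, c (compV (.inr (compV (.inl (mergeV (.inr x)))))) =
      c (compV (.inl (compV (.inl (cylV _ (Quot.mk _ (besidePt (.inr x)))))))) := by grind
  simp only [e1, e2] at h'
  simp only [e3]
  linarith

theorem Cob.dotInt_unbend (c : f.unbend.surf.V → ℤ) :
    f.unbend.dotInt c = f.dotInt (fun v => c (f.unbendV v)) := by
  revert c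
  unfold unbendV unbend
  intro c
  simp [dotInt_halfTurn]

end

/-- The zigzag identity of a duality: a strand of `a` that is rotated away and rotated back is
straightened, and only the sheets of `f` remain. -/
theorem Homeo.unbend_bend {a b : Tangle m n} (f : Cob a b) :
    Homeo ((Cob.coev a).comp (f.hcomp (.one (.dual a))).trace).unbend f := by
  have H1 := ((Cob.coev a).comp (f.hcomp (.one (.dual a))).trace).unbend.isCol_sheet
  have H2 := f.isCol_sheet
  have hα := H2.bd.src
  have hβ := H2.bd.tgt
  let γ : ((Cob.coev a).comp (f.hcomp (.one (.dual a))).trace).surf.V → f.Sheet :=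
    compElim (coevElim (fun x => Quot.mk _ (f.surf.src x)) hα)
      fun v => hcompElim (fun v => Quot.mk _ v)
        (cylElim (fun x => Quot.mk _ (f.surf.src (dualPt.symm x))) (by simpa using hα))
          (traceV.symm v)
  let ω := (Cob.coev a).comp (f.hcomp (.one (.dual a))).trace
  have hθ : ω.unbend.IsCol (unbendCol (f := ω) γ _ _ hα hβ H2.bd.bot) := by
    have := H2.bd.top
    have := H2.bd.bot
    refine isCol_unbendCol _ _ _ _ _ _ ?_ H2.bd.top ?_ ?_
    · simp [ω, γ] at H2 ⊢; grind
    · simp [ω, γ]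
    · simp [ω, γ]
  refine homeo_of_col (unbendCol γ _ _ hα hβ H2.bd.bot)
    (fun v => Quot.mk _ (unbendV _ (compV (.inr (traceV (hcompV (.inl v)))))))
    hθ ?_ ?_ ?_ ?_ ?_ ?_ ?_
  · have := H1.unbend.1; simp at this; exact this.1.1.1
  · intro v
    revert v
    have h0 : ω.unbend.IsCol (ω.unbend.sheet) := H1
    refine Cob.IsCol.unbend_ext (f := ω) (fun _ _ h => congrArg _ (hθ h)) h0 ?_
    have h1 := h0.unbend.1
    simp [ω, γ] at h1 ⊢
    grind
  · simp [γ]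
  · simp
  · simp
  · intro u
    have := two_mul_wtInt_unbend (f := ω) (c := fun v => u (unbendCol γ _ _ hα hβ H2.bd.bot v)) (fun _ _ h => congrArg u (hθ h))
    have e := Cob.two_mul_wtInt_coev a fun v => u (coevElim (fun x => f.sheet (f.surf.src x)) hα v)
    simp [γ, ω] at this e ⊢
    linarith
  · intro u
    rw [dotInt_unbend]
    simp [γ]

theorem Homeo.bend_unbend {a b : Tangle m n} (f : Cob (.id 0) (.trace (.comp b (.dual a)))) :
    Homeo ((Cob.coev a).comp (f.unbend.hcomp (.one (.dual a))).trace) f := by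
  have H1 := ((Cob.coev a).comp (f.unbend.hcomp (.one (.dual a))).trace).isCol_sheet
  have H2 := f.isCol_sheet
  have h := H2.bd.tgt
  simp at h
  obtain ⟨⟨hβ, hα, hb⟩, ht⟩ := h
  have hθ : f.unbend.IsCol (unbendCol (fun v => f.sheet v) _ _ hα hβ (fun j => (hb j).symm)) :=
    isCol_unbendCol _ _ _ _ _ _ H2 (fun j => (ht j).symm) (fun _ => rfl) (fun _ => rfl)
  refine homeo_of_col (compElim (coevElim _ hα) fun v => hcompElim (unbendCol (fun v => f.sheet v) _ _ hα hβ fun j => (hb j).symm)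
      (cylElim (fun x => Quot.mk _ (f.surf.tgt (tracePt (compPt (.inr x))))) (by simpa using hα)) (traceV.symm v))
    (fun v => Quot.mk _ (compV (.inr (traceV (hcompV (.inl (unbendV _ v)))))))
    ?_ ?_ ?_ ?_ ?_ ?_ ?_ ?_
  · simp; exact ⟨⟨hθ, hb⟩, ht⟩
  · simp at H1
    have := H1.1.1.1.unbend
    exact this.1
  · have H3 := H1
    simp at H1
    have h1 := H1.1.1.1.unbend
    have h0 := Cob.IsCol.unbend_ext (c := fun v => Cob.desc f (fun v => ((Cob.coev a).comp
        (f.unbend.hcomp (.one (.dual a))).trace).sheet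
          (compV (.inr (traceV (hcompV (.inl (unbendV _ v))))))) h1.1 (unbendCol (fun v => f.sheet v) _ _ hα hβ (fun j => (hb j).symm) v))
      (fun _ _ h => congrArg _ (hθ h)) H1.1.1.1 fun v => rfl
    simp at h0 ⊢
    simp [h0]
    grind
  · simp
  · simp
  · simp
  · intro u
    have := two_mul_wtInt_unbend (f := f) (c := fun v => u (unbendCol (fun v => f.sheet v) _ _ hα hβ (fun j => (hb j).symm) v)) (fun _ _ h => congrArg u (hθ h))
    have e := Cob.two_mul_wtInt_coev a fun v => u (coevElim _ hα v)
    simp at this e ⊢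
    linarith
  · intro u
    simp [dotInt_unbend]
end Bending

/-! ### Splitting a circle off a turnback -/

section Turnback
open Tangle Cob
variable {X : Type} {m k n : ℕ}

/-- The end point of the strand `t` in the presence of an arc at `l`. -/
def unpinch (l : Fin (n + 1)) (t : Fin n) : Fin (n + 2) :=
  if t.val < l.val then ⟨t.val, by omega⟩ else ⟨t.val + 2, by omega⟩

theorem pinch_unpinch (l : Fin (n + 1)) (t : Fin n) : pinch l (unpinch l t) = some t := by
  unfold unpinch pinch
  split_ifs <;> simp_all only [Fin.ext_iff, Option.some.injEq] <;>
    first | rfl | omega | (exfalso; simp_all; omega)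

theorem unpinch_eq {l : Fin (n + 1)} {t : Fin n} {j : Fin (n + 2)} (h : pinch l j = some t) :
    unpinch l t = j :=
  pinch_eq_some_inj l (pinch_unpinch l t) h

theorem pinch_eq_none {l : Fin (n + 1)} {j : Fin (n + 2)} :
    pinch l j = none ↔ j = l.castSucc ∨ j = l.succ := by
  unfold pinch
  simp only [Fin.ext_iff, Fin.val_castSucc, Fin.val_succ]
  split_ifs <;> simp <;> omega

/-- A component has at most two ends by `ends_le_two`, and the turnback already uses two. -/
theorem Tangle.top_ne_of_turnback (a : Tangle (n + 2) k) {l : Fin (n + 1)}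
    (h : a.strand (a.curve.top l.castSucc) = a.strand (a.curve.top l.succ)) :
    (∀ j, a.strand (a.curve.top j) = a.strand (a.curve.top l.castSucc) ↔ pinch l j = none) ∧
      ∀ j, a.strand (a.curve.bot j) ≠ a.strand (a.curve.top l.castSucc) := by
  classical
  have h2 := a.ends_le_two (a.strand (a.curve.top l.castSucc))
  have hne : l.castSucc ≠ l.succ := by simp [Fin.ext_iff]
  unfold Tangle.ends at h2
  have h3 : 2 ≤ Nat.card {i // a.strand (a.curve.top i) = a.strand (a.curve.top l.castSucc)} := by
    rw [Nat.card_eq_fintype_card, Fintype.card_subtype]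
    refine (Finset.card_pair hne).symm.le.trans (Finset.card_le_card fun j hj => ?_)
    rcases Finset.mem_insert.1 hj with rfl | hj
    · simp
    · simp [Finset.mem_singleton.1 hj, h]
  refine ⟨fun j => ⟨fun hj => ?_, fun hj => ?_⟩, fun j hj => ?_⟩
  · by_contra hc
    rw [pinch_eq_none, not_or] at hc
    have : 3 ≤ Nat.card {i // a.strand (a.curve.top i) = a.strand (a.curve.top l.castSucc)} := by
      rw [Nat.card_eq_fintype_card, Fintype.card_subtype]
      refine (Finset.card_eq_three.2 ⟨j, l.castSucc, l.succ, hc.1, hc.2, hne, rfl⟩).symm.le.trans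
        (Finset.card_le_card fun i hi => ?_)
      simp only [Finset.mem_insert, Finset.mem_singleton] at hi
      rcases hi with rfl | rfl | rfl <;> simp [hj, h]
    omega
  · rcases pinch_eq_none.1 hj with rfl | rfl
    · rfl
    · exact h.symm
  · have : 0 < Nat.card {j // a.strand (a.curve.bot j) = a.strand (a.curve.top l.castSucc)} :=
      Nat.card_pos_iff.2 ⟨⟨⟨j, hj⟩⟩, inferInstance⟩
    omega

open Classical in
/-- A turnback splits off a diagram, up to a circle. -/
def Isotopy.turnback (a : Tangle (n + 2) k) (l : Fin (n + 1))
    (h : a.strand (a.curve.top l.castSucc) = a.strand (a.curve.top l.succ)) :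
    Isotopy (.beside circle a) (.comp (.cup l) (.comp (.cap l) a)) := by
  have H1 := (Tangle.beside circle a).isCol_strand id
  have H2 := (Tangle.comp (.cup l) (.comp (.cap l) a)).isCol_strand id
  have h0 := a.top_ne_of_turnback h
  have hp := fun t => pinch_unpinch l t
  have hq := fun t j => unpinch_eq (l := l) (t := t) (j := j)
  have hs : ∀ x y, a.curve.adj x y → a.strand x = a.strand y := fun _ _ h => Quot.sound h
  -- Capping closes the turnback of `a` into a circle, and the new cup takes over its two ends. Thus
  -- the extra circle goes to the capped arc, the turnback of `a` to the cup, and all other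
  -- components to themselves.
  refine Isotopy.ofCol
    (besideElim (fun _ => Quot.mk _ (compPt (.inr (compPt (.inl (capPt l none))))))
      fun x => if a.strand x = a.strand (a.curve.top l.castSucc) then
        Quot.mk _ (compPt (.inl (cupPt l none))) else Quot.mk _ (compPt (.inr (compPt (.inr x)))))
    (compElim (fun t => ((cupPt l).symm t).elim (Quot.mk _ (besidePt (.inr (a.curve.top l.castSucc))))
        fun t => Quot.mk _ (besidePt (.inr (a.curve.top (unpinch l t)))))
      (compElim (fun t => ((capPt l).symm t).elim
          (Quot.mk _ (besidePt (.inl (compPt (.inl (capPt 0 none))))))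
          fun t => Quot.mk _ (besidePt (.inr (a.curve.top (unpinch l t)))))
        fun x => if a.strand x = a.strand (a.curve.top l.castSucc) then
          Quot.mk _ (besidePt (.inl (compPt (.inl (capPt 0 none)))))
          else Quot.mk _ (besidePt (.inr x)))) ?_ ?_ ?_ ?_ ?_ ?_
  · clear H1; simp at H2 ⊢
    intro x y hxy
    have := hs x y hxy
    simp only at this ⊢
    rw [this]
    split
    · rfl
    · exact H2.1.1 hxy
  · clear H2; simp at H1 ⊢
    refine ⟨?_, ?_⟩
    · intro x y hxy
      have := hs x y hxy
      simp only at this ⊢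
      rw [this]
      split
      · rfl
      · exact H1.2 hxy
    · intro j
      rcases hj : pinch l j with _ | t
      · simp [(h0.1 j).2 hj]
      · rw [if_neg (by rw [h0.1 j, hj]; simp)]
        simp [hq t j hj]
  · clear H2; simp at H1 ⊢
    have hc : (Tangle.beside circle a).strand (besidePt (.inl (compPt (.inl (capPt 0 none))))) =
      (Tangle.beside circle a).strand (besidePt (.inl (compPt (.inr (cupPt 0 none))))) := H1.1.1
    have key : ∀ x, a.strand x = a.strand (a.curve.top l.castSucc) →
      (Tangle.beside circle a).strand (besidePt (.inr x)) =
        (Tangle.beside circle a).strand (besidePt (.inr (a.curve.top l.castSucc))) :=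
      fun x hx => congrArg (a.desc _ H1.2) hx
    refine ⟨hc, fun x => ?_⟩
    split_ifs with hx
    · simp [key x hx]
    · simp [hx]
  · clear H1; simp at H2 ⊢
    have key : ∀ x, a.strand x = a.strand (a.curve.top l.castSucc) →
      (Tangle.comp (.cup l) (.comp (.cap l) a)).strand (compPt (.inr (compPt (.inr x)))) =
        Quot.mk _ (compPt (.inr (compPt (.inl (capPt l none))))) :=
      fun x hx => (congrArg (a.desc _ H2.1.1) hx).trans (by
        rw [Tangle.desc_mk, ← H2.1.2, (h0.1 _).1 rfl])
    have h3 : ∀ t, a.strand (a.curve.top (unpinch l t)) ≠ a.strand (a.curve.top l.castSucc) :=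
      fun t => by rw [Ne, h0.1, hp]; simp
    refine ⟨fun j => ?_, fun j => ?_, fun x => ?_⟩
    · rw [if_neg (h3 j), ← H2.1.2, hp]
      exact (H2.2 j).symm
    · rw [if_neg (h3 j), ← H2.1.2, hp]
    · split_ifs with hx
      · simp [key x hx]
      · simp [hx]
  · clear H1; simp at H2 ⊢
    intro j
    rcases hj : pinch l j with _ | t
    · rw [if_pos ((h0.1 j).2 hj)]
    · rw [if_neg (by rw [h0.1 j, hj]; simp)]
      grind
  · clear H1; simp at H2 ⊢
    grind

end Turnback

/-! ### The same identities for linear combinations, and quantum degrees -/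

section HomLevel
variable {m k n l : ℕ}

theorem cob_eq {a b : Tangle m n} {f g : Cob a b} (h : Homeo f g) : cob f = cob g := by
  rw [cob, cob, ← sub_eq_zero, ← map_sub]
  exact (Submodule.Quotient.mk_eq_zero _).2 (Null.homeo f g h)

@[elab_as_elim]
theorem Hom.induction_on {a b : Tangle m n} {p : Hom a b → Prop} (x : Hom a b)
    (cob : ∀ f, p (cob f)) (zero : p 0) (add : ∀ x y, p x → p y → p (x + y))
    (smul : ∀ (r : ℤ[X]) x, p x → p (r • x)) : p x := by
  induction x using Submodule.Quotient.induction_on with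
  | _ x =>
    induction x using Finsupp.induction_linear with
    | zero => exact zero
    | add x y hx hy => exact add _ _ hx hy
    | single f r =>
      have := smul r _ (cob f)
      rwa [BN.cob, Submodule.mkQ_apply, ← Submodule.Quotient.mk_smul, Finsupp.smul_single, smul_eq_mul,
        mul_one] at this

theorem lift₂_cob {A B C : Type} (F : A → B → C) (NA : Submodule ℤ[X] (A →₀ ℤ[X]))
    (NB : Submodule ℤ[X] (B →₀ ℤ[X])) (NC : Submodule ℤ[X] (C →₀ ℤ[X])) (hA hB) (x : A) (y : B) :
    lift₂ F NA NB NC hA hB (NA.mkQ (.single x 1)) (NB.mkQ (.single y 1)) =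
      NC.mkQ (.single (F x y) 1) := by
  simp [lift₂, Finsupp.linearCombination_single, Finsupp.lmapDomain_apply, Finsupp.mapDomain_single]

namespace Hom

@[simp] theorem comp_cob {a b c : Tangle m n} (f : Cob a b) (g : Cob b c) :
    Hom.comp (cob f) (cob g) = cob (f.comp g) := lift₂_cob ..
@[simp] theorem hcomp_cob {a a' : Tangle m k} {b b' : Tangle k n} (f : Cob a a') (g : Cob b b') :
    Hom.hcomp (cob f) (cob g) = cob (f.hcomp g) := lift₂_cob ..
@[simp] theorem beside_cob {c c' : Tangle 0 0} {a a' : Tangle m n} (f : Cob c c') (g : Cob a a') :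
    Hom.beside (cob f) (cob g) = cob (f.beside g) := lift₂_cob ..
@[simp] theorem trace_cob {a b : Tangle n n} (f : Cob a b) : Hom.trace (cob f) = cob f.trace :=
  (Submodule.mapQ_apply _ _ _ _).trans
    (by rw [Finsupp.lmapDomain_apply, Finsupp.mapDomain_single]; rfl)
@[simp] theorem dual_cob {a b : Tangle m n} (f : Cob a b) : Hom.dual (cob f) = cob f.dual :=
  (Submodule.mapQ_apply _ _ _ _).trans
    (by rw [Finsupp.lmapDomain_apply, Finsupp.mapDomain_single]; rfl)

theorem comp_assoc {a b c d : Tangle m n} (f : Hom a b) (g : Hom b c) (h : Hom c d) :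
    comp (comp f g) h = comp f (comp g h) := by
  induction f using induction_on with
  | cob f =>
    induction g using induction_on with
    | cob g =>
      induction h using induction_on with
      | cob h => simpa using cob_eq (Homeo.assoc f g h)
      | _ => simp_all
    | _ => simp_all
  | _ => simp_all

@[simp] theorem one_comp {a b : Tangle m n} (f : Hom a b) : comp (one a) f = f := by
  induction f using induction_on with
  | cob f => simpa [one] using cob_eq (Homeo.one_comp f)
  | _ => simp_all

@[simp] theorem comp_one {a b : Tangle m n} (f : Hom a b) : comp f (one b) = f := by
  induction f using induction_on with
  | cob f => simpa [one] using cob_eq (Homeo.comp_one f)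
  | _ => simp_all

theorem hcomp_comp {a b c : Tangle m k} {a' b' c' : Tangle k n} (f : Hom a b) (g : Hom b c)
    (f' : Hom a' b') (g' : Hom b' c') :
    comp (hcomp f f') (hcomp g g') = hcomp (comp f g) (comp f' g') := by
  induction f using induction_on with
  | cob f =>
    induction g using induction_on with
    | cob g =>
      induction f' using induction_on with
      | cob f' =>
        induction g' using induction_on with
        | cob g' => simpa using (cob_eq (Homeo.interchange f g f' g')).symm
        | _ => simp_all
      | _ => simp_all
    | _ => simp_all
  | _ => simp_all

@[simp] theorem hcomp_one_one (a : Tangle m k) (b : Tangle k n) :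
    hcomp (one a) (one b) = one (.comp a b) := by
  simpa [one] using cob_eq (Homeo.one_hcomp_one a b)

theorem trace_comp {a b c : Tangle n n} (f : Hom a b) (g : Hom b c) :
    trace (comp f g) = comp (trace f) (trace g) := by
  induction f using induction_on with
  | cob f =>
    induction g using induction_on with
    | cob g => simpa using cob_eq (Homeo.trace_comp f g)
    | _ => simp_all
  | _ => simp_all

@[simp] theorem trace_one (a : Tangle n n) : trace (one a) = one (.trace a) := by
  simpa [one] using cob_eq (Homeo.trace_one a)

theorem beside_comp {a b c : Tangle 0 0} {a' b' c' : Tangle m n} (f : Hom a b) (g : Hom b c)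
    (f' : Hom a' b') (g' : Hom b' c') :
    comp (beside f f') (beside g g') = beside (comp f g) (comp f' g') := by
  induction f using induction_on with
  | cob f =>
    induction g using induction_on with
    | cob g =>
      induction f' using induction_on with
      | cob f' =>
        induction g' using induction_on with
        | cob g' => simpa using (cob_eq (Homeo.beside_comp f g f' g')).symm
        | _ => simp_all
      | _ => simp_all
    | _ => simp_all
  | _ => simp_all

@[simp] theorem beside_one_one (b : Tangle 0 0) (a : Tangle m n) :
    beside (one b) (one a) = one (.beside b a) := by
  simpa [one] using cob_eq (Homeo.one_beside_one b a)

theorem dual_comp {a b c : Tangle m n} (f : Hom a b) (g : Hom b c) :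
    dual (comp f g) = comp (dual g) (dual f) := by
  induction f using induction_on with
  | cob f =>
    induction g using induction_on with
    | cob g => simpa using cob_eq (Homeo.dual_comp f g)
    | _ => simp_all
  | _ => simp_all

@[simp] theorem dual_one (a : Tangle m n) : dual (one a) = one (.dual a) := by
  simpa [one] using cob_eq (Homeo.dual_one a)

@[simp] theorem iso_refl (a : Tangle m n) : iso (.refl a) = one a := rfl

theorem iso_comp_iso {a b c : Tangle m n} (e : Isotopy a b) (e' : Isotopy b c) :
    comp (iso e) (iso e') = iso (e.trans e') := by
  simpa [iso] using cob_eq (Homeo.cyl_comp_cyl e e')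

@[simp] theorem iso_comp_symm {a b : Tangle m n} (e : Isotopy a b) :
    comp (iso e) (iso e.symm) = one a := by
  rw [iso_comp_iso, Isotopy.trans_symm, iso_refl]

@[simp] theorem iso_symm_comp {a b : Tangle m n} (e : Isotopy a b) :
    comp (iso e.symm) (iso e) = one b := by
  rw [iso_comp_iso, Isotopy.symm_trans, iso_refl]

@[simp] theorem iso_comp_symm_comp {a b c : Tangle m n} (e : Isotopy a b) (f : Hom a c) :
    comp (iso e) (comp (iso e.symm) f) = f := by
  rw [← comp_assoc, iso_comp_symm, one_comp]

@[simp] theorem iso_symm_comp_comp {a b c : Tangle m n} (e : Isotopy a b) (f : Hom b c) :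
    comp (iso e.symm) (comp (iso e) f) = f := by
  rw [← comp_assoc, iso_symm_comp, one_comp]

theorem rightUnit {a b : Tangle m n} (f : Hom a b) :
    comp (hcomp f (one _)) (iso (.rightUnit b)) = comp (iso (.rightUnit a)) f := by
  induction f using induction_on with
  | cob f => simpa [one, iso] using cob_eq (Homeo.rightUnit f)
  | _ => simp_all

theorem emptyBeside {a b : Tangle m n} (f : Hom a b) :
    comp f (iso (.emptyBeside b)) = comp (iso (.emptyBeside a)) (beside (one _) f) := by
  induction f using induction_on with
  | cob f => simpa [one, iso] using cob_eq (Homeo.emptyBeside f)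
  | _ => simp_all

theorem hcomp_assoc {a a' : Tangle m k} {b b' : Tangle k n} {c c' : Tangle n l} (f : Hom a a')
    (g : Hom b b') (h : Hom c c') :
    comp (hcomp (hcomp f g) h) (iso (.assoc a' b' c')) =
      comp (iso (.assoc a b c)) (hcomp f (hcomp g h)) := by
  induction f using induction_on with
  | cob f =>
    induction g using induction_on with
    | cob g =>
      induction h using induction_on with
      | cob h => simpa [iso] using cob_eq (Homeo.tensor_assoc f g h)
      | _ => simp_all
    | _ => simp_all
  | _ => simp_all

theorem merge {a a' : Tangle n n} {b b' : Tangle n k} (f : Hom a a') (g : Hom b b') :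
    comp (beside (trace f) g) (cob (.merge a' b')) = comp (cob (.merge a b)) (hcomp f g) := by
  induction f using induction_on with
  | cob f =>
    induction g using induction_on with
    | cob g => simpa using cob_eq (Homeo.merge f g)
    | _ => simp_all
  | _ => simp_all

theorem disks_merge (a : Tangle n k) :
    comp (comp (iso (.emptyBeside a)) (beside (cob (.disks n)) (one a))) (cob (.merge (.id n) a)) =
      iso (Isotopy.leftUnit a).symm := by
  simpa [one, iso] using cob_eq (Homeo.disks_merge a)

theorem disks_beside_merge {b : Tangle n n} (f : Hom (.id 0) (.trace b)) :
    comp (cob (.disks n)) (trace (comp (comp (iso (.emptyBeside (.id n))) (beside f (one _)))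
      (cob (.merge b (.id n))))) = comp f (trace (iso (Isotopy.rightUnit b).symm)) := by
  induction f using induction_on with
  | cob f => simpa [one, iso] using cob_eq (Homeo.disks_beside_merge f)
  | _ => simp_all

theorem coev_id (n : ℕ) : comp (cob (.coev (.id n))) (trace (comp (hcomp (one _) (iso (.dualId n)))
    (iso (.rightUnit (.id n))))) = cob (.disks n) := by
  simpa [one, iso] using cob_eq (Homeo.coev_id n)

theorem coev_slide {a a' : Tangle m n} (g : Hom a a') :
    comp (cob (.coev a)) (trace (hcomp g (one _))) =
      comp (cob (.coev a')) (trace (hcomp (one _) (dual g))) := by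
  induction g using induction_on with
  | cob f => simpa [one] using cob_eq (Homeo.coev_slide f)
  | _ => simp_all

/-- Bending of a morphism. -/
def bend (a b : Tangle m n) : Hom a b →ₗ[ℤ[X]] Hom (.id 0) (.trace (.comp b (.dual a))) :=
  comp (cob (.coev a)) ∘ₗ trace ∘ₗ hcomp.flip (one (.dual a))

theorem bend_apply {a b : Tangle m n} (f : Hom a b) :
    bend a b f = comp (cob (.coev a)) (trace (hcomp f (one (.dual a)))) := rfl

/-- The inverse of bending. -/
def unbend (a b : Tangle m n) : Hom (.id 0) (.trace (.comp b (.dual a))) →ₗ[ℤ[X]] Hom a b :=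
  comp.flip (cob ((Cob.merge (.comp b (.dual a)) a).comp ((Cob.cyl (.unbend a b)).comp
    (((Cob.one b).hcomp (Cob.halfTurn a).dual).comp (.cyl (.rightDualUnit b)))))) ∘ₗ
      comp (iso (.emptyBeside a)) ∘ₗ beside.flip (one a)

theorem unbend_cob {a b : Tangle m n} (f : Cob (.id 0) (.trace (.comp b (.dual a)))) :
    unbend a b (cob f) = cob f.unbend := by
  simp [unbend, one, iso, Cob.unbend]

@[simp] theorem unbend_bend {a b : Tangle m n} (f : Hom a b) : unbend a b (bend a b f) = f := by
  induction f using induction_on with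
  | cob f =>
    rw [bend_apply, one, hcomp_cob, trace_cob, comp_cob, unbend_cob]
    exact cob_eq (Homeo.unbend_bend f)
  | _ => simp_all

@[simp] theorem bend_unbend {a b : Tangle m n} (f : Hom (.id 0) (.trace (.comp b (.dual a)))) :
    bend a b (unbend a b f) = f := by
  induction f using induction_on with
  | cob f =>
    rw [bend_apply, one, unbend_cob, hcomp_cob, trace_cob, comp_cob]
    exact cob_eq (Homeo.bend_unbend f)
  | _ => simp_all

/-- The composite is a sphere with one dot. This is the only place where a local relation is invoked
directly; the other identities of surfaces are homeomorphisms. -/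
theorem birth_dot_death : comp (cob (.birth 0)) (comp (cob (.dot circle (.inl none)))
    (cob (.death 0))) = one (.id 0) := by
  have h : cob (sphere 1) = one (.id 0) := by
    rw [one, cob, cob, ← sub_eq_zero, ← map_sub]
    exact (Submodule.Quotient.mk_eq_zero _).2 Null.sphere_one
  rw [← h, sphere, ← comp_cob, ← comp_cob, circleDots, ← comp_cob, circleDots]
  exact congrArg _ (congrArg (fun x => comp x _) (one_comp _).symm)

end Hom

@[simp] theorem Cob.deg_cyl {a b : Tangle m n} (e : Isotopy a b) : (Cob.cyl e).deg = 0 := by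
  simp [Cob.deg_eq]
@[simp] theorem Cob.deg_dot (a : Tangle m n) (p : a.Pt) : (Cob.dot a p).deg = 2 := by
  simp [Cob.deg_eq]
@[simp] theorem Cob.deg_birth (i : Fin (n + 1)) : (Cob.birth i).deg = -1 := by simp [Cob.deg_eq]
@[simp] theorem Cob.deg_death (i : Fin (n + 1)) : (Cob.death i).deg = -1 := by simp [Cob.deg_eq]
@[simp] theorem Cob.deg_disks (n : ℕ) : (Cob.disks n).deg = -n := by simp [Cob.deg_eq]
@[simp] theorem Cob.deg_merge (a : Tangle n n) (b : Tangle n k) : (Cob.merge a b).deg = n := by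
  simp [Cob.deg_eq]
@[simp] theorem Cob.deg_coev (a : Tangle n n) : (Cob.coev a).deg = -n := by
  have := Cob.two_mul_wtInt_coev a fun _ => 1
  simp at this
  simp [Cob.deg_eq]
  linarith
@[simp] theorem Cob.deg_comp {a b c : Tangle m n} (f : Cob a b) (g : Cob b c) :
    (f.comp g).deg = f.deg + g.deg := by
  simp [Cob.deg_eq]; ring
@[simp] theorem Cob.deg_hcomp {a a' : Tangle m k} {b b' : Tangle k n} (f : Cob a a') (g : Cob b b') :
    (f.hcomp g).deg = f.deg + g.deg := by
  simp [Cob.deg_eq]; ring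
@[simp] theorem Cob.deg_beside {c c' : Tangle 0 0} {a a' : Tangle m n} (f : Cob c c')
    (g : Cob a a') : (f.beside g).deg = f.deg + g.deg := by
  simp [Cob.deg_eq]; ring
@[simp] theorem Cob.deg_trace {a b : Tangle n n} (f : Cob a b) : f.trace.deg = f.deg := by
  simp [Cob.deg_eq]
@[simp] theorem Cob.deg_dual {a b : Tangle m n} (f : Cob a b) : f.dual.deg = f.deg := by
  simp [Cob.deg_eq]
@[simp] theorem Cob.deg_unbend {a b : Tangle n n}
    (f : Cob (.id 0) (.trace (.comp b (.dual a)))) : f.unbend.deg = f.deg + n := by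
  simp [Cob.unbend, Cob.halfTurn]

namespace Hom

theorem cob_mem {a b : Tangle m n} {f : Cob a b} {d : ℤ} (h : f.deg = d) : cob f ∈ homog a b d :=
  AddSubgroup.subset_closure ⟨0, f, by simpa using h, by simp⟩

theorem one_mem (a : Tangle m n) : one a ∈ homog a a 0 := cob_mem (by simp)
theorem iso_mem {a b : Tangle m n} (e : Isotopy a b) : iso e ∈ homog a b 0 := cob_mem (by simp)

theorem map_mem {m' n' : ℕ} {a b : Tangle m n} {a' b' : Tangle m' n'}
    (F : Hom a b →ₗ[ℤ[X]] Hom a' b') (s : ℤ) (G : Cob a b → Cob a' b')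
    (hF : ∀ f, F (cob f) = cob (G f)) (hd : ∀ f, (G f).deg = f.deg + s) {x : Hom a b} {d : ℤ}
    (hx : x ∈ homog a b d) : F x ∈ homog a' b' (d + s) := by
  induction hx using AddSubgroup.closure_induction with
  | mem x hx =>
    obtain ⟨j, f, h, rfl⟩ := hx
    exact AddSubgroup.subset_closure ⟨j, G f, by rw [hd, ← h]; ring, by rw [map_smul, hF]⟩
  | zero => simp
  | add x y _ _ hx hy => rw [map_add]; exact add_mem hx hy
  | neg x _ hx => rw [map_neg]; exact neg_mem hx

theorem map₂_mem {m' n' m'' n'' : ℕ} {a b : Tangle m n} {a' b' : Tangle m' n'}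
    {a'' b'' : Tangle m'' n''} (F : Hom a b →ₗ[ℤ[X]] Hom a' b' →ₗ[ℤ[X]] Hom a'' b'')
    (G : Cob a b → Cob a' b' → Cob a'' b'') (hF : ∀ f g, F (cob f) (cob g) = cob (G f g))
    (hd : ∀ f g, (G f g).deg = f.deg + g.deg) {x : Hom a b} {y : Hom a' b'} {d e : ℤ}
    (hx : x ∈ homog a b d) (hy : y ∈ homog a' b' e) : F x y ∈ homog a'' b'' (d + e) := by
  induction hx using AddSubgroup.closure_induction with
  | mem x hx =>
    obtain ⟨j, f, h, rfl⟩ := hx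
    induction hy using AddSubgroup.closure_induction with
    | mem y hy =>
      obtain ⟨i, g, h', rfl⟩ := hy
      exact AddSubgroup.subset_closure ⟨j + i, G f g, by rw [hd, ← h, ← h']; push_cast; ring,
        by rw [map_smul, map_smul, LinearMap.smul_apply, hF, smul_smul, pow_add, mul_comm]⟩
    | zero => simp
    | add x y _ _ hx hy => rw [map_add]; exact add_mem hx hy
    | neg x _ hx => rw [map_neg]; exact neg_mem hx
  | zero => simp
  | add x y _ _ hx hy => rw [map_add, LinearMap.add_apply]; exact add_mem hx hy
  | neg x _ hx => rw [map_neg, LinearMap.neg_apply]; exact neg_mem hx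

theorem comp_mem {a b c : Tangle m n} {x : Hom a b} {y : Hom b c} {d e f : ℤ}
    (hx : x ∈ homog a b d) (hy : y ∈ homog b c e) (h : d + e = f) : comp x y ∈ homog a c f :=
  h ▸ map₂_mem comp _ comp_cob Cob.deg_comp hx hy

theorem hcomp_mem {a a' : Tangle m k} {b b' : Tangle k n} {x : Hom a a'} {y : Hom b b'} {d e f : ℤ}
    (hx : x ∈ homog a a' d) (hy : y ∈ homog b b' e) (h : d + e = f) :
    hcomp x y ∈ homog (.comp a b) (.comp a' b') f :=
  h ▸ map₂_mem hcomp _ hcomp_cob Cob.deg_hcomp hx hy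

theorem beside_mem {a a' : Tangle 0 0} {b b' : Tangle m n} {x : Hom a a'} {y : Hom b b'} {d e f : ℤ}
    (hx : x ∈ homog a a' d) (hy : y ∈ homog b b' e) (h : d + e = f) :
    beside x y ∈ homog (.beside a b) (.beside a' b') f :=
  h ▸ map₂_mem beside _ beside_cob Cob.deg_beside hx hy

theorem trace_mem {a b : Tangle n n} {x : Hom a b} {d : ℤ} (hx : x ∈ homog a b d) :
    trace x ∈ homog (.trace a) (.trace b) d := by
  simpa using map_mem trace 0 Cob.trace trace_cob (by simp) hx

theorem dual_mem {a b : Tangle m n} {x : Hom a b} {d : ℤ} (hx : x ∈ homog a b d) :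
    dual x ∈ homog (.dual b) (.dual a) d := by
  simpa using map_mem dual 0 Cob.dual dual_cob (by simp) hx

theorem bend_mem {a b : Tangle n n} {x : Hom a b} {d : ℤ} (hx : x ∈ homog a b d) :
    bend a b x ∈ homog (.id 0) (.trace (.comp b (.dual a))) (d - n) :=
  comp_mem (cob_mem (Cob.deg_coev a)) (trace_mem (hcomp_mem hx (one_mem _) rfl)) (by ring)

theorem unbend_mem {a b : Tangle n n} {x : Hom (.id 0) (.trace (.comp b (.dual a)))} {d : ℤ}
    (hx : x ∈ homog (.id 0) (.trace (.comp b (.dual a))) d) : unbend a b x ∈ homog a b (d + n) :=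
  map_mem (unbend a b) n Cob.unbend unbend_cob Cob.deg_unbend hx

/-- By `Isotopy.turnback` the larger diagram is `a` with an extra circle. The circle is created by a
birth, of degree `-1`, and removed by a dot followed by a death, of degree `2 - 1`. -/
theorem exists_turnback_retract (a : Tangle (n + 2) k) {l : Fin (n + 1)}
    (h : a.strand (a.curve.top l.castSucc) = a.strand (a.curve.top l.succ)) :
    ∃ r ∈ homog a (.comp (.cup l) (.comp (.cap l) a)) (-1),
      ∃ s ∈ homog (.comp (.cup l) (.comp (.cap l) a)) a 1, comp r s = one a := by
  refine ⟨comp (iso (.emptyBeside a)) (comp (beside (cob (.birth 0)) (one a))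
    (iso (Isotopy.turnback a l h))), ?_, comp (iso (Isotopy.turnback a l h).symm)
      (comp (beside (comp (cob (.dot circle (.inl none))) (cob (.death 0))) (one a))
        (iso (Isotopy.emptyBeside a).symm)), ?_, ?_⟩
  · exact comp_mem (iso_mem _) (comp_mem (beside_mem (cob_mem (Cob.deg_birth _)) (one_mem _) rfl)
      (iso_mem _) rfl) rfl
  · exact comp_mem (iso_mem _) (comp_mem (beside_mem (comp_mem (cob_mem (Cob.deg_dot _ _))
      (cob_mem (Cob.deg_death _)) rfl) (one_mem _) rfl) (iso_mem _) rfl) rfl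
  · simp only [comp_assoc, iso_comp_symm_comp]
    rw [← comp_assoc (beside _ _) (beside _ _), beside_comp, birth_dot_death]
    simp

end Hom

end HomLevel

/-! ### The preadditive category of complexes and column-finite matrices -/

section Matrices
open CategoryTheory
variable {m k n l : ℕ}

theorem exists_of_finsum_ne_zero {ι M : Type} [AddCommMonoid M] {f : ι → M}
    (h : ∑ᶠ i, f i ≠ 0) : ∃ i, f i ≠ 0 := by
  by_contra! hc
  exact h (by simp [hc])

/-- The matrices with finitely many entries in each column. -/
def colFin (A B : Cx m n) : AddSubgroup (Mat A B) where
  carrier := {f | ∀ j, {i | f i j ≠ 0}.Finite}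
  zero_mem' := fun _ => by simp
  add_mem' := fun {f g} hf hg j => ((hf j).union (hg j)).subset fun i h => by
    by_contra hc
    simp only [Set.mem_union, Set.mem_ofPred_eq, not_or, not_not] at hc
    exact h (by simp [hc.1, hc.2])
  neg_mem' := fun {f} hf j => (hf j).subset fun i h h0 => h (by simp [h0])

theorem Mat.one_self (A : Cx m n) (i : A.I) : Mat.one A i i = Hom.one _ := by
  rw [Mat.one, dif_pos rfl]; rfl

theorem Mat.one_ne (A : Cx m n) {i j : A.I} (h : i ≠ j) : Mat.one A i j = 0 := by
  rw [Mat.one, dif_neg h]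

theorem Mat.comp_eq_sum {A B C : Cx m n} (f : Mat A B) (g : Mat B C) (i : A.I) (k : C.I)
    (s : Finset B.I) (h : ∀ j, Hom.comp (f i j) (g j k) ≠ 0 → j ∈ s) :
    Mat.comp f g i k = ∑ j ∈ s, Hom.comp (f i j) (g j k) :=
  finsum_eq_sum_of_support_subset _ fun j hj => h j hj

theorem Mat.comp_eq_single {A B C : Cx m n} (f : Mat A B) (g : Mat B C) (i : A.I) (k : C.I)
    (j : B.I) (h : ∀ j', Hom.comp (f i j') (g j' k) ≠ 0 → j' = j) :
    Mat.comp f g i k = Hom.comp (f i j) (g j k) := by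
  rw [Mat.comp_eq_sum f g i k {j} (by simpa using h), Finset.sum_singleton]

@[simp] theorem Mat.one_comp {A B : Cx m n} (f : Mat A B) : Mat.comp (Mat.one A) f = f := by
  funext i k
  rw [Mat.comp_eq_single _ _ i k i fun j h => ?_, Mat.one_self, Hom.one_comp]
  by_contra hc
  simp [Mat.one_ne A (Ne.symm hc)] at h

@[simp] theorem Mat.comp_one {A B : Cx m n} (f : Mat A B) : Mat.comp f (Mat.one B) = f := by
  funext i k
  rw [Mat.comp_eq_single _ _ i k k fun j h => ?_, Mat.one_self, Hom.comp_one]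
  by_contra hc
  simp [Mat.one_ne B hc] at h

theorem Mat.comp_eq_sum_right {A B C : Cx m n} (f : Mat A B) {g : Mat B C} (i : A.I) (k : C.I)
    {s : Finset B.I} (h : ∀ j, g j k ≠ 0 → j ∈ s) :
    Mat.comp f g i k = ∑ j ∈ s, Hom.comp (f i j) (g j k) :=
  Mat.comp_eq_sum _ _ _ _ _ fun j hj => h j fun h0 => hj (by rw [h0, map_zero])

/-- For a fixed target index `l`, column finiteness of `g` and `h` confines both summations to
finite sets that do not depend on `f`, so they can be exchanged. This is the continuity of maps
between formal products. -/
theorem Mat.comp_assoc {A B C D : Cx m n} (f : Mat A B) {g : Mat B C} {h : Mat C D}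
    (hg : g ∈ colFin B C) (hh : h ∈ colFin C D) :
    Mat.comp (Mat.comp f g) h = Mat.comp f (Mat.comp g h) := by
  classical
  funext i l
  let s := (hh l).toFinset
  let t := s.biUnion fun k => (hg k).toFinset
  have hs : ∀ k, h k l ≠ 0 → k ∈ s := fun k hk => (hh l).mem_toFinset.2 hk
  have ht : ∀ k ∈ s, ∀ j, g j k ≠ 0 → j ∈ t := fun k hk j hj =>
    Finset.mem_biUnion.2 ⟨k, hk, (hg k).mem_toFinset.2 hj⟩
  have ht' : ∀ j, Mat.comp g h j l ≠ 0 → j ∈ t := fun j hj => by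
    rw [Mat.comp_eq_sum_right g j l hs] at hj
    obtain ⟨k, hk, hk'⟩ := Finset.exists_ne_zero_of_sum_ne_zero hj
    exact ht k hk j fun h0 => hk' (by simp [h0])
  rw [Mat.comp_eq_sum_right _ i l hs, Mat.comp_eq_sum_right _ i l ht']
  have h1 : ∀ k ∈ s, Hom.comp (Mat.comp f g i k) (h k l) =
      ∑ j ∈ t, Hom.comp (f i j) (Hom.comp (g j k) (h k l)) := fun k hk => by
    rw [Mat.comp_eq_sum_right f i k (ht k hk), map_sum, LinearMap.sum_apply]
    exact Finset.sum_congr rfl fun j _ => Hom.comp_assoc _ _ _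
  rw [Finset.sum_congr rfl h1, Finset.sum_comm]
  exact Finset.sum_congr rfl fun j _ => by rw [Mat.comp_eq_sum_right g j l hs, map_sum]

theorem Mat.comp_mem {A B C : Cx m n} {f : Mat A B} {g : Mat B C} (hf : f ∈ colFin A B)
    (hg : g ∈ colFin B C) : Mat.comp f g ∈ colFin A C := fun l => by
  classical
  refine ((hg l).toFinset.biUnion fun k => (hf k).toFinset).finite_toSet.subset fun i hi => ?_
  obtain ⟨k, hk⟩ := exists_of_finsum_ne_zero hi
  refine Finset.mem_coe.2 (Finset.mem_biUnion.2 ⟨k, (hg l).mem_toFinset.2 ?_,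
    (hf k).mem_toFinset.2 ?_⟩) <;> intro h0 <;> exact hk (by simp [h0])

theorem Mat.add_comp {A B C : Cx m n} (f f' : Mat A B) {g : Mat B C} (hg : g ∈ colFin B C) :
    Mat.comp (f + f') g = Mat.comp f g + Mat.comp f' g := by
  funext i k
  have h : ∀ j, g j k ≠ 0 → j ∈ (hg k).toFinset := fun j hj => (hg k).mem_toFinset.2 hj
  simp [Mat.comp_eq_sum_right _ i k h, Finset.sum_add_distrib]

theorem Mat.comp_add {A B C : Cx m n} (f : Mat A B) {g g' : Mat B C} (hg : g ∈ colFin B C)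
    (hg' : g' ∈ colFin B C) : Mat.comp f (g + g') = Mat.comp f g + Mat.comp f g' := by
  classical
  funext i k
  have h : ∀ j, g j k ≠ 0 → j ∈ (hg k).toFinset ∪ (hg' k).toFinset := fun j hj =>
    Finset.mem_union_left _ ((hg k).mem_toFinset.2 hj)
  have h' : ∀ j, g' j k ≠ 0 → j ∈ (hg k).toFinset ∪ (hg' k).toFinset := fun j hj =>
    Finset.mem_union_right _ ((hg' k).mem_toFinset.2 hj)
  have h'' : ∀ j, (g + g') j k ≠ 0 → j ∈ (hg k).toFinset ∪ (hg' k).toFinset := fun j hj => by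
    by_contra hc
    exact hj (by simp [not_imp_comm.1 (h j) hc, not_imp_comm.1 (h' j) hc])
  rw [Pi.add_apply, Pi.add_apply, Mat.comp_eq_sum_right _ i k h, Mat.comp_eq_sum_right _ i k h',
    Mat.comp_eq_sum_right _ i k h'', ← Finset.sum_add_distrib]
  simp

theorem Mat.one_mem (A : Cx m n) : Mat.one A ∈ colFin A A := fun j =>
  (Set.finite_singleton j).subset fun i hi => by
    by_contra hc
    exact hi (Mat.one_ne A hc)

/-- Chain complexes, with all matrices as morphisms. -/
structure Cpx (m n : ℕ) where
  X : Cx m n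
  isComplex : X.IsComplex

/-- Morphisms are all column-finite matrices, of any degree and without regard to differentials. So
the differential `D` is itself an endomorphism and `δ` is a graded commutator, and identities
between maps of complexes become computations in a preadditive category. -/
instance : Category (Cpx m n) where
  Hom A B := colFin A.X B.X
  id A := ⟨Mat.one A.X, Mat.one_mem A.X⟩
  comp f g := ⟨Mat.comp f.1 g.1, Mat.comp_mem f.2 g.2⟩
  id_comp f := Subtype.ext (Mat.one_comp f.1)
  comp_id f := Subtype.ext (Mat.comp_one f.1)
  assoc f g h := Subtype.ext (Mat.comp_assoc f.1 g.2 h.2)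

instance : Preadditive (Cpx m n) where
  homGroup A B := inferInstanceAs (AddCommGroup (colFin A.X B.X))
  add_comp _ _ _ f f' g := Subtype.ext (Mat.add_comp f.1 f'.1 g.2)
  comp_add _ _ _ f g g' := Subtype.ext (Mat.comp_add f.1 g.2 g'.2)

namespace Cpx

variable {A B C : Cpx m n}

/-- The matrix of a morphism. -/
def mat : (A ⟶ B) →+ Mat A.X B.X := (colFin A.X B.X).subtype

theorem mat_injective : Function.Injective (mat (A := A) (B := B)) := Subtype.val_injective

@[ext] theorem hom_ext {f g : A ⟶ B} (h : ∀ i j, mat f i j = mat g i j) : f = g :=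
  mat_injective (funext fun i => funext fun j => h i j)

@[simp] theorem mat_comp (f : A ⟶ B) (g : B ⟶ C) : mat (f ≫ g) = Mat.comp (mat f) (mat g) := rfl
@[simp] theorem mat_id (A : Cpx m n) : mat (𝟙 A) = Mat.one A.X := rfl

/-- The morphism with a given matrix. -/
def ofMat (f : Mat A.X B.X) (h : f ∈ colFin A.X B.X) : A ⟶ B := ⟨f, h⟩

@[simp] theorem mat_ofMat (f : Mat A.X B.X) (h : f ∈ colFin A.X B.X) : mat (ofMat f h) = f := rfl

/-- The differential. -/
def D (A : Cpx m n) : A ⟶ A := ofMat A.X.d A.isComplex.row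

@[simp] theorem mat_D (A : Cpx m n) : mat A.D = A.X.d := rfl

@[simp] theorem D_comp_D (A : Cpx m n) : A.D ≫ A.D = 0 := mat_injective A.isComplex.sq

@[simp] theorem D_comp_D_assoc (f : A ⟶ B) : A.D ≫ A.D ≫ f = 0 := by
  rw [← Category.assoc, D_comp_D, Limits.zero_comp]

/-- The differential of the morphism complex. -/
def δ (k : ℤ) (f : A ⟶ B) : A ⟶ B := f ≫ B.D - k.negOnePow • A.D ≫ f

theorem mat_δ (k : ℤ) (f : A ⟶ B) : mat (δ k f) = diff k (mat f) := rfl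

/-- Morphisms of bidegree `(k, l)`. -/
def Bi (A B : Cpx m n) (k l : ℤ) : AddSubgroup (A ⟶ B) := (HomBi A.X B.X k l).comap mat

theorem exists_mat {f : Mat A.X B.X} {k l : ℤ} (h : f ∈ HomBi A.X B.X k l) :
    ∃ f' ∈ Bi A B k l, mat f' = f := ⟨ofMat f h.2.2, h, rfl⟩

theorem comp_mem {f : A ⟶ B} {g : B ⟶ C} {k l k' l' k'' l'' : ℤ} (hf : f ∈ Bi A B k l)
    (hg : g ∈ Bi B C k' l') (hk : k + k' = k'') (hl : l + l' = l'') : f ≫ g ∈ Bi A C k'' l'' := by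
  refine ⟨fun i j => ?_, fun i j h => ?_, (f ≫ g).2⟩
  · refine finsum_induction (· ∈ Hom.homog _ _ _) (zero_mem _) (fun _ _ => add_mem) fun x => ?_
    exact Hom.comp_mem (hf.1 i x) (hg.1 x j) (by rw [← hl]; ring)
  · obtain ⟨x, hx⟩ := exists_of_finsum_ne_zero h
    change Hom.comp (mat f i x) (mat g x j) ≠ 0 at hx
    have h1 := hf.2.1 i x fun h0 => hx (by rw [h0]; simp)
    have h2 := hg.2.1 x j fun h0 => hx (by rw [h0]; simp)
    rw [h2, h1, ← hk]; ring

theorem id_mem (A : Cpx m n) : 𝟙 A ∈ Bi A A 0 0 := by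
  refine ⟨fun i j => ?_, fun i j h => ?_, (𝟙 A : A ⟶ A).2⟩
  · rw [mat_id]
    by_cases h : i = j
    · subst h; rw [Mat.one_self]; simpa using Hom.one_mem _
    · rw [Mat.one_ne _ h]; exact zero_mem _
  · rw [mat_id] at h
    by_cases h0 : i = j
    · subst h0; simp
    · exact absurd (Mat.one_ne _ h0) h

theorem D_mem (A : Cpx m n) : A.D ∈ Bi A A 1 0 :=
  ⟨fun i j => by simpa using A.isComplex.homog i j, A.isComplex.deg, A.isComplex.row⟩

theorem units_smul_mem {f : A ⟶ B} {k l : ℤ} (u : ℤˣ) (hf : f ∈ Bi A B k l) : u • f ∈ Bi A B k l := by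
  rcases Int.units_eq_one_or u with rfl | rfl
  · simpa using hf
  · simpa using neg_mem hf

theorem δ_mem {f : A ⟶ B} {k l k' : ℤ} (hf : f ∈ Bi A B k l) (hk : k + 1 = k') :
    δ k f ∈ Bi A B k' l :=
  sub_mem (comp_mem hf B.D_mem hk (by ring))
    (units_smul_mem _ (comp_mem A.D_mem hf (by rw [← hk]; ring) (by ring)))

theorem δ_add (k : ℤ) (f g : A ⟶ B) : δ k (f + g) = δ k f + δ k g := by
  simp [δ, smul_add]; abel
theorem δ_neg (k : ℤ) (f : A ⟶ B) : δ k (-f) = -δ k f := by simp [δ, smul_neg]; abel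
theorem δ_sub (k : ℤ) (f g : A ⟶ B) : δ k (f - g) = δ k f - δ k g := by
  rw [sub_eq_add_neg, δ_add, δ_neg, ← sub_eq_add_neg]
@[simp] theorem δ_zero (k : ℤ) : δ k (0 : A ⟶ B) = 0 := by simp [δ]
@[simp] theorem δ_id : δ 0 (𝟙 A) = 0 := by simp [δ]

theorem δ_δ (k k' : ℤ) (h : k + 1 = k') (f : A ⟶ B) : δ k' (δ k f) = 0 := by
  subst h
  simp [δ, Int.negOnePow_succ, Preadditive.sub_comp, Preadditive.comp_sub]

/-- The Leibniz rule for `g ∘ f`. Composition is written in diagrammatic order, so the sign is that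
of the second map and stands at the derivative of the first. -/
theorem δ_comp (k k' k'' : ℤ) (h : k + k' = k'') (f : A ⟶ B) (g : B ⟶ C) :
    δ k'' (f ≫ g) = f ≫ δ k' g + k'.negOnePow • δ k f ≫ g := by
  subst h
  rcases Int.units_eq_one_or k.negOnePow with h | h <;>
    rcases Int.units_eq_one_or k'.negOnePow with h' | h' <;>
      simp [δ, Int.negOnePow_add, h, h', Preadditive.sub_comp, Preadditive.comp_sub,
        Preadditive.add_comp, Preadditive.comp_add] <;> abel

theorem δ_comp_of_left {k : ℤ} {f : A ⟶ B} (hf : δ 0 f = 0) (g : B ⟶ C) :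
    δ k (f ≫ g) = f ≫ δ k g := by
  rw [δ_comp 0 k k (by ring), hf]; simp

theorem δ_comp_of_right {k : ℤ} (f : A ⟶ B) {g : B ⟶ C} (hg : δ 0 g = 0) :
    δ k (f ≫ g) = δ k f ≫ g := by
  rw [δ_comp k 0 k (by ring), hg]; simp

end Cpx

end Matrices

/-! ### Tensor products, closures and duals of complexes -/

section Operations
open CategoryTheory
variable {m k n l : ℕ}

namespace Cx

/-- `A ⊗ B`, in reducible form. -/
abbrev tens (A : Cx m k) (B : Cx k n) : Cx m n where
  I := A.I × B.I
  h p := A.h p.1 + B.h p.2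
  q p := A.q p.1 + B.q p.2
  o p := .comp (A.o p.1) (B.o p.2)
  d p p' := Hom.hcomp (A.d p.1 p'.1) (Mat.one B p.2 p'.2) +
    Int.negOnePow (A.h p.1) • Hom.hcomp (Mat.one A p.1 p'.1) (B.d p.2 p'.2)

/-- A diagram in degree zero, in reducible form. -/
abbrev pure (a : Tangle m n) : Cx m n := ⟨Unit, fun _ => 0, fun _ => 0, fun _ => a, fun _ _ => 0⟩

/-- `q^s Tr(A)`, in reducible form. -/
abbrev closure (s : ℤ) (A : Cx n n) : Cx 0 0 :=
  ⟨A.I, A.h, fun i => A.q i + s, fun i => .trace (A.o i), fun i j => Hom.trace (A.d i j)⟩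

/-- `A^∨`, in reducible form. -/
abbrev mirror (A : Cx m n) : Cx n m where
  I := A.I
  h i := -A.h i
  q i := -A.q i
  o i := .dual (A.o i)
  d i j := -(Int.negOnePow (-A.h i) • Hom.dual (A.d j i))

end Cx

/-- The tensor product of matrices. -/
def Mat.tens {A A' : Cx m k} {B B' : Cx k n} (f : Mat A A') (g : Mat B B') :
    Mat (A.tens B) (A'.tens B') :=
  fun p p' => Hom.hcomp (f p.1 p'.1) (g p.2 p'.2)

theorem Mat.tens_mem {A A' : Cx m k} {B B' : Cx k n} {f : Mat A A'} {g : Mat B B'}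
    (hf : f ∈ colFin A A') (hg : g ∈ colFin B B') :
    Mat.tens f g ∈ colFin (A.tens B) (A'.tens B') := fun p =>
  ((hf p.1).prod (hg p.2)).subset fun q hq =>
    ⟨fun h0 => hq (by simp [Mat.tens, h0]), fun h0 => hq (by simp [Mat.tens, h0])⟩

theorem Mat.tens_comp {A A' A'' : Cx m k} {B B' B'' : Cx k n} (f : Mat A A') (g : Mat B B')
    {f' : Mat A' A''} {g' : Mat B' B''} (hf : f' ∈ colFin A' A'') (hg : g' ∈ colFin B' B'') :
    Mat.comp (Mat.tens f g) (Mat.tens f' g') = Mat.tens (Mat.comp f f') (Mat.comp g g') := by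
  funext p r
  have h1 : ∀ j, f' j r.1 ≠ 0 → j ∈ (hf r.1).toFinset := fun j hj => (hf r.1).mem_toFinset.2 hj
  have h2 : ∀ j, g' j r.2 ≠ 0 → j ∈ (hg r.2).toFinset := fun j hj => (hg r.2).mem_toFinset.2 hj
  have h3 : ∀ q, Mat.tens f' g' q r ≠ 0 → q ∈ (hf r.1).toFinset ×ˢ (hg r.2).toFinset :=
    fun q hq => Finset.mem_product.2 ⟨h1 _ fun h0 => hq (by simp [Mat.tens, h0]),
      h2 _ fun h0 => hq (by simp [Mat.tens, h0])⟩
  rw [Mat.comp_eq_sum_right _ p r h3, Finset.sum_product, tens, Mat.comp_eq_sum_right _ _ _ h1,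
    Mat.comp_eq_sum_right _ _ _ h2, LinearMap.map_sum₂]
  refine Finset.sum_congr rfl fun i _ => ?_
  rw [map_sum]
  exact Finset.sum_congr rfl fun j _ => Hom.hcomp_comp _ _ _ _

@[simp] theorem Mat.tens_one_one (A : Cx m k) (B : Cx k n) :
    Mat.tens (Mat.one A) (Mat.one B) = Mat.one (A.tens B) := by
  funext ⟨i, j⟩ ⟨i', j'⟩
  by_cases h : i = i'
  · subst h
    by_cases h' : j = j'
    · subst h'
      rw [Mat.one_self, Mat.tens, Mat.one_self, Mat.one_self, Hom.hcomp_one_one]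
    · rw [Mat.one_ne, Mat.tens, Mat.one_ne B h', map_zero]
      simpa using h'
  · rw [Mat.one_ne, Mat.tens, Mat.one_ne A h, map_zero, LinearMap.zero_apply]
    simp [h]

/-- The matrix of signs `(-1)^h`. -/
def Mat.sign (A : Cx m n) : Mat A A := fun i j => (A.h i).negOnePow • Mat.one A i j

theorem Mat.sign_mem (A : Cx m n) : Mat.sign A ∈ colFin A A := fun j =>
  (Mat.one_mem A j).subset fun i hi h0 => hi (by simp [sign, h0])

theorem Mat.sign_comp {A B : Cx m n} (f : Mat A B) (i : A.I) (j : B.I) :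
    Mat.comp (Mat.sign A) f i j = (A.h i).negOnePow • f i j := by
  rw [Mat.comp_eq_single _ _ i j i fun x hx => ?_, sign, Mat.one_self]
  · rcases Int.units_eq_one_or (A.h i).negOnePow with h | h <;> simp [h]
  · by_contra hc
    exact hx (by simp [sign, Mat.one_ne A (Ne.symm hc)])

theorem Mat.comp_sign {A B : Cx m n} (f : Mat A B) (i : A.I) (j : B.I) :
    Mat.comp f (Mat.sign B) i j = (B.h j).negOnePow • f i j := by
  rw [Mat.comp_eq_single _ _ i j j fun x hx => ?_, sign, Mat.one_self]
  · rcases Int.units_eq_one_or (B.h j).negOnePow with h | h <;> simp [h]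
  · by_contra hc
    exact hx (by simp [sign, Mat.one_ne B hc])

/-- `Mat.tens` carries no signs; the Koszul signs are collected in the single matrix `Mat.sign`,
which commutes or anticommutes with homogeneous maps. -/
theorem Mat.tens_d (A : Cx m k) (B : Cx k n) :
    (A.tens B).d = Mat.tens A.d (Mat.one B) + Mat.tens (Mat.sign A) B.d := by
  funext p p'
  change _ = Mat.tens A.d (Mat.one B) p p' + Mat.tens (Mat.sign A) B.d p p'
  rcases Int.units_eq_one_or (A.h p.1).negOnePow with h | h <;>
    simp [Cx.tens, Mat.tens, sign, h]

theorem Mat.d_comp_sign {A : Cx m n} (hA : A.IsComplex) :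
    Mat.comp A.d (Mat.sign A) = -Mat.comp (Mat.sign A) A.d := by
  funext i j
  change _ = -(Mat.comp (Mat.sign A) A.d i j)
  rw [Mat.sign_comp, Mat.comp_sign]
  by_cases h : A.d i j = 0
  · simp [h]
  · rw [hA.deg i j h, Int.negOnePow_succ, Units.neg_smul]

theorem Cx.IsComplex.tens {A : Cx m k} {B : Cx k n} (hA : A.IsComplex) (hB : B.IsComplex) :
    (A.tens B).IsComplex := by
  have h1 := (Cpx.id_mem ⟨A, hA⟩)
  have h2 := (Cpx.id_mem ⟨B, hB⟩)
  have e1 := Mat.tens_mem hA.row (Mat.one_mem B)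
  have e2 := Mat.tens_mem (Mat.sign_mem A) hB.row
  refine ⟨fun p p' => ?_, fun p p' h => ?_, ?_, ?_⟩
  · rw [Mat.tens_d]
    refine add_mem (Hom.hcomp_mem (hA.homog _ _) (h2.1 _ _) (by simp; ring)) ?_
    refine Hom.hcomp_mem (d := A.q p.1 - A.q p'.1) (e := B.q p.2 - B.q p'.2) ?_ (hB.homog _ _)
      (by simp; ring)
    have := h1.1 p.1 p'.1
    simp only [add_zero] at this
    rcases Int.units_eq_one_or (A.h p.1).negOnePow with h | h
    · rw [Mat.sign, h, one_smul]; exact this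
    · rw [Mat.sign, h, Units.neg_smul, one_smul]; exact neg_mem this
  · by_cases h0 : A.d p.1 p'.1 = 0
    · have h3 : B.d p.2 p'.2 ≠ 0 := fun h' => h (by simp [h0, h'])
      have h4 : Mat.one A p.1 p'.1 ≠ 0 := fun h' => h (by simp [h0, h'])
      have := hB.deg _ _ h3
      have := h1.2.1 _ _ h4
      simp at this ⊢
      omega
    · by_cases h3 : Mat.one B p.2 p'.2 = 0
      · have h4 : Mat.one A p.1 p'.1 ≠ 0 := fun h' => h (by simp [h3, h'])
        have h5 : B.d p.2 p'.2 ≠ 0 := fun h' => h (by simp [h3, h'])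
        have := hB.deg _ _ h5
        have := h1.2.1 _ _ h4
        simp at this ⊢
        omega
      · have := h2.2.1 _ _ h3
        have := hA.deg _ _ h0
        simp [Cx.tens] at *
        omega
  · rw [Mat.tens_d]
    exact add_mem e1 e2
  -- The two mixed terms cancel because `Mat.sign` anticommutes with the differential.
  · rw [Mat.tens_d, Mat.comp_add _ e1 e2, Mat.add_comp _ _ e1, Mat.add_comp _ _ e2,
      Mat.tens_comp _ _ hA.row (Mat.one_mem B), Mat.tens_comp _ _ hA.row (Mat.one_mem B),
      Mat.tens_comp _ _ (Mat.sign_mem A) hB.row, Mat.tens_comp _ _ (Mat.sign_mem A) hB.row,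
      hA.sq, hB.sq, Mat.d_comp_sign hA]
    funext p p'
    simp [Mat.tens]

theorem Cx.IsComplex.pure (a : Tangle m n) : (Cx.pure a).IsComplex :=
  ⟨fun _ _ => zero_mem _, fun _ _ h => absurd rfl h, fun _ => by simp [Cx.pure], by
    funext i j; simp [Mat.comp, Cx.pure]⟩

theorem Cx.IsComplex.closure {A : Cx n n} (hA : A.IsComplex) (s : ℤ) :
    (Cx.closure s A).IsComplex := by
  refine ⟨fun i j => ?_, fun i j h => hA.deg i j fun h0 => h ?_, fun j => (hA.row j).subset
    fun i hi h0 => hi ?_, ?_⟩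
  · have := Hom.trace_mem (hA.homog i j)
    simpa [Cx.closure] using this
  · simp [Cx.closure, h0]
  · simp [Cx.closure, h0]
  · funext i j
    have h1 : ∀ x, A.d x j ≠ 0 → x ∈ (hA.row j).toFinset := fun x hx => (hA.row j).mem_toFinset.2 hx
    have h2 : ∀ x, (Cx.closure s A).d x j ≠ 0 → x ∈ (hA.row j).toFinset := fun x hx =>
      h1 x fun h0 => hx (by simp [Cx.closure, h0])
    rw [Mat.comp_eq_sum_right _ i j h2]
    have := congrArg Hom.trace ((Mat.comp_eq_sum_right A.d (i : A.I) (j : A.I) h1).symm.trans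
      (congrFun (congrFun hA.sq i) j))
    rw [map_sum] at this
    refine (Finset.sum_congr rfl fun x _ => ?_).trans (this.trans (map_zero _))
    exact (Hom.trace_comp _ _).symm

/-- Transposition exchanges rows and columns, so the columns of the new differential need not be
finite by themselves. They are, because the differential has degree one and each chain group has
finitely many summands. -/
theorem Cx.IsComplex.mirror {A : Cx m n} (hA : A.IsComplex) (hf : ∀ k, {i | A.h i = k}.Finite) :
    A.mirror.IsComplex := by
  have hrow : ∀ j, {i | A.mirror.d i j ≠ 0}.Finite := fun j => (hf (A.h j + 1)).subset fun i hi => by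
    refine hA.deg j i fun h0 => hi ?_
    simp [h0]
  refine ⟨fun i j => ?_, fun i j h => ?_, hrow, ?_⟩
  · refine neg_mem ?_
    have : A.mirror.q i - A.mirror.q j = A.q j - A.q i := by simp; ring
    rw [this]
    rcases Int.units_eq_one_or (-A.h i).negOnePow with h | h
    · simpa [h] using Hom.dual_mem (hA.homog j i)
    · simpa [h] using neg_mem (Hom.dual_mem (hA.homog j i))
  · have := hA.deg j i fun h0 => h (by simp [h0])
    simp [this]
  · funext i j
    let s := (hf (A.h j + 1)).toFinset
    have h1 : ∀ x, Hom.comp (A.d j x) (A.d x i) ≠ 0 → x ∈ s := fun x hx =>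
      (hf _).mem_toFinset.2 (hA.deg j x fun h0 => hx (by simp [h0]))
    have h2 : ∀ x, Hom.comp (A.mirror.d i x) (A.mirror.d x j) ≠ 0 → x ∈ s := fun x hx =>
      (hf _).mem_toFinset.2 (hA.deg j x fun h0 => hx (by simp [h0]))
    have := congrArg Hom.dual ((Mat.comp_eq_sum A.d A.d (j : A.I) (i : A.I) _ h1).symm.trans
      (congrFun (congrFun hA.sq j) i))
    rw [map_sum] at this
    rw [Mat.comp_eq_sum _ _ i j _ h2]
    have key : ∀ x ∈ s, Hom.comp (A.mirror.d i x) (A.mirror.d x j) =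
        ((-A.h i).negOnePow * (-(A.h j + 1)).negOnePow) •
          Hom.dual (Hom.comp (A.d j x) (A.d x i)) := fun x hx => by
      rw [Hom.dual_comp]
      change Hom.comp (-((-A.h i).negOnePow • Hom.dual (A.d x i)))
        (-((-A.h x).negOnePow • Hom.dual (A.d j x))) = _
      rw [show A.h x = A.h j + 1 from (hf _).mem_toFinset.1 hx]
      rcases Int.units_eq_one_or (-A.h i).negOnePow with h | h <;>
        rcases Int.units_eq_one_or (-(A.h j + 1)).negOnePow with h' | h' <;> simp [h]
    rw [Finset.sum_congr rfl key, ← Finset.smul_sum, this]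
    simp

namespace Cpx

/-- `A ⊗ B`. -/
abbrev tensor (A : Cpx m k) (B : Cpx k n) : Cpx m n := ⟨A.X.tens B.X, A.isComplex.tens B.isComplex⟩

/-- A diagram in degree zero. -/
abbrev pure (a : Tangle m n) : Cpx m n := ⟨.pure a, .pure a⟩

/-- `q^s Tr(A)`. -/
abbrev closure (s : ℤ) (A : Cpx n n) : Cpx 0 0 := ⟨.closure s A.X, A.isComplex.closure s⟩

section Tens

variable {A A' A'' : Cpx m k} {B B' B'' : Cpx k n}

/-- The tensor product of morphisms. -/
def tens (f : A ⟶ A') (g : B ⟶ B') : A.tensor B ⟶ A'.tensor B' :=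
  ofMat (Mat.tens (mat f) (mat g)) (Mat.tens_mem f.2 g.2)

theorem mat_tens_apply (f : A ⟶ A') (g : B ⟶ B') (p q) :
    mat (tens f g) p q = Hom.hcomp (mat f p.1 q.1) (mat g p.2 q.2) := rfl

theorem tens_comp (f : A ⟶ A') (g : B ⟶ B') (f' : A' ⟶ A'') (g' : B' ⟶ B'') :
    tens f g ≫ tens f' g' = tens (f ≫ f') (g ≫ g') :=
  mat_injective (Mat.tens_comp _ _ f'.2 g'.2)

theorem tens_id (A : Cpx m k) (B : Cpx k n) : tens (𝟙 A) (𝟙 B) = 𝟙 (A.tensor B) :=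
  mat_injective (Mat.tens_one_one A.X B.X)

theorem tens_add (f : A ⟶ A') (g g' : B ⟶ B') : tens f (g + g') = tens f g + tens f g' :=
  hom_ext fun p q => map_add (Hom.hcomp (mat f p.1 q.1)) (mat g p.2 q.2) (mat g' p.2 q.2)
theorem add_tens (f f' : A ⟶ A') (g : B ⟶ B') : tens (f + f') g = tens f g + tens f' g :=
  hom_ext fun p q => LinearMap.map_add₂ Hom.hcomp (mat f p.1 q.1) (mat f' p.1 q.1) (mat g p.2 q.2)
@[simp] theorem tens_zero (f : A ⟶ A') : tens f (0 : B ⟶ B') = 0 :=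
  hom_ext fun p q => map_zero (Hom.hcomp (mat f p.1 q.1))
theorem tens_neg (f : A ⟶ A') (g : B ⟶ B') : tens f (-g) = -tens f g :=
  hom_ext fun p q => map_neg (Hom.hcomp (mat f p.1 q.1)) (mat g p.2 q.2)
theorem neg_tens (f : A ⟶ A') (g : B ⟶ B') : tens (-f) g = -tens f g :=
  hom_ext fun p q => LinearMap.map_neg₂ Hom.hcomp (mat f p.1 q.1) (mat g p.2 q.2)

theorem tens_mem {f : A ⟶ A'} {g : B ⟶ B'} {s t s' t' s'' t'' : ℤ} (hf : f ∈ Bi A A' s t)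
    (hg : g ∈ Bi B B' s' t') (hs : s + s' = s'') (ht : t + t' = t'') :
    tens f g ∈ Bi (A.tensor B) (A'.tensor B') s'' t'' := by
  refine ⟨fun p q => Hom.hcomp_mem (hf.1 _ _) (hg.1 _ _) (by simp; rw [← ht]; ring), fun p q h => ?_,
    (tens f g).2⟩
  have h1 := hf.2.1 p.1 q.1 fun h0 => h (by rw [mat_tens_apply, h0, LinearMap.map_zero₂])
  have h2 := hg.2.1 p.2 q.2 fun h0 => h (by rw [mat_tens_apply, h0, map_zero])
  simp only [h1, h2, ← hs]
  ring

/-- The sign `(-1)^h`. -/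
def sign (A : Cpx m k) : A ⟶ A := ofMat (Mat.sign A.X) (Mat.sign_mem A.X)

theorem comp_sign {f : A ⟶ A'} {s t : ℤ} (hf : f ∈ Bi A A' s t) :
    f ≫ A'.sign = s.negOnePow • A.sign ≫ f := by
  ext i j
  change Mat.comp (mat f) (Mat.sign A'.X) i j = mat (s.negOnePow • A.sign ≫ f) i j
  have e : mat (s.negOnePow • A.sign ≫ f) i j =
      s.negOnePow • Mat.comp (Mat.sign A.X) (mat f) i j := by
    rcases Int.units_eq_one_or s.negOnePow with h | h <;> simp [h, sign]
  rw [e, Mat.sign_comp, Mat.comp_sign, smul_smul, ← Int.negOnePow_add]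
  by_cases h : mat f i j = 0
  · simp [h]
  · rw [hf.2.1 i j h, add_comm]

theorem D_tensor (A : Cpx m k) (B : Cpx k n) :
    (A.tensor B).D = tens A.D (𝟙 B) + tens A.sign B.D := mat_injective (Mat.tens_d A.X B.X)

theorem δ_tens_left {f : A ⟶ A'} {s t : ℤ} (hf : f ∈ Bi A A' s t) :
    δ s (tens f (𝟙 B)) = tens (δ s f) (𝟙 B) := by
  simp only [δ, D_tensor, Preadditive.comp_add, Preadditive.add_comp, tens_comp, Category.id_comp,
    Category.comp_id, comp_sign hf]
  rcases Int.units_eq_one_or s.negOnePow with h | h <;>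
    simp [h, sub_eq_add_neg, add_tens, neg_tens]

theorem δ_tens_right (g : B ⟶ B') : δ 0 (tens (𝟙 A) g) = tens A.sign (δ 0 g) := by
  simp [δ, D_tensor, Preadditive.comp_add, Preadditive.add_comp, tens_comp, sub_eq_add_neg, tens_add,
    tens_neg]
  abel

end Tens

section Closure

variable {A B C : Cpx n n} {s : ℤ}

/-- The closure of a morphism. -/
def tr (s : ℤ) (f : A ⟶ B) : A.closure s ⟶ B.closure s :=
  ofMat (fun i j => Hom.trace (mat f i j)) fun j => (f.2 j).subset fun i hi h0 => hi (by
    change Hom.trace (f.1 i j) = 0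
    rw [h0, map_zero])

theorem mat_tr (f : A ⟶ B) (i j) : mat (tr s f) i j = Hom.trace (mat f i j) := rfl

theorem tr_comp (f : A ⟶ B) (g : B ⟶ C) : tr s (f ≫ g) = tr s f ≫ tr s g := by
  ext i k
  have h1 : ∀ j, mat g j k ≠ 0 → j ∈ (g.2 k).toFinset := fun j hj => (g.2 k).mem_toFinset.2 hj
  have h2 : ∀ j, mat (tr s g) j k ≠ 0 → j ∈ (g.2 k).toFinset := fun j hj =>
    h1 j fun h0 => hj (by rw [mat_tr, h0, map_zero])
  rw [mat_tr, mat_comp, mat_comp, Mat.comp_eq_sum_right _ _ _ h1, Mat.comp_eq_sum_right _ _ _ h2,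
    map_sum]
  exact Finset.sum_congr rfl fun j _ => Hom.trace_comp _ _

@[simp] theorem tr_id (A : Cpx n n) : tr s (𝟙 A) = 𝟙 (A.closure s) := by
  ext i j
  rw [mat_tr, mat_id, mat_id]
  by_cases h : i = j
  · subst h
    rw [Mat.one_self, Mat.one_self, Hom.trace_one]
  · rw [Mat.one_ne _ h, Mat.one_ne A.X (show (i : A.X.I) ≠ j from h), map_zero]

theorem tr_add (f g : A ⟶ B) : tr s (f + g) = tr s f + tr s g :=
  hom_ext fun i j => map_add Hom.trace (mat f i j) (mat g i j)
theorem tr_sub (f g : A ⟶ B) : tr s (f - g) = tr s f - tr s g :=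
  hom_ext fun i j => map_sub Hom.trace (mat f i j) (mat g i j)
@[simp] theorem tr_zero : tr s (0 : A ⟶ B) = 0 := hom_ext fun _ _ => map_zero Hom.trace

theorem tr_mem {f : A ⟶ B} {k l : ℤ} (hf : f ∈ Bi A B k l) :
    tr s f ∈ Bi (A.closure s) (B.closure s) k l := by
  refine ⟨fun i j => ?_, fun i j h => hf.2.1 i j fun h0 => h (by rw [mat_tr, h0, map_zero]),
    (tr s f).2⟩
  have := Hom.trace_mem (hf.1 i j)
  rw [mat_tr]
  convert this using 1
  simp

theorem D_closure : (A.closure s).D = tr s A.D := rfl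

theorem δ_tr (k : ℤ) (f : A ⟶ B) : δ k (tr s f) = tr s (δ k f) := by
  rw [δ, δ, D_closure, D_closure, ← tr_comp, ← tr_comp]
  rcases Int.units_eq_one_or k.negOnePow with h | h
  · simp only [h, one_smul, tr_sub]
  · simp only [h, Units.neg_smul, one_smul, sub_neg_eq_add, tr_add]

end Closure

/-- Isomorphic complexes. -/
theorem exists_iso {A B : Cpx m n} (e : A.X.I ≃ B.X.I) (hh : ∀ i, A.X.h i = B.X.h (e i))
    (hq : ∀ i, A.X.q i = B.X.q (e i)) (φ : ∀ i, Isotopy (A.X.o i) (B.X.o (e i)))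
    (hd : ∀ i j, Hom.comp (A.X.d i j) (Hom.iso (φ j)) =
      Hom.comp (Hom.iso (φ i)) (B.X.d (e i) (e j))) :
    ∃ f ∈ Bi A B 0 0, ∃ g ∈ Bi B A 0 0, δ 0 f = 0 ∧ δ 0 g = 0 ∧ f ≫ g = 𝟙 A ∧ g ≫ f = 𝟙 B ∧
      (∀ i j, mat f i j = Hom.comp (Hom.iso (φ i)) (Mat.one B.X (e i) j)) ∧
      ∀ i j, mat g j i = Hom.comp (Mat.one B.X j (e i)) (Hom.iso (φ i).symm) := by
  have hf0 : ∀ i j, e i ≠ j → Hom.comp (Hom.iso (φ i)) (Mat.one B.X (e i) j) = 0 := fun i j h => by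
    rw [Mat.one_ne _ h, map_zero]
  have hg0 : ∀ i j, e i ≠ j → Hom.comp (Mat.one B.X j (e i)) (Hom.iso (φ i).symm) = 0 :=
    fun i j h => by rw [Mat.one_ne _ h.symm, map_zero, LinearMap.zero_apply]
  let f : A ⟶ B := ofMat (fun i j => Hom.comp (Hom.iso (φ i)) (Mat.one B.X (e i) j)) fun j =>
    (Set.finite_singleton (e.symm j)).subset fun i hi => by
      by_contra hc
      exact hi (hf0 i j fun h => hc ((e.symm_apply_eq.2 h.symm).symm))
  let g : B ⟶ A := ofMat (fun j i => Hom.comp (Mat.one B.X j (e i)) (Hom.iso (φ i).symm)) fun i =>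
    (Set.finite_singleton (e i)).subset fun j hj => by
      by_contra hc
      exact hj (hg0 i j fun h => hc h.symm)
  have hfm : f ∈ Bi A B 0 0 := by
    refine ⟨fun i j => ?_, fun i j h => ?_, f.2⟩
    · exact Hom.comp_mem (Hom.iso_mem _) ((id_mem B).1 (e i) j) (by rw [hq]; ring)
    · rw [hh, not_imp_comm.1 (hf0 i j) h, add_zero]
  have hgm : g ∈ Bi B A 0 0 := by
    refine ⟨fun j i => ?_, fun j i h => ?_, g.2⟩
    · exact Hom.comp_mem ((id_mem B).1 j (e i)) (Hom.iso_mem _) (by rw [hq]; ring)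
    · rw [hh, not_imp_comm.1 (hg0 i j) h, add_zero]
  have hfg : f ≫ g = 𝟙 A := by
    ext i j
    rw [mat_comp, Mat.comp_eq_single _ _ i j (e i) fun x hx => ?_]
    · change Hom.comp (Hom.comp _ (Mat.one B.X (e i) (e i))) (Hom.comp (Mat.one B.X (e i) (e j)) _) = _
      rw [Mat.one_self, Hom.comp_one, mat_id]
      by_cases h : i = j
      · subst h
        rw [Mat.one_self, Mat.one_self, Hom.one_comp, Hom.iso_comp_symm]
      · rw [Mat.one_ne _ h, Mat.one_ne _ (e.injective.ne h), map_zero, LinearMap.zero_apply, map_zero]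
    · by_contra hc
      exact hx (by rw [show mat f i x = 0 from hf0 i x (Ne.symm hc), map_zero, LinearMap.zero_apply])
  have hgf : g ≫ f = 𝟙 B := by
    ext i j
    rw [mat_comp, Mat.comp_eq_single _ _ i j (e.symm i) fun x hx => ?_]
    · change Hom.comp (Hom.comp (Mat.one B.X i (e (e.symm i))) (Hom.iso (φ (e.symm i)).symm))
        (Hom.comp (Hom.iso (φ (e.symm i))) (Mat.one B.X (e (e.symm i)) j)) = _
      generalize hx : e.symm i = x
      rw [e.symm_apply_eq] at hx
      subst hx
      rw [Hom.comp_assoc, Hom.iso_symm_comp_comp, Mat.one_self, Hom.one_comp, mat_id]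
    · by_contra hc
      exact hx (by rw [show mat g i x = 0 from hg0 x i fun h => hc (by rw [← h, e.symm_apply_apply]),
        map_zero, LinearMap.zero_apply])
  have hδ : δ 0 f = 0 := by
    rw [δ, Int.negOnePow_zero, one_smul, sub_eq_zero]
    ext i j
    rw [mat_comp, mat_comp, Mat.comp_eq_single _ _ i j (e i) fun x hx => ?_,
      Mat.comp_eq_single _ _ i j (e.symm j) fun x hx => ?_]
    · change Hom.comp (Hom.comp _ (Mat.one B.X (e i) (e i))) (B.X.d _ _) =
        Hom.comp (A.X.d _ _) (Hom.comp _ (Mat.one B.X _ j))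
      generalize hx : e.symm j = x
      rw [e.symm_apply_eq] at hx
      subst hx
      rw [Mat.one_self, Mat.one_self, Hom.comp_one, Hom.comp_one, hd]
    · by_contra hc
      exact hx (by rw [show mat f x j = 0 from hf0 x j fun h => hc (by rw [← h, e.symm_apply_apply]),
        map_zero])
    · by_contra hc
      exact hx (by rw [show mat f i x = 0 from hf0 i x (Ne.symm hc), map_zero, LinearMap.zero_apply])
  refine ⟨f, hfm, g, hgm, hδ, ?_, hfg, hgf, fun _ _ => rfl, fun _ _ => rfl⟩
  -- The inverse of a closed isomorphism is closed: `δ g ≫ f = δ (g ≫ f) = δ 1 = 0`, and `f` can be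
  -- cancelled.
  have h := δ_comp_of_right (k := 0) g hδ
  rw [hgf, δ_id] at h
  rw [← Category.comp_id (δ 0 g), ← hfg, ← Category.assoc, ← h, Limits.zero_comp]

end Cpx

end Operations

/-! ### Contractibility of tensor products by a convergent perturbation -/

section Contraction
open CategoryTheory
variable {m k n l : ℕ}

namespace Cpx

/-- Contractibility. -/
def Contractible (A : Cpx m n) : Prop := ∃ H ∈ Bi A A (-1) 0, δ (-1) H = 𝟙 A

theorem contractible_iff {A : Cpx m n} : A.Contractible ↔ A.X.Contractible :=
  ⟨fun ⟨H, hH, h⟩ => ⟨mat H, hH, congrArg mat h⟩,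
    fun ⟨H, hH, h⟩ => ⟨ofMat H hH.2.2, hH, mat_injective h⟩⟩

/-- A morphism of diagrams, in degree zero. -/
def pureHom {a b : Tangle m n} (r : Hom a b) : pure a ⟶ pure b :=
  ofMat (fun _ _ => r) fun _ => Set.toFinite _

theorem pureHom_mem {a b : Tangle m n} {r : Hom a b} {d : ℤ} (hr : r ∈ Hom.homog a b d) :
    pureHom r ∈ Bi (pure a) (pure b) 0 d :=
  ⟨fun _ _ => by change r ∈ _; simpa using hr, fun _ _ _ => rfl, (pureHom r).2⟩

theorem pureHom_comp {a b c : Tangle m n} (r : Hom a b) (s : Hom b c) :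
    pureHom r ≫ pureHom s = pureHom (Hom.comp r s) := by
  ext i j
  rw [mat_comp, Mat.comp_eq_single _ _ _ _ () fun _ _ => rfl]
  rfl

theorem pureHom_one (a : Tangle m n) : pureHom (Hom.one a) = 𝟙 (pure a) := by
  ext i j
  exact (Mat.one_self (Cx.pure a) i).symm

theorem D_pure (a : Tangle m n) : (pure a).D = 0 := rfl

theorem δ_pure {a b : Tangle m n} (j : ℤ) (f : pure a ⟶ pure b) : δ j f = 0 := by
  simp [δ, D_pure]

theorem tens_pure_d (A : Cx m k) (a : Tangle k n) (p q) :
    (A.tens (.pure a)).d p q = Hom.hcomp (A.d p.1 q.1) (Hom.one a) := by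
  change Hom.hcomp (A.d p.1 q.1) (Mat.one (Cx.pure a) () ()) + _ • Hom.hcomp _ 0 = _
  rw [Mat.one_self, map_zero, smul_zero, add_zero]

theorem Contractible.tensor_right {A : Cpx m k} (hA : A.Contractible) (B : Cpx k n) :
    (A.tensor B).Contractible := by
  obtain ⟨H, hH, h⟩ := hA
  exact ⟨tens H (𝟙 B), tens_mem hH (id_mem B) rfl rfl, by rw [δ_tens_left hH, h, tens_id]⟩

/-- A homotopy retract of a contractible complex, up to a shift. -/
theorem Contractible.retract {A B : Cpx m n} (hB : B.Contractible) {r : A ⟶ B} {s : B ⟶ A} {t : ℤ}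
    (hr : r ∈ Bi A B 0 (-t)) (hs : s ∈ Bi B A 0 t) (hr' : δ 0 r = 0) (hs' : δ 0 s = 0)
    (hrs : r ≫ s = 𝟙 A) : A.Contractible := by
  obtain ⟨H, hH, h⟩ := hB
  refine ⟨r ≫ H ≫ s, comp_mem hr (comp_mem hH hs rfl rfl) rfl (by ring), ?_⟩
  rw [δ_comp_of_left hr', δ_comp_of_right _ hs', h, Category.id_comp, hrs]

/-- `A ⊗ a` is a shifted retract of `A ⊗ (b ⊗ c) ≅ (A ⊗ b) ⊗ c`, and tensoring with `c` preserves
contractions. -/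
theorem contractible_tensor_pure {A : Cpx m n} {a : Tangle n k} {b : Tangle n l} {c : Tangle l k}
    (h : (A.tensor (pure b)).Contractible) {t : ℤ} {r : Hom a (.comp b c)} {s : Hom (.comp b c) a}
    (hr : r ∈ Hom.homog _ _ (-t)) (hs : s ∈ Hom.homog _ _ t) (hrs : Hom.comp r s = Hom.one a) :
    (A.tensor (pure a)).Contractible := by
  have h1 := h.tensor_right (pure c)
  obtain ⟨f, hf, g, hg, hf0, hg0, hfg, -⟩ := exists_iso (A := A.tensor (pure (.comp b c)))
    (B := (A.tensor (pure b)).tensor (pure c))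
    ⟨fun p => (p, ()), fun p => p.1, fun _ => rfl, fun _ => rfl⟩ (fun p => by simp) (fun p => by simp)
    (fun p => (Isotopy.assoc (A.X.o p.1) b c).symm) fun p q => by
      rw [tens_pure_d]
      change _ = Hom.comp _ (((A.X.tens (.pure b)).tens (.pure c)).d (p, ()) (q, ()))
      rw [tens_pure_d, tens_pure_d, ← Hom.hcomp_one_one]
      have := Hom.hcomp_assoc (A.X.d p.1 q.1) (Hom.one b) (Hom.one c)
      have h2 := congrArg (fun x => Hom.comp (Hom.iso (Isotopy.assoc (A.X.o p.1) b c).symm)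
        (Hom.comp x (Hom.iso (Isotopy.assoc (A.X.o q.1) b c).symm))) this
      simp only [Hom.comp_assoc, Hom.iso_comp_symm, Hom.comp_one, Hom.iso_symm_comp_comp] at h2
      exact h2.symm
  have h2 : (A.tensor (pure (.comp b c))).Contractible :=
    h1.retract (t := 0) hf hg hf0 hg0 hfg
  refine h2.retract (t := t) (r := tens (𝟙 A) (pureHom r)) (s := tens (𝟙 A) (pureHom s))
    (tens_mem (id_mem A) (pureHom_mem hr) rfl (zero_add _))
    (tens_mem (id_mem A) (pureHom_mem hs) rfl (zero_add _)) ?_ ?_ ?_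
  · rw [δ_tens_right, δ_pure, tens_zero]
  · rw [δ_tens_right, δ_pure, tens_zero]
  · rw [tens_comp, pureHom_comp, hrs, pureHom_one, Category.comp_id, tens_id]

/-- Up to shift `a` is a retract of a diagram with a cup on top, and `A` kills this cup. -/
theorem contractible_of_killsTurnbacks {A : Cpx n n} (hA : A.X.KillsTurnbacks) (a : Tangle n k)
    (h : ∃ (i : ℕ) (hi : i + 1 < n), a.strand (a.curve.top ⟨i, by omega⟩) =
      a.strand (a.curve.top ⟨i + 1, hi⟩)) : (A.tensor (pure a)).Contractible := by
  obtain ⟨i, hi, h⟩ := h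
  obtain ⟨n, rfl⟩ : ∃ n', n = n' + 2 := ⟨n - 2, by omega⟩
  obtain ⟨r, hr, s, hs, hrs⟩ := Hom.exists_turnback_retract a (l := ⟨i, by omega⟩) h
  exact contractible_tensor_pure (contractible_iff.2 (hA ⟨i, by omega⟩).2) hr hs hrs

section Inverse

variable {X : Cpx m n} (N : X ⟶ X)

/-- The partial sums of the geometric series of `-N`. -/
def geom : ℕ → (X ⟶ X)
  | 0 => 0
  | t + 1 => 𝟙 X - geom t ≫ N

theorem geom_comm : ∀ t, geom N t ≫ N = N ≫ geom N t
  | 0 => by simp [geom]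
  | t + 1 => by
    rw [geom, Preadditive.sub_comp, Preadditive.comp_sub, geom_comm t, Category.assoc, geom_comm t]
    simp

variable {N}

theorem geom_mem (hN : N ∈ Bi X X 0 0) : ∀ t, geom N t ∈ Bi X X 0 0
  | 0 => zero_mem _
  | t + 1 => sub_mem (id_mem X) (comp_mem (geom_mem hN t) hN rfl rfl)

variable {w : X.X.I → ℕ} (hw : ∀ i j, mat N i j ≠ 0 → w i < w j)

include hw

theorem geom_succ : ∀ t i j, w j < t → mat (geom N (t + 1)) i j = mat (geom N t) i j
  | t + 1, i, j, h => by
    rw [geom, geom, map_sub, map_sub]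
    change _ - Mat.comp (mat (geom N (t + 1))) (mat N) i j = _ - Mat.comp (mat (geom N t)) (mat N) i j
    congr 1
    refine finsum_congr fun x => ?_
    by_cases h0 : mat N x j = 0
    · rw [h0, map_zero, map_zero]
    · rw [geom_succ t i x (by have := hw x j h0; omega)]

theorem geom_eq {t t' : ℕ} {i j} (h : w j < t) (h' : t ≤ t') :
    mat (geom N t') i j = mat (geom N t) i j := by
  induction h' with
  | refl => rfl
  | step h' ih => rw [geom_succ hw _ _ _ (lt_of_lt_of_le h h'), ih]

/-- The inverse is the geometric series of `-N`. Since `N` strictly raises `w`, the `(i, j)` entry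
of `N^t` vanishes for `t > w j`, so column `j` of the series is already that of the partial sum with
`w j + 1` terms. No bound on `w` as a whole is needed. -/
theorem exists_inverse (hN : N ∈ Bi X X 0 0) :
    ∃ V ∈ Bi X X 0 0, V ≫ (𝟙 X + N) = 𝟙 X ∧ (𝟙 X + N) ≫ V = 𝟙 X := by
  let V : X ⟶ X := ofMat (fun i j => mat (geom N (w j + 1)) i j) fun j => (geom N (w j + 1)).2 j
  refine ⟨V, ⟨fun i j => (geom_mem hN (w j + 1)).1 i j, fun i j => (geom_mem hN (w j + 1)).2.1 i j,
    V.2⟩, ?_, ?_⟩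
  · rw [Preadditive.comp_add, Category.comp_id]
    ext i j
    have h : mat (V ≫ N) i j = mat (geom N (w j) ≫ N) i j := by
      refine finsum_congr fun x => ?_
      by_cases h0 : mat N x j = 0
      · change Hom.comp _ (mat N x j) = Hom.comp _ (mat N x j)
        rw [h0, map_zero, map_zero]
      · change Hom.comp (mat (geom N (w x + 1)) i x) _ = Hom.comp (mat (geom N (w j)) i x) _
        rw [geom_eq hw (Nat.lt_succ_self _) (hw x j h0)]
    rw [map_add, Pi.add_apply, Pi.add_apply, h]
    change mat (geom N (w j + 1)) i j + _ = _
    rw [geom, map_sub, Pi.sub_apply, Pi.sub_apply, sub_add_cancel]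
  · rw [Preadditive.add_comp, Category.id_comp]
    ext i j
    have h : mat (N ≫ V) i j = mat (geom N (w j + 1) ≫ N) i j := by
      rw [geom_comm]; rfl
    rw [map_add, Pi.add_apply, Pi.add_apply, h]
    change mat (geom N (w j + 1)) i j + _ = _
    rw [← geom_succ hw _ _ _ (Nat.lt_succ_self _), geom, map_sub, Pi.sub_apply, Pi.sub_apply,
      sub_add_cancel]

omit hw

/-- A null-homotopic isomorphism gives a contraction. -/
theorem contractible_of_inverse {H V : X ⟶ X} (hH : H ∈ Bi X X (-1) 0) (hV : V ∈ Bi X X 0 0)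
    (h1 : V ≫ δ (-1) H = 𝟙 X) (h2 : δ (-1) H ≫ V = 𝟙 X) : X.Contractible := by
  have h3 : δ 0 V = 0 := by
    have h := δ_comp_of_left (k := 0) (δ_δ (-1) 0 rfl H) V
    rw [h2, δ_id] at h
    rw [← Category.id_comp (δ 0 V), ← h1, Category.assoc, ← h, Limits.comp_zero]
  exact ⟨V ≫ H, comp_mem hV hH rfl rfl, by rw [δ_comp_of_left h3, h1]⟩

end Inverse

theorem finsum_eq_of_injective {α β M : Type} [AddCommMonoid M] (F : α → M) {g : β → α}
    (hg : Function.Injective g) (h : ∀ q, q ∉ Set.range g → F q = 0) :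
    ∑ᶠ q, F q = ∑ᶠ x, F (g x) := by
  rw [← finsum_mem_range (f := F) hg]
  refine finsum_congr fun q => ?_
  by_cases hq : q ∈ Set.range g
  · simp only [hq, finsum_true]
  · rw [h q hq]; simp

theorem finsum_slice {α β M : Type} [AddCommMonoid M] (F : α × β → M) (c : β)
    (h : ∀ q, q.2 ≠ c → F q = 0) : ∑ᶠ q, F q = ∑ᶠ x : α × Unit, F (x.1, c) :=
  finsum_eq_of_injective F (g := fun x : α × Unit => (x.1, c))
    (fun _ _ hxy => Prod.ext (Prod.ext_iff.1 hxy).1 rfl) fun q hq => h q fun hc =>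
      hq ⟨(q.1, ()), by rw [← hc]⟩

/-- The homotopy on `A ⊗ C` given by homotopies on all `A ⊗ c`. -/
theorem exists_slicewise {A : Cpx m k} {C : Cpx k n} (H : ∀ c, A.tensor (pure (C.X.o c)) ⟶
    A.tensor (pure (C.X.o c))) (hH : ∀ c, H c ∈ Bi _ _ (-1) 0) :
    ∃ K ∈ Bi (A.tensor C) (A.tensor C) (-1) 0,
      (∀ i j c, mat K (i, c) (j, c) = mat (H c) (i, ()) (j, ())) ∧
      ∀ p q, p.2 ≠ q.2 → mat K p q = 0 := by
  let K : Mat (A.X.tens C.X) (A.X.tens C.X) := fun p q =>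
    Hom.comp (mat (H p.2) (p.1, ()) (q.1, ())) (Hom.hcomp (Hom.one _) (Mat.one C.X p.2 q.2))
  have h1 : ∀ i j c, K (i, c) (j, c) = mat (H c) (i, ()) (j, ()) := fun i j c => by
    change Hom.comp _ (Hom.hcomp (Hom.one (A.X.o j)) (Mat.one C.X c c)) = _
    rw [Mat.one_self, Hom.hcomp_one_one]
    exact Hom.comp_one _
  have h2 : ∀ p q, p.2 ≠ q.2 → K p q = 0 := fun p q h => by
    change Hom.comp _ (Hom.hcomp _ (Mat.one C.X p.2 q.2)) = 0
    rw [Mat.one_ne _ h, map_zero, map_zero]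
  have h3 : K ∈ colFin (A.X.tens C.X) (A.X.tens C.X) := fun q =>
    (((H q.2).2 (q.1, ())).image fun x => (x.1, q.2)).subset fun p hp => by
      have h4 : p.2 = q.2 := by
        by_contra hc
        exact hp (h2 p q hc)
      refine ⟨(p.1, ()), fun h0 => hp ?_, Prod.ext rfl h4.symm⟩
      obtain ⟨i, c⟩ := p
      obtain ⟨j, c'⟩ := q
      obtain rfl : c = c' := h4
      exact (h1 i j c).trans h0
  refine ⟨ofMat K h3, ⟨fun p q => ?_, fun p q h => ?_, h3⟩, h1, h2⟩
  · refine Hom.comp_mem ((hH p.2).1 (p.1, ()) (q.1, ()))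
      (Hom.hcomp_mem (Hom.one_mem _) ((id_mem C).1 p.2 q.2) rfl) ?_
    simp; ring
  · obtain ⟨i, c⟩ := p
    obtain ⟨j, c'⟩ := q
    by_cases h4 : c = c'
    · subst h4
      have := (hH c).2.1 (i, ()) (j, ()) fun h0 => h ((h1 i j c).trans h0)
      simp at this ⊢
      omega
    · exact absurd (h2 (i, c) (j, c') h4) h

/-- The contractions of all slices `A ⊗ c` are assembled into a map `K`, ignoring the differential
of `C`. Then `δK = 1 + N`, where `N` raises the degree in `C` by one and preserves the total degree.
The weight `w` makes `1 + N` invertible although infinitely many summands may share a total degree,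
and a null-homotopic isomorphism yields a contraction. -/
theorem contractible_tensor {A : Cpx m k} {C : Cpx k n} (w : A.X.I × C.X.I → ℕ)
    (hc : ∀ c, (A.tensor (pure (C.X.o c))).Contractible)
    (hw : ∀ p q : A.X.I × C.X.I, A.X.h q.1 + C.X.h q.2 = A.X.h p.1 + C.X.h p.2 →
      C.X.h q.2 = C.X.h p.2 + 1 → w p < w q) : (A.tensor C).Contractible := by
  choose H hH hH1 using hc
  obtain ⟨K, hK, h1, h2⟩ := exists_slicewise H hH
  -- Between such indices the differential of `C` has no entry. Within a slice what remains is the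
  -- identity `δ(H c) = 1`; between different slices both sides vanish.
  have key : ∀ p q, C.X.h q.2 ≠ C.X.h p.2 + 1 → mat (δ (-1) K) p q = Mat.one (A.tensor C).X p q := by
    rintro ⟨i, c⟩ ⟨j, c'⟩ hne
    have hd : C.X.d c c' = 0 := not_imp_comm.1 (C.isComplex.deg c c') hne
    have hD : ∀ x y, (A.tensor C).X.d (x, c) (y, c') =
        Hom.hcomp (A.X.d x y) (Mat.one C.X c c') := fun x y => by
      change Hom.hcomp (A.X.d x y) (Mat.one C.X c c') +
        _ • Hom.hcomp (Mat.one A.X x y) (C.X.d c c') = _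
      rw [hd, map_zero, smul_zero, add_zero]
    have e1 : mat (K ≫ (A.tensor C).D) (i, c) (j, c') = ∑ᶠ x : A.X.I × Unit,
        Hom.comp (mat K (i, c) (x.1, c)) (Hom.hcomp (A.X.d x.1 j) (Mat.one C.X c c')) := by
      refine (finsum_slice _ c fun q hq => ?_).trans (finsum_congr fun x => by
        rw [← hD]; rfl)
      change Hom.comp (mat K (i, c) q) _ = 0
      rw [h2 _ _ (Ne.symm hq), map_zero, LinearMap.zero_apply]
    have e2 : mat ((A.tensor C).D ≫ K) (i, c) (j, c') = ∑ᶠ x : A.X.I × Unit,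
        Hom.comp (Hom.hcomp (A.X.d i x.1) (Mat.one C.X c c')) (mat K (x.1, c') (j, c')) := by
      refine (finsum_slice _ c' fun q hq => ?_).trans (finsum_congr fun x => by
        rw [← hD]; rfl)
      change Hom.comp _ (mat K q (j, c')) = 0
      rw [h2 _ _ hq, map_zero]
    have e3 : mat (δ (-1) K) (i, c) (j, c') = mat (K ≫ (A.tensor C).D) (i, c) (j, c') +
        mat ((A.tensor C).D ≫ K) (i, c) (j, c') := by
      simp [δ]
    rw [e3, e1, e2]
    by_cases hcc : c = c'
    · subst hcc
      have h3 := congrFun (congrFun (congrArg mat (hH1 c)) (i, ())) (j, ())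
      have e4 : mat (δ (-1) (H c)) (i, ()) (j, ()) = mat (H c ≫ (A.tensor (pure (C.X.o c))).D) (i, ()) (j, ()) +
          mat ((A.tensor (pure (C.X.o c))).D ≫ H c) (i, ()) (j, ()) := by
        simp [δ]
      rw [e4] at h3
      have h4 : Mat.one (A.tensor C).X (i, c) (j, c) =
          Mat.one (A.tensor (pure (C.X.o c))).X (i, ()) (j, ()) := by
        by_cases hij : i = j
        · subst hij
          rw [Mat.one_self, Mat.one_self]
        · rw [Mat.one_ne _ fun h => hij (congrArg Prod.fst h),
            Mat.one_ne _ fun h => hij (congrArg Prod.fst h)]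
      rw [h4]
      refine Eq.trans ?_ h3
      congr 1
      · refine finsum_congr fun x => ?_
        rw [h1, Mat.one_self]
        exact congrArg _ (tens_pure_d A.X (C.X.o c) x (j, ())).symm
      · refine finsum_congr fun x => ?_
        rw [h1, Mat.one_self]
        exact congrArg (fun y => Hom.comp y _) (tens_pure_d A.X (C.X.o c) (i, ()) x).symm
    · rw [Mat.one_ne C.X hcc, Mat.one_ne (A.tensor C).X fun h => hcc (congrArg Prod.snd h)]
      simp
  have hN : δ (-1) K - 𝟙 _ ∈ Bi (A.tensor C) (A.tensor C) 0 0 :=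
    sub_mem (δ_mem hK rfl) (id_mem _)
  -- The first condition on `w` holds because `N` has homological degree zero, the second one by
  -- `key`.
  obtain ⟨V, hV, hV1, hV2⟩ := exists_inverse (N := δ (-1) K - 𝟙 _) (w := w) (fun p q h => by
    refine hw p q ?_ ?_
    · simpa using hN.2.1 p q h
    · by_contra hc
      refine h ?_
      rw [map_sub, Pi.sub_apply, Pi.sub_apply, key p q hc, sub_eq_zero]
      rfl) hN
  rw [add_sub_cancel] at hV1 hV2
  exact contractible_of_inverse hK hV hV1 hV2

end Cpx

end Contraction

/-! ### Splitting off contractible subcomplexes and quotients -/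

section Retracts
open CategoryTheory
variable {m k n l : ℕ}

namespace Cpx

/-- Homotopy of morphisms. -/
def Htpc {A B : Cpx m n} (f g : A ⟶ B) : Prop := ∃ H ∈ Bi A B (-1) 0, f - g = δ (-1) H

section Off

variable {C : Cpx k n} {z : C.X.I}

/-- The complex spanned by all summands but one. -/
abbrev off (C : Cpx k n) (z : C.X.I) (hz : (∀ c, C.X.d z c = 0) ∨ ∀ c, C.X.d c z = 0) : Cpx k n where
  X := ⟨{c // c ≠ z}, fun c => C.X.h c, fun c => C.X.q c, fun c => C.X.o c, fun c c' => C.X.d c c'⟩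
  isComplex := by
    refine ⟨fun i j => C.isComplex.homog i j, fun i j => C.isComplex.deg i j, fun j => ?_, ?_⟩
    · exact Set.Finite.preimage (Subtype.val_injective.injOn) (C.isComplex.row j)
    · funext i j
      have h := congrFun (congrFun C.isComplex.sq i) j
      refine (finsum_eq_of_injective (fun q => Hom.comp (C.X.d i.1 q) (C.X.d q j.1))
        Subtype.val_injective fun q hq => ?_).symm.trans h
      have : q = z := by
        by_contra hc
        exact hq ⟨⟨q, hc⟩, rfl⟩
      rcases hz with hz | hz
      · rw [this, hz, map_zero]
      · rw [this, hz, map_zero, LinearMap.zero_apply]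

variable (hz : (∀ c, C.X.d z c = 0) ∨ ∀ c, C.X.d c z = 0)

/-- The inclusion of the other summands. -/
def offIn : C.off z hz ⟶ C :=
  ofMat (fun i j => Mat.one C.X i.1 j) fun j =>
    Set.Finite.preimage (Subtype.val_injective.injOn) (Mat.one_mem C.X j)

/-- The projection to the other summands. -/
def offPr : C ⟶ C.off z hz := ofMat (fun i j => Mat.one C.X i j.1) fun j => Mat.one_mem C.X j.1

theorem offIn_mem : offIn hz ∈ Bi _ _ 0 0 :=
  ⟨fun i j => (id_mem C).1 i.1 j, fun i j => (id_mem C).2.1 i.1 j, (offIn hz).2⟩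

theorem offPr_mem : offPr hz ∈ Bi _ _ 0 0 :=
  ⟨fun i j => (id_mem C).1 i j.1, fun i j => (id_mem C).2.1 i j.1, (offPr hz).2⟩

theorem mat_offIn_comp {B : Cpx k n} (f : C ⟶ B) (i j) : mat (offIn hz ≫ f) i j = mat f i.1 j :=
  congrFun (congrFun (Mat.one_comp (mat f)) i.1) j

theorem mat_comp_offPr {B : Cpx k n} (f : B ⟶ C) (i j) : mat (f ≫ offPr hz) i j = mat f i j.1 :=
  congrFun (congrFun (Mat.comp_one (mat f)) i) j.1

theorem offIn_comp_offPr : offIn hz ≫ offPr hz = 𝟙 (C.off z hz) := by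
  ext i j
  rw [mat_offIn_comp]
  change Mat.one C.X i.1 j.1 = Mat.one (C.off z hz).X i j
  by_cases h : i = j
  · subst h
    rw [Mat.one_self, Mat.one_self]
  · rw [Mat.one_ne _ h, Mat.one_ne _ fun h' => h (Subtype.ext h')]

open Classical in
theorem mat_offPr_comp_offIn (i j) :
    mat (offPr hz ≫ offIn hz) i j = if i = z then 0 else Mat.one C.X i j := by
  split_ifs with h
  · subst h
    refine finsum_eq_zero_of_forall_eq_zero fun q => ?_
    change Hom.comp (Mat.one C.X i q.1) (Mat.one C.X q.1 j) = 0
    rw [Mat.one_ne _ (Ne.symm q.2), map_zero, LinearMap.zero_apply]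
  · rw [mat_comp, Mat.comp_eq_single _ _ i j (⟨i, h⟩ : {c // c ≠ z}) fun q hq => ?_]
    · change Hom.comp (Mat.one C.X i i) (Mat.one C.X i j) = _
      rw [Mat.one_self]
      exact Hom.one_comp _
    · by_contra hc
      refine hq ?_
      change Hom.comp (Mat.one C.X i q.1) (Mat.one C.X q.1 j) = 0
      rw [Mat.one_ne _ fun h' => hc (Subtype.ext h'.symm), map_zero, LinearMap.zero_apply]

/-- If no differential leaves `z`, this summand is a subcomplex and the remaining ones form the
quotient. If none enters `z`, the roles are exchanged and the inclusion `offIn` is the chain map. -/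
theorem δ_offPr (h : ∀ c, C.X.d z c = 0) : δ 0 (offPr (.inl h)) = 0 := by
  rw [δ, Int.negOnePow_zero, one_smul, sub_eq_zero]
  ext i j
  rw [mat_comp_offPr]
  change mat (offPr (.inl h) ≫ (C.off z (.inl h)).D) i j = C.X.d i j.1
  by_cases hi : i = z
  · subst hi
    rw [h]
    refine finsum_eq_zero_of_forall_eq_zero fun q => ?_
    change Hom.comp (Mat.one C.X i q.1) (C.X.d q.1 j.1) = 0
    rw [Mat.one_ne _ (Ne.symm q.2), map_zero, LinearMap.zero_apply]
  · rw [mat_comp, Mat.comp_eq_single _ _ i j (⟨i, hi⟩ : {c // c ≠ z}) fun q hq => ?_]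
    · change Hom.comp (Mat.one C.X i i) (C.X.d i j.1) = _
      rw [Mat.one_self]
      exact Hom.one_comp _
    · by_contra hc
      refine hq ?_
      change Hom.comp (Mat.one C.X i q.1) (C.X.d q.1 j.1) = 0
      rw [Mat.one_ne _ fun h' => hc (Subtype.ext h'.symm), map_zero, LinearMap.zero_apply]

theorem δ_offIn (h : ∀ c, C.X.d c z = 0) : δ 0 (offIn (.inr h)) = 0 := by
  rw [δ, Int.negOnePow_zero, one_smul, sub_eq_zero]
  ext i j
  rw [mat_offIn_comp]
  change C.X.d i.1 j = mat ((C.off z (.inr h)).D ≫ offIn (.inr h)) i j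
  by_cases hj : j = z
  · subst hj
    rw [h]
    refine (finsum_eq_zero_of_forall_eq_zero fun q => ?_).symm
    change Hom.comp (C.X.d i.1 q.1) (Mat.one C.X q.1 j) = 0
    rw [Mat.one_ne _ q.2, map_zero]
  · rw [mat_comp, Mat.comp_eq_single _ _ i j (⟨j, hj⟩ : {c // c ≠ z}) fun q hq => ?_]
    · change _ = Hom.comp (C.X.d i.1 j) (Mat.one C.X j j)
      rw [Mat.one_self]
      exact (Hom.comp_one _).symm
    · by_contra hc
      refine hq ?_
      change Hom.comp (C.X.d i.1 q.1) (Mat.one C.X q.1 j) = 0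
      rw [Mat.one_ne _ fun h' => hc (Subtype.ext h'), map_zero]

variable {a : Tangle k n}

/-- The inclusion of a summand. -/
def atIn (C : Cpx k n) (z : C.X.I) (x : Hom a (C.X.o z)) : pure a ⟶ C :=
  ofMat (fun _ j => Hom.comp x (Mat.one C.X z j)) fun _ => Set.toFinite _

/-- The projection to a summand. -/
def atPr (C : Cpx k n) (z : C.X.I) (y : Hom (C.X.o z) a) : C ⟶ pure a :=
  ofMat (fun i _ => Hom.comp (Mat.one C.X i z) y) fun _ => (Set.finite_singleton z).subset
    fun i hi => by
      by_contra hc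
      refine hi ?_
      change Hom.comp (Mat.one C.X i z) y = 0
      rw [Mat.one_ne _ hc, map_zero, LinearMap.zero_apply]

theorem mat_atIn (x : Hom a (C.X.o z)) (i j) : mat (atIn C z x) i j = Hom.comp x (Mat.one C.X z j) :=
  rfl

theorem mat_atPr (y : Hom (C.X.o z) a) (i j) : mat (atPr C z y) i j = Hom.comp (Mat.one C.X i z) y :=
  rfl

theorem atIn_mem {x : Hom a (C.X.o z)} (hx : x ∈ Hom.homog _ _ 0) (h0 : C.X.h z = 0)
    (q0 : C.X.q z = 0) : atIn C z x ∈ Bi _ _ 0 0 := by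
  refine ⟨fun i j => Hom.comp_mem hx ((id_mem C).1 z j) (by rw [q0]; simp), fun i j h => ?_,
    (atIn C z x).2⟩
  rw [(id_mem C).2.1 z j fun h' => h (by
    rw [mat_atIn, show Mat.one C.X z j = 0 from h', map_zero]), h0]

theorem atPr_mem {y : Hom (C.X.o z) a} (hy : y ∈ Hom.homog _ _ 0) (h0 : C.X.h z = 0)
    (q0 : C.X.q z = 0) : atPr C z y ∈ Bi _ _ 0 0 := by
  refine ⟨fun i j => Hom.comp_mem ((id_mem C).1 i z) hy (by rw [q0]; simp), fun i j h => ?_,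
    (atPr C z y).2⟩
  rw [← (id_mem C).2.1 i z fun h' => h (by
    rw [mat_atPr, show Mat.one C.X i z = 0 from h', map_zero, LinearMap.zero_apply]), h0]

theorem δ_atIn (h : ∀ c, C.X.d z c = 0) (x : Hom a (C.X.o z)) : δ 0 (atIn C z x) = 0 := by
  rw [δ, D_pure, Limits.zero_comp, smul_zero, sub_zero]
  ext i j
  refine finsum_eq_zero_of_forall_eq_zero fun q => ?_
  change Hom.comp (Hom.comp x (Mat.one C.X z q)) (C.X.d q j) = 0
  by_cases hq : z = q
  · subst hq
    rw [h, map_zero]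
  · rw [Mat.one_ne _ hq, map_zero, map_zero, LinearMap.zero_apply]

theorem δ_atPr (h : ∀ c, C.X.d c z = 0) (y : Hom (C.X.o z) a) : δ 0 (atPr C z y) = 0 := by
  rw [δ, D_pure, Limits.comp_zero, zero_sub, Int.negOnePow_zero, one_smul, neg_eq_zero]
  ext i j
  refine finsum_eq_zero_of_forall_eq_zero fun q => ?_
  change Hom.comp (C.X.d i q) (Hom.comp (Mat.one C.X q z) y) = 0
  by_cases hq : q = z
  · subst hq
    rw [h, map_zero, LinearMap.zero_apply]
  · rw [Mat.one_ne _ hq, map_zero, LinearMap.zero_apply, map_zero]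

variable {x : Hom a (C.X.o z)} {y : Hom (C.X.o z) a}

theorem atIn_comp_atPr (hxy : Hom.comp x y = Hom.one a) : atIn C z x ≫ atPr C z y = 𝟙 (pure a) := by
  ext i j
  rw [mat_comp, Mat.comp_eq_single _ _ i j z fun q hq => ?_]
  · rw [mat_atIn, mat_atPr, Mat.one_self, Hom.one_comp, Hom.comp_one, hxy]
    exact (Mat.one_self (Cx.pure a) i).symm
  · by_contra hc
    exact hq (by rw [mat_atPr, Mat.one_ne _ hc, map_zero, LinearMap.zero_apply, map_zero])

theorem atIn_comp_offPr : atIn C z x ≫ offPr hz = 0 := by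
  ext i j
  rw [mat_comp_offPr, mat_atIn, Mat.one_ne _ (Ne.symm j.2), map_zero]; rfl

theorem offIn_comp_atPr : offIn hz ≫ atPr C z y = 0 := by
  ext i j
  rw [mat_offIn_comp, mat_atPr, Mat.one_ne _ i.2, map_zero, LinearMap.zero_apply]; rfl

open Classical in
theorem atPr_comp_atIn (hyx : Hom.comp y x = Hom.one _) :
    atPr C z y ≫ atIn C z x + offPr hz ≫ offIn hz = 𝟙 C := by
  ext i j
  have : mat (atPr C z y ≫ atIn C z x) i j = Hom.comp (Mat.one C.X i z) (Mat.one C.X z j) := by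
    rw [mat_comp, Mat.comp_eq_single _ _ i j () fun _ _ => rfl, mat_atIn, mat_atPr, Hom.comp_assoc,
      ← Hom.comp_assoc y, hyx, Hom.one_comp]
  rw [map_add, Pi.add_apply, Pi.add_apply, this, mat_offPr_comp_offIn, mat_id]
  split_ifs with h
  · subst h
    rw [Mat.one_self, Hom.one_comp, add_zero]
  · rw [Mat.one_ne _ h, map_zero, LinearMap.zero_apply, zero_add]

end Off

section

variable {X Y Z : Cpx m n} {J : Y ⟶ X} {π : X ⟶ Y} {i : Z ⟶ X} {p : X ⟶ Z}
  (hJ : J ∈ Bi _ _ 0 0) (hπ : π ∈ Bi _ _ 0 0) (hi : i ∈ Bi _ _ 0 0) (hp : p ∈ Bi _ _ 0 0)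
  (hJπ : J ≫ π = 𝟙 Y) (hip : i ≫ p = 𝟙 Z) (hJp : J ≫ p = 0) (hiπ : i ≫ π = 0)
  (hsum : π ≫ J + p ≫ i = 𝟙 X) (hZ : Z.Contractible)

include hπ hi hp hJπ hip hJp hsum hZ in
/-- A subcomplex with contractible quotient. -/
theorem exists_retraction (hJ' : δ 0 J = 0) (hp' : δ 0 p = 0) :
    ∃ ν ∈ Bi X Y 0 0, δ 0 ν = 0 ∧ J ≫ ν = 𝟙 Y ∧ Htpc (𝟙 X) (ν ≫ J) := by
  obtain ⟨H, hH, h⟩ := hZ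
  have hK : p ≫ H ≫ i ∈ Bi X X (-1) 0 := comp_mem hp (comp_mem hH hi rfl rfl) rfl rfl
  -- `T` is homotopic to the identity. It dies in the contractible quotient `Z` (`hTp`), hence
  -- factors through the subcomplex `Y`. Since `J ≫ p = 0`, the correction vanishes on `Y`, and the
  -- retraction is strict and not merely up to homotopy; the exact equation `μ(ι ⊗ ι) = ι` will
  -- depend on this.
  set T := 𝟙 X - δ (-1) (p ≫ H ≫ i) with hT
  have hδ : δ (-1) (p ≫ H ≫ i) = p ≫ (H ≫ δ 0 i + i) := by
    rw [δ_comp_of_left hp', δ_comp (-1) 0 (-1) rfl, h]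
    simp
  have hip' : δ 0 i ≫ p = 0 := by
    rw [← δ_comp_of_right _ hp', hip, δ_id]
  have hTp : T ≫ p = 0 := by
    rw [hT, hδ, Preadditive.sub_comp, Category.id_comp, Category.assoc, Preadditive.add_comp,
      Category.assoc, hip', hip]
    simp
  have hT' : T ∈ Bi X X 0 0 := sub_mem (id_mem X) (δ_mem hK rfl)
  have hT0 : δ 0 T = 0 := by rw [hT, δ_sub, δ_id, δ_δ (-1) 0 rfl, sub_zero]
  have hν : (T ≫ π) ≫ J = T := by
    rw [Category.assoc, ← add_zero (T ≫ π ≫ J), ← Limits.zero_comp (f := i), ← hTp, Category.assoc,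
      ← Preadditive.comp_add, hsum, Category.comp_id]
  refine ⟨T ≫ π, comp_mem hT' hπ rfl rfl, ?_, ?_, p ≫ H ≫ i, hK, ?_⟩
  · have := δ_comp_of_right (k := 0) (T ≫ π) hJ'
    rw [hν, hT0] at this
    rw [← Category.comp_id (δ 0 _), ← hJπ, ← Category.assoc, ← this, Limits.zero_comp]
  · rw [hT, hδ, Preadditive.sub_comp, Preadditive.comp_sub, Category.id_comp, hJπ, Category.assoc,
      ← Category.assoc J p, hJp, Limits.zero_comp, sub_zero]
  · rw [hν, hT, sub_sub_cancel]

include hJ hi hp hJπ hip hiπ hsum hZ in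
/-- A quotient complex with contractible kernel. -/
theorem exists_section (hπ' : δ 0 π = 0) (hi' : δ 0 i = 0) :
    ∃ σ ∈ Bi Y X 0 0, δ 0 σ = 0 ∧ σ ≫ π = 𝟙 Y ∧ Htpc (𝟙 X) (π ≫ σ) := by
  obtain ⟨H, hH, h⟩ := hZ
  have hK : p ≫ H ≫ i ∈ Bi X X (-1) 0 := comp_mem hp (comp_mem hH hi rfl rfl) rfl rfl
  -- Dually, `T` vanishes on the contractible subcomplex `Z` (`hiT`) and therefore factors through
  -- the quotient `Y`.
  set T := 𝟙 X - δ (-1) (p ≫ H ≫ i) with hT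
  have hδ : δ (-1) (p ≫ H ≫ i) = (p - δ 0 p ≫ H) ≫ i := by
    rw [← Category.assoc, δ_comp_of_right _ hi', δ_comp 0 (-1) (-1) rfl, h]
    simp [sub_eq_add_neg]
  have hip' : i ≫ δ 0 p = 0 := by
    rw [← δ_comp_of_left hi', hip, δ_id]
  have hiT : i ≫ T = 0 := by
    rw [hT, hδ, Preadditive.comp_sub, Category.comp_id, ← Category.assoc, Preadditive.comp_sub, hip,
      ← Category.assoc, hip']
    simp
  have hT' : T ∈ Bi X X 0 0 := sub_mem (id_mem X) (δ_mem hK rfl)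
  have hT0 : δ 0 T = 0 := by rw [hT, δ_sub, δ_id, δ_δ (-1) 0 rfl, sub_zero]
  have hσ : π ≫ J ≫ T = T := by
    rw [← Category.assoc, ← add_zero ((π ≫ J) ≫ T), ← Limits.comp_zero (f := p), ← hiT,
      ← Category.assoc, ← Preadditive.add_comp, hsum, Category.id_comp]
  refine ⟨J ≫ T, comp_mem hJ hT' rfl rfl, ?_, ?_, p ≫ H ≫ i, hK, ?_⟩
  · have := δ_comp_of_left (k := 0) hπ' (J ≫ T)
    rw [hσ, hT0] at this
    rw [← Category.id_comp (δ 0 _), ← hJπ, Category.assoc, ← this, Limits.comp_zero]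
  · rw [hT, hδ, Preadditive.comp_sub, Preadditive.sub_comp, Category.comp_id, hJπ]
    simp [hiπ]
  · rw [hσ, hT, sub_sub_cancel]

end

section

variable {A : Cpx m k} {C : Cpx k n} {z : C.X.I} {a : Tangle k n} {x : Hom a (C.X.o z)}
  {y : Hom (C.X.o z) a} (hx : x ∈ Hom.homog _ _ 0) (hy : y ∈ Hom.homog _ _ 0)
  (hxy : Hom.comp x y = Hom.one _) (hyx : Hom.comp y x = Hom.one _) (h0 : C.X.h z = 0)
  (q0 : C.X.q z = 0) (w : A.X.I × C.X.I → ℕ)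
  (hc : ∀ c, c ≠ z → (A.tensor (pure (C.X.o c))).Contractible)
  (hw : ∀ p q : A.X.I × C.X.I, q.2 ≠ z → A.X.h q.1 + C.X.h q.2 = A.X.h p.1 + C.X.h p.2 →
      C.X.h q.2 = C.X.h p.2 + 1 → w p < w q)

include hy hxy hyx h0 q0 hc hw in
/-- If all summands of `C` but one kill `A` then `A ⊗ C` retracts to this one. -/
theorem exists_tensor_retraction (hz : ∀ c, C.X.d z c = 0) :
    ∃ ν ∈ Bi (A.tensor C) (A.tensor (pure a)) 0 0, δ 0 ν = 0 ∧ tens (𝟙 A) (atIn C z x) ≫ ν = 𝟙 _ ∧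
      Htpc (𝟙 _) (ν ≫ tens (𝟙 A) (atIn C z x)) := by
  have hZ : (A.tensor (C.off z (.inl hz))).Contractible :=
    contractible_tensor (fun p => w (p.1, p.2.1)) (fun c => hc c.1 c.2)
      fun p q => hw (p.1, p.2.1) (q.1, q.2.1) q.2.2
  refine exists_retraction (Z := A.tensor (C.off z (.inl hz))) (π := tens (𝟙 A) (atPr C z y))
    (i := tens (𝟙 A) (offIn (.inl hz))) (p := tens (𝟙 A) (offPr (.inl hz)))
    (tens_mem (id_mem _) (atPr_mem hy h0 q0) rfl rfl)
    (tens_mem (id_mem _) (offIn_mem _) rfl rfl) (tens_mem (id_mem _) (offPr_mem _) rfl rfl)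
    ?_ ?_ ?_ ?_ hZ ?_ ?_
  · rw [tens_comp, atIn_comp_atPr hxy, Category.id_comp, tens_id]
  · rw [tens_comp, offIn_comp_offPr, Category.id_comp, tens_id]
  · rw [tens_comp, atIn_comp_offPr, tens_zero]
  · rw [tens_comp, tens_comp, ← Category.comp_id (𝟙 A), Category.assoc, ← tens_add, atPr_comp_atIn _ hyx]
    simp [tens_id]
  · rw [δ_tens_right, δ_atIn hz, tens_zero]
  · rw [δ_tens_right, δ_offPr hz, tens_zero]

include hx hxy hyx h0 q0 hc hw in
/-- If all summands of `C` but one kill `A` then `A ⊗ C` retracts to this one. -/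
theorem exists_tensor_section (hz : ∀ c, C.X.d c z = 0) :
    ∃ σ ∈ Bi (A.tensor (pure a)) (A.tensor C) 0 0, δ 0 σ = 0 ∧ σ ≫ tens (𝟙 A) (atPr C z y) = 𝟙 _ ∧
      Htpc (𝟙 _) (tens (𝟙 A) (atPr C z y) ≫ σ) := by
  have hZ : (A.tensor (C.off z (.inr hz))).Contractible :=
    contractible_tensor (fun p => w (p.1, p.2.1)) (fun c => hc c.1 c.2)
      fun p q => hw (p.1, p.2.1) (q.1, q.2.1) q.2.2
  refine exists_section (Z := A.tensor (C.off z (.inr hz))) (J := tens (𝟙 A) (atIn C z x))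
    (i := tens (𝟙 A) (offIn (.inr hz))) (p := tens (𝟙 A) (offPr (.inr hz)))
    (tens_mem (id_mem _) (atIn_mem hx h0 q0) rfl rfl)
    (tens_mem (id_mem _) (offIn_mem _) rfl rfl) (tens_mem (id_mem _) (offPr_mem _) rfl rfl)
    ?_ ?_ ?_ ?_ hZ ?_ ?_
  · rw [tens_comp, atIn_comp_atPr hxy, Category.id_comp, tens_id]
  · rw [tens_comp, offIn_comp_offPr, Category.id_comp, tens_id]
  · rw [tens_comp, offIn_comp_atPr, tens_zero]
  · rw [tens_comp, tens_comp, ← Category.comp_id (𝟙 A), Category.assoc, ← tens_add, atPr_comp_atIn _ hyx]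
    simp [tens_id]
  · rw [δ_tens_right, δ_atPr hz, tens_zero]
  · rw [δ_tens_right, δ_offIn hz, tens_zero]

end

/-- `A ⊗ 1 ≅ A`. -/
theorem exists_rightUnit (A : Cpx m k) :
    ∃ f ∈ Bi (A.tensor (pure (.id k))) A 0 0, ∃ g ∈ Bi A (A.tensor (pure (.id k))) 0 0,
      δ 0 f = 0 ∧ δ 0 g = 0 ∧ f ≫ g = 𝟙 _ ∧ g ≫ f = 𝟙 A ∧
      (∀ p j, mat f p j = Hom.comp (Hom.iso (.rightUnit (A.X.o p.1))) (Mat.one A.X p.1 j)) ∧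
      ∀ j p, mat g j p =
        Hom.comp (Mat.one A.X j p.1) (Hom.iso (Isotopy.rightUnit (A.X.o p.1)).symm) := by
  obtain ⟨f, hf, g, hg, h1, h2, h3, h4, h5, h6⟩ := exists_iso (A := A.tensor (pure (.id k))) ⟨fun p => p.1, fun i => (i, ()), fun _ => rfl, fun _ => rfl⟩
    (fun p => by simp) (fun p => by simp) (fun p => .rightUnit (A.X.o p.1)) fun p q => by
      rw [tens_pure_d]
      exact Hom.rightUnit _
  exact ⟨f, hf, g, hg, h1, h2, h3, h4, h5, fun j p => h6 p j⟩

end Cpx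

end Retracts

/-! ### Standard equivalences, and absorption of the dual projector -/

section Projectors
open CategoryTheory Cpx

theorem Cpx.Htpc.mapHomotopic {m n : ℕ} {A B : Cpx m n} {f g : A ⟶ B} (h : Htpc f g) :
    MapHomotopic (mat f) (mat g) := by
  obtain ⟨H, hH, h⟩ := h
  exact ⟨mat H, hH, congrArg mat h⟩

theorem Tangle.exists_turnback_top {n : ℕ} (a : Tangle n n)
    (h : ∃ j, a.strand (a.curve.top j) ≠ a.strand (a.curve.bot j)) :
    ∃ (i : ℕ) (hi : i + 1 < n), a.strand (a.curve.top ⟨i, by omega⟩) =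
      a.strand (a.curve.top ⟨i + 1, hi⟩) := by
  obtain ⟨j, hj⟩ := h
  exact Tangle.exists_turnback (.dual a) ⟨j, fun h => hj h.symm⟩

theorem Hom.rightUnit_symm {m n : ℕ} {a b : Tangle m n} (f : Hom a b) :
    comp f (iso (Isotopy.rightUnit b).symm) =
      comp (iso (Isotopy.rightUnit a).symm) (hcomp f (one _)) := by
  rw [← Hom.iso_symm_comp_comp (Isotopy.rightUnit a) (comp f _), ← Hom.comp_assoc (iso _) f,
    ← Hom.rightUnit, Hom.comp_assoc, Hom.iso_comp_symm, Hom.comp_one]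

namespace UniversalProjector

variable {n : ℕ} (P : UniversalProjector n)

/-- A universal projector. -/
abbrev cpx : Cpx n n := ⟨P.toCx, P.isComplex⟩

/-- The dual of a universal projector. -/
abbrev mirror : Cpx n n := ⟨.mirror P.toCx, P.isComplex.mirror P.finite⟩

/-- `1_n` is the chain group in degree zero. -/
abbrev zIso : Isotopy (.id n) (P.o P.z) := .ofEq P.z_o.symm

theorem h_z : P.h P.z = 0 := (P.degree_zero P.z).2 rfl

theorem d_z (c : P.I) : P.d P.z c = 0 := by
  by_contra h
  have := P.isComplex.deg _ _ h
  have := P.nonpos c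
  have := P.h_z
  omega

/-- The entries of `ι`. -/
def inc (i : P.I) : Hom (.id n) (P.o i) := P.iota () i

theorem inc_z : P.inc P.z = Hom.iso P.zIso := dif_pos rfl

theorem inc_ne {i : P.I} (h : i ≠ P.z) : P.inc i = 0 := dif_neg h

theorem inc_eq (i : P.I) : P.inc i = Hom.comp (Hom.iso P.zIso) (Mat.one P.toCx P.z i) := by
  by_cases h : i = P.z
  · subst h
    rw [inc_z, Mat.one_self, Hom.comp_one]
  · rw [P.inc_ne h, Mat.one_ne _ (Ne.symm h), map_zero]

/-- By planarity, a summand other than `1_n` has turnbacks on both sides. Here the one at the top is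
used; in `contractible_dual` it is the one at the bottom, which the reflection brings to the top. -/
theorem contractible (c : P.I) (hc : c ≠ P.z) : (P.cpx.tensor (Cpx.pure (P.o c))).Contractible :=
  contractible_of_killsTurnbacks P.kills (P.o c) (Tangle.exists_turnback_top _ (P.not_id c hc))

theorem contractible_dual (c : P.I) (hc : c ≠ P.z) :
    (P.cpx.tensor (Cpx.pure (.dual (P.o c)))).Contractible :=
  contractible_of_killsTurnbacks P.kills (.dual (P.o c)) (Tangle.exists_turnback _ (P.not_id c hc))

/-- The inclusion of the chain group in degree zero. -/
abbrev unit : Cpx.pure (.id n) ⟶ P.cpx := atIn P.cpx P.z (Hom.iso P.zIso)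

theorem mat_unit (u i) : mat P.unit u i = P.inc i := (P.inc_eq i).symm

theorem unit_mem : P.unit ∈ Bi _ _ 0 0 := atIn_mem (Hom.iso_mem _) P.h_z P.z_q

theorem δ_unit : δ 0 P.unit = 0 := δ_atIn P.d_z _

/-- The inclusion `P = P ⊗ 1_n → P ⊗ P`. -/
theorem mat_comp_tens_unit {g : P.cpx ⟶ P.cpx.tensor (Cpx.pure (.id n))} (hg : ∀ j p, mat g j p =
      Hom.comp (Mat.one P.toCx j p.1) (Hom.iso (Isotopy.rightUnit (P.o p.1)).symm)) (i p) :
    mat (g ≫ tens (𝟙 P.cpx) P.unit) i p = Hom.comp (Hom.iso (Isotopy.rightUnit (P.o i)).symm)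
      (Hom.hcomp (Mat.one P.toCx i p.1) (P.inc p.2)) := by
  rw [mat_comp, Mat.comp_eq_single _ _ i p (i, ()) fun q hq => ?_]
  · rw [hg, mat_tens_apply, Mat.one_self, Hom.one_comp, mat_unit]
    rfl
  · by_contra hc
    refine hq ?_
    rw [hg, Mat.one_ne _ fun h => hc (Prod.ext h.symm rfl), map_zero, LinearMap.zero_apply, map_zero,
      LinearMap.zero_apply]

/-- The restriction of `1 ⊗ ι` to `1_n` is `ι ⊗ ι`. Any `μ` with `J ≫ μ = 1` therefore satisfies
`μ(ι ⊗ ι) = ι`. -/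
theorem unit_comp {J : P.cpx ⟶ P.cpx.tensor P.cpx} (hJ : ∀ i p, mat J i p =
    Hom.comp (Hom.iso (Isotopy.rightUnit (P.o i)).symm)
      (Hom.hcomp (Mat.one P.toCx i p.1) (P.inc p.2))) : mat (P.unit ≫ J) = P.iotaTensor := by
  funext u p
  rw [mat_comp, Mat.comp_eq_single _ _ u p P.z fun q hq => ?_]
  · rw [mat_unit, hJ, inc_z, ← Hom.comp_assoc, Hom.rightUnit_symm, Hom.comp_assoc, Hom.hcomp_comp,
      Hom.one_comp, ← inc_eq]
    rfl
  · by_contra hc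
    exact hq (by rw [mat_unit, P.inc_ne hc, map_zero, LinearMap.zero_apply])

/-- There is a standard equivalence, with an explicit inverse. -/
theorem exists_standard : ∃ J ∈ Bi P.cpx (P.cpx.tensor P.cpx) 0 0, ∃ μ ∈ Bi (P.cpx.tensor P.cpx) P.cpx 0 0,
    δ 0 J = 0 ∧ δ 0 μ = 0 ∧ J ≫ μ = 𝟙 _ ∧ Htpc (𝟙 _) (μ ≫ J) ∧ mat (P.unit ≫ J) = P.iotaTensor := by
  obtain ⟨f, hf, g, hg, hf0, hg0, hfg, hgf, -, hg'⟩ := exists_rightUnit P.cpx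
  obtain ⟨ν, hν, hν0, h1, H, hH, h2⟩ := exists_tensor_retraction (A := P.cpx) (C := P.cpx) (z := P.z)
    (x := Hom.iso P.zIso) (y := Hom.iso P.zIso.symm) (Hom.iso_mem _) (Hom.iso_comp_symm _)
    -- At fixed total degree, raising the degree of the second factor lowers that of the first,
    -- which is never positive; its negative is the weight.
    (Hom.iso_symm_comp _) P.h_z P.z_q (fun p => (-P.h p.1).toNat) P.contractible
    (fun p q _ h1 h2 => by
      change P.h q.1 + P.h q.2 = P.h p.1 + P.h p.2 at h1
      change P.h q.2 = P.h p.2 + 1 at h2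
      have := P.nonpos q.1
      have := P.nonpos p.1
      omega) P.d_z
  have hι : tens (𝟙 P.cpx) P.unit ∈ Bi _ _ 0 0 := tens_mem (id_mem _) P.unit_mem rfl rfl
  have hι0 : δ 0 (tens (𝟙 P.cpx) P.unit) = 0 := by rw [δ_tens_right, P.δ_unit, tens_zero]
  refine ⟨g ≫ tens (𝟙 P.cpx) P.unit, comp_mem hg hι rfl rfl, ν ≫ f, comp_mem hν hf rfl rfl, ?_, ?_, ?_,
    ⟨H, hH, ?_⟩, ?_⟩
  · rw [δ_comp_of_left hg0, hι0, Limits.comp_zero]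
  · rw [δ_comp_of_left hν0, hf0, Limits.comp_zero]
  · rw [Category.assoc, reassoc_of% h1, hgf]
  · rw [← h2, Category.assoc, reassoc_of% hfg]
  · exact P.unit_comp (P.mat_comp_tens_unit hg')

/-- The absorption of `P^∨`. -/
theorem exists_absorb : ∃ π ∈ Bi (P.cpx.tensor P.mirror) P.cpx 0 0,
    ∃ σ ∈ Bi P.cpx (P.cpx.tensor P.mirror) 0 0, δ 0 π = 0 ∧ δ 0 σ = 0 ∧ σ ≫ π = 𝟙 _ ∧
      Htpc (𝟙 _) (π ≫ σ) ∧ ∀ p j, mat π p j = Hom.comp (Hom.hcomp (Mat.one P.toCx p.1 j)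
        (Hom.comp (Hom.dual (P.inc p.2)) (Hom.iso (.dualId n)))) (Hom.iso (.rightUnit (P.o j))) := by
  obtain ⟨f, hf, g, hg, hf0, hg0, hfg, hgf, hf', -⟩ := exists_rightUnit P.cpx
  set x : Hom (.id n) (.dual (P.o P.z)) :=
    Hom.comp (Hom.iso (Isotopy.dualId n).symm) (Hom.dual (Hom.iso P.zIso.symm)) with hx
  set y : Hom (.dual (P.o P.z)) (.id n) :=
    Hom.comp (Hom.dual (Hom.iso P.zIso)) (Hom.iso (.dualId n)) with hy
  have hxy : Hom.comp x y = Hom.one _ := by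
    rw [hx, hy, Hom.comp_assoc, ← Hom.comp_assoc (Hom.dual _), ← Hom.dual_comp, Hom.iso_comp_symm,
      Hom.dual_one, Hom.one_comp, Hom.iso_symm_comp]
  have hyx : Hom.comp y x = Hom.one _ := by
    rw [hx, hy, Hom.comp_assoc, Hom.iso_comp_symm_comp, ← Hom.dual_comp, Hom.iso_symm_comp,
      Hom.dual_one]
  have hxm : x ∈ Hom.homog _ _ 0 :=
    Hom.comp_mem (Hom.iso_mem _) (Hom.dual_mem (Hom.iso_mem _)) (by simp)
  have hym : y ∈ Hom.homog _ _ 0 :=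
    Hom.comp_mem (Hom.dual_mem (Hom.iso_mem _)) (Hom.iso_mem _) (by simp)
  have h0 : P.mirror.X.h P.z = 0 := by
    change -P.h P.z = 0
    rw [P.h_z, neg_zero]
  have q0 : P.mirror.X.q P.z = 0 := by
    change -P.q P.z = 0
    rw [P.z_q, neg_zero]
  -- No differential of `P` leaves `1_n`, so none of `P^∨` enters it: `1_n` is now a quotient
  -- complex, and the version with a section applies.
  have hd : ∀ c, P.mirror.X.d c P.z = 0 := fun c => by
    change -(_ • Hom.dual (P.d P.z c)) = 0
    rw [P.d_z, map_zero, smul_zero, neg_zero]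
  obtain ⟨σ, hσ, hσ0, h1, H, hH, h2⟩ := exists_tensor_section (A := P.cpx) (C := P.mirror) (z := P.z)
    -- `P^∨` lives in non-negative degrees, so its own degree serves as the weight.
    hxm hxy hyx h0 q0 (fun p => (-P.h p.2).toNat) P.contractible_dual
    (fun p q _ _ h2 => by
      change -P.h q.2 = -P.h p.2 + 1 at h2
      have := P.nonpos q.2
      have := P.nonpos p.2
      omega) hd
  have hι : tens (𝟙 P.cpx) (atPr P.mirror P.z y) ∈ Bi _ _ 0 0 :=
    tens_mem (id_mem _) (atPr_mem hym h0 q0) rfl rfl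
  have hι0 : δ 0 (tens (𝟙 P.cpx) (atPr P.mirror P.z y)) = 0 := by
    rw [δ_tens_right, δ_atPr hd, tens_zero]
  refine ⟨tens (𝟙 P.cpx) (atPr P.mirror P.z y) ≫ f, comp_mem hι hf rfl rfl, g ≫ σ,
    comp_mem hg hσ rfl rfl, ?_, ?_, ?_, ⟨H, hH, ?_⟩, fun p j => ?_⟩
  · rw [δ_comp_of_left hι0, hf0, Limits.comp_zero]
  · rw [δ_comp_of_left hg0, hσ0, Limits.comp_zero]
  · rw [Category.assoc, reassoc_of% h1, hgf]
  · rw [← h2, Category.assoc, reassoc_of% hfg]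
  · rw [mat_comp, Mat.comp_eq_single _ _ p j (j, ()) fun q hq => ?_]
    · have hy' : Hom.comp (Mat.one P.mirror.X p.2 P.z) y =
          Hom.comp (Hom.dual (P.inc p.2)) (Hom.iso (.dualId n)) := by
        by_cases h : p.2 = P.z
        · rw [h, Mat.one_self, Hom.one_comp, inc_z]
        · rw [Mat.one_ne _ h, P.inc_ne h, map_zero, LinearMap.zero_apply, map_zero, map_zero,
            LinearMap.zero_apply]
      rw [hf', mat_tens_apply, Mat.one_self, Hom.comp_one]
      exact congrArg (fun t => Hom.comp (Hom.hcomp (Mat.one P.toCx p.1 j) t) _) hy'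
    · by_contra hc
      refine hq ?_
      rw [hf', Mat.one_ne _ fun h => hc (Prod.ext h rfl), map_zero, map_zero]

end UniversalProjector

end Projectors

/-! ### Chain maps and homotopies between morphism complexes -/

section DG
open CategoryTheory Cpx

variable {m n m' n' m'' n'' : ℕ} {A B : Cpx m n} {A' B' : Cpx m' n'} {A'' B'' : Cpx m'' n''}

theorem diff_mem {k l k' : ℤ} {f : Mat A.X B.X} (hf : f ∈ HomBi A.X B.X k l) (hk : k + 1 = k') :
    diff k f ∈ HomBi A.X B.X k' l := by
  obtain ⟨f, hf, rfl⟩ := exists_mat hf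
  exact δ_mem hf hk

theorem diff_neg {k l : ℤ} {f : Mat A.X B.X} (hf : f ∈ HomBi A.X B.X k l) :
    diff k (-f) = -diff k f := by
  obtain ⟨f, hf, rfl⟩ := exists_mat hf
  exact congrArg mat (δ_neg k f)

theorem diff_add {k l : ℤ} {f g : Mat A.X B.X} (hf : f ∈ HomBi A.X B.X k l)
    (hg : g ∈ HomBi A.X B.X k l) : diff k (f + g) = diff k f + diff k g := by
  obtain ⟨f, hf, rfl⟩ := exists_mat hf
  obtain ⟨g, hg, rfl⟩ := exists_mat hg
  exact congrArg mat (δ_add k f g)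

namespace IsDGMap

variable {F : Mat A.X B.X → Mat A'.X B'.X} {G : Mat A'.X B'.X → Mat A''.X B''.X} {k l : ℤ}
  {f g : Mat A.X B.X}

theorem mem (hF : IsDGMap F) (hf : f ∈ HomBi A.X B.X k l) : F f ∈ HomBi A'.X B'.X k l := by
  simpa using (hF.1 k l).1 f hf

theorem map_add (hF : IsDGMap F) (hf : f ∈ HomBi A.X B.X k l) (hg : g ∈ HomBi A.X B.X k l) :
    F (f + g) = F f + F g := (hF.1 k l).2 f hf g hg

theorem map_sub (hF : IsDGMap F) (hf : f ∈ HomBi A.X B.X k l) (hg : g ∈ HomBi A.X B.X k l) :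
    F (f - g) = F f - F g := by
  have := hF.map_add (sub_mem hf hg) hg
  exact @eq_sub_of_add_eq (Mat A'.X B'.X) _ _ _ _ (this.symm.trans (congrArg F (sub_add_cancel f g)))

theorem map_zero (hF : IsDGMap F) : F 0 = 0 := by
  have := hF.map_sub (k := 0) (l := 0) (zero_mem (HomBi A.X B.X 0 0)) (zero_mem _)
  exact (congrArg F (sub_self 0).symm).trans (this.trans (@sub_self (Mat A'.X B'.X) _ _))

theorem comp (hG : IsDGMap G) (hF : IsDGMap F) : IsDGMap fun f => G (F f) :=
  ⟨fun k l => ⟨fun f hf => (hG.1 k l).1 _ (hF.mem hf), fun f hf g hg => by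
    dsimp only
    rw [hF.map_add hf hg, hG.map_add (hF.mem hf) (hF.mem hg)]⟩, fun k l f hf => by
    dsimp only
    rw [hF.2 k l f hf, hG.2 k l _ (hF.mem hf)]⟩

theorem of_inverse {U : Mat A'.X B'.X → Mat A.X B.X} (hF : IsDGMap F) (hU : IsGraded 0 fun _ _ => U)
    (hUF : ∀ f, U (F f) = f) (hFU : ∀ g, F (U g) = g) : IsDGMap U :=
  ⟨hU, fun k l g hg => by
    have h : U g ∈ HomBi A.X B.X k l := by simpa using (hU k l).1 g hg
    rw [← hUF (diff k (U g)), hF.2 k l _ h, hFU]⟩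

theorem postcomp {A B B' : Cpx m n} {f : B ⟶ B'} (hf : f ∈ Bi B B' 0 0)
    (hf0 : δ 0 f = 0) : IsDGMap fun ζ : Mat A.X B.X => Mat.comp ζ (mat f) := by
  refine ⟨fun k l => ⟨fun ζ hζ => ?_, fun ζ hζ ζ' hζ' => ?_⟩, fun k l ζ hζ => ?_⟩
  · obtain ⟨ζ, hζ, rfl⟩ := exists_mat hζ
    exact comp_mem hζ hf rfl (add_zero l)
  · exact Mat.add_comp ζ ζ' f.2
  · obtain ⟨ζ, hζ, rfl⟩ := exists_mat hζ
    exact congrArg mat (δ_comp_of_right ζ hf0).symm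

end IsDGMap

namespace DGHomotopic

variable {F G K : Mat A.X B.X → Mat A'.X B'.X}

theorem symm (h : DGHomotopic F G) : DGHomotopic G F := by
  obtain ⟨H, hH, h⟩ := h
  refine ⟨fun k l f => -H k l f, fun k l => ⟨fun f hf => neg_mem ((hH k l).1 f hf),
    fun f hf g hg => (congrArg Neg.neg ((hH k l).2 f hf g hg)).trans 
      (@neg_add (Mat A'.X B'.X) _ _ _)⟩, fun k l f hf => ?_⟩
  dsimp only
  rw [diff_neg (k := k - 1) ((hH k l).1 f hf)]
  exact ((neg_sub _ _).symm.trans (congrArg Neg.neg (h k l f hf))).trans (@neg_add (Mat A'.X B'.X) _ _ _)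

theorem trans (h : DGHomotopic F G) (h' : DGHomotopic G K) : DGHomotopic F K := by
  obtain ⟨H, hH, h⟩ := h
  obtain ⟨H', hH', h'⟩ := h'
  refine ⟨fun k l f => H k l f + H' k l f, fun k l => ⟨fun f hf => add_mem ((hH k l).1 f hf)
    ((hH' k l).1 f hf), fun f hf g hg => by
      dsimp only
      rw [(hH k l).2 f hf g hg, (hH' k l).2 f hf g hg]
      exact @add_add_add_comm (Mat A'.X B'.X) _ _ _ _ _⟩, fun k l f hf => ?_⟩
  dsimp only
  rw [diff_add (k := k - 1) ((hH k l).1 f hf) ((hH' k l).1 f hf)]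
  refine (sub_add_sub_cancel (F f) (G f) (K f)).symm.trans ?_
  rw [h k l f hf, h' k l f hf]
  exact @add_add_add_comm (Mat A'.X B'.X) _ _ _ _ _

theorem congr {F' G' : Mat A.X B.X → Mat A'.X B'.X} (h : DGHomotopic F G)
    (hF : ∀ k l, ∀ f ∈ HomBi A.X B.X k l, F f = F' f)
    (hG : ∀ k l, ∀ f ∈ HomBi A.X B.X k l, G f = G' f) : DGHomotopic F' G' := by
  obtain ⟨H, hH, h⟩ := h
  exact ⟨H, hH, fun k l f hf => by rw [← hF k l f hf, ← hG k l f hf, h k l f hf]⟩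

theorem comp_left {L : Mat A'.X B'.X → Mat A''.X B''.X} (hL : IsDGMap L) (hF : IsDGMap F)
    (hG : IsDGMap G) (h : DGHomotopic F G) :
    DGHomotopic (fun f => L (F f)) fun f => L (G f) := by
  obtain ⟨H, hH, h⟩ := h
  refine ⟨fun k l f => L (H k l f), fun k l => ⟨fun f hf => hL.mem ((hH k l).1 f hf),
    fun f hf g hg => by
      dsimp only
      rw [(hH k l).2 f hf g hg, hL.map_add ((hH k l).1 f hf) ((hH k l).1 g hg)]⟩, fun k l f hf => ?_⟩
  have h1 : H k l f ∈ HomBi A'.X B'.X (k - 1) l := (hH k l).1 f hf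
  have h2 : H (k + 1) l (diff k f) ∈ HomBi A'.X B'.X k l := by
    simpa using (hH (k + 1) l).1 _ (diff_mem hf rfl)
  dsimp only
  rw [← hL.map_sub (hF.mem hf) (hG.mem hf), h k l f hf,
    hL.map_add (diff_mem h1 (sub_add_cancel k 1)) h2, hL.2 _ l _ h1]

theorem comp_right {L : Mat A''.X B''.X → Mat A.X B.X} (hL : IsDGMap L) (h : DGHomotopic F G) :
    DGHomotopic (fun f => F (L f)) fun f => G (L f) := by
  obtain ⟨H, hH, h⟩ := h
  refine ⟨fun k l f => H k l (L f), fun k l => ⟨fun f hf => (hH k l).1 _ (hL.mem hf),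
    fun f hf g hg => by
      dsimp only
      rw [hL.map_add hf hg, (hH k l).2 _ (hL.mem hf) _ (hL.mem hg)]⟩, fun k l f hf => ?_⟩
  dsimp only
  rw [h k l _ (hL.mem hf), hL.2 k l f hf]

/-- The homotopy is composition with `H`, without a sign: as `H` has degree `-1`, the Leibniz rule
reads `δ(ζ ≫ H) = ζ ≫ δH - δζ ≫ H`. -/
theorem postcomp {A B B' : Cpx m n} {f g : B ⟶ B'} (h : Htpc f g) :
    DGHomotopic (fun ζ : Mat A.X B.X => Mat.comp ζ (mat f)) fun ζ => Mat.comp ζ (mat g) := by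
  obtain ⟨H, hH, h⟩ := h
  refine ⟨fun k l ζ => Mat.comp ζ (mat H), fun k l => ⟨fun ζ hζ => ?_, fun ζ hζ ζ' hζ' => ?_⟩,
    fun k l ζ hζ => ?_⟩
  · obtain ⟨ζ, hζ, rfl⟩ := exists_mat hζ
    exact comp_mem hζ hH rfl (add_zero l)
  · exact Mat.add_comp ζ ζ' H.2
  · obtain ⟨ζ, hζ, rfl⟩ := exists_mat hζ
    have h1 := δ_comp k (-1) (k - 1) rfl ζ H
    have h2 : ζ ≫ f - ζ ≫ g = δ (k - 1) (ζ ≫ H) + δ k ζ ≫ H := by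
      rw [← Preadditive.comp_sub, h, h1]
      simp
    exact congrArg mat h2

end DGHomotopic

end DG

/-! ### The saddle map -/

section Saddles
open CategoryTheory Cpx

variable {n l : ℕ}

/-- The surface `x` in the closure of `a`, merged with `g` by parallel saddles. -/
def Hom.spread (a : Tangle n n) (b b' : Tangle n l) :
    Hom (.id 0) (.trace a) →ₗ[ℤ[X]] Hom b b' →ₗ[ℤ[X]] Hom b (.comp a b') :=
  Hom.beside.compr₂ (Hom.comp.flip (cob (.merge a b')) ∘ₗ Hom.comp (Hom.iso (.emptyBeside b)))

theorem Hom.spread_apply {a : Tangle n n} {b b' : Tangle n l} (x : Hom (.id 0) (.trace a))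
    (g : Hom b b') : spread a b b' x g =
      comp (comp (iso (.emptyBeside b)) (beside x g)) (cob (.merge a b')) := rfl

theorem Hom.spread_hcomp {a a' : Tangle n n} {b b' b'' : Tangle n l} (x : Hom (.id 0) (.trace a))
    (g : Hom b b') (f : Hom a a') (h : Hom b' b'') :
    comp (spread a b b' x g) (hcomp f h) = spread a' b b'' (comp x (trace f)) (comp g h) := by
  rw [spread_apply, spread_apply, comp_assoc, ← merge, ← comp_assoc, comp_assoc (iso _), beside_comp]

theorem Hom.comp_spread {a : Tangle n n} {b b' b'' : Tangle n l} (x : Hom (.id 0) (.trace a))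
    (g : Hom b b') (h : Hom b' b'') :
    comp g (spread a b' b'' x h) = spread a b b'' x (comp g h) := by
  rw [spread_apply, spread_apply, ← comp_assoc, ← comp_assoc, emptyBeside, comp_assoc (iso _),
    beside_comp, one_comp]

theorem Hom.spread_mem {a : Tangle n n} {b b' : Tangle n l} {x : Hom (.id 0) (.trace a)} {g : Hom b b'}
    {d e f : ℤ} (hx : x ∈ homog _ _ d) (hg : g ∈ homog _ _ e) (h : d + e + n = f) :
    spread a b b' x g ∈ homog _ _ f :=
  comp_mem (comp_mem (iso_mem _) (beside_mem hx hg rfl) rfl) (cob_mem (Cob.deg_merge a b'))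
    (by rw [← h]; ring)

namespace Cpx

variable {A A' : Cpx n n} {B B' : Cpx n l} {s : ℤ}

/-- The saddle map. -/
def sad (B : Cpx n l) (ζ : Cpx.pure (.id 0) ⟶ A.closure s) : B ⟶ A.tensor B :=
  ofMat (fun i p => Hom.spread _ _ _ (mat ζ () p.1) (Mat.one B.X i p.2)) fun p =>
    (Mat.one_mem B.X p.2).subset fun i hi h0 => hi (by
      change Hom.spread _ _ _ (mat ζ () p.1) (Mat.one B.X i p.2) = 0
      rw [h0, map_zero])

theorem mat_sad (ζ : Cpx.pure (.id 0) ⟶ A.closure s) (i p) :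
    mat (sad B ζ) i p = Hom.spread _ _ _ (mat ζ () p.1) (Mat.one B.X i p.2) := rfl

theorem sad_add (ζ ζ' : Cpx.pure (.id 0) ⟶ A.closure s) : sad B (ζ + ζ') = sad B ζ + sad B ζ' :=
  hom_ext fun i p => LinearMap.map_add₂ (Hom.spread _ _ _) (mat ζ () p.1) (mat ζ' () p.1)
    (Mat.one B.X i p.2)

theorem sad_neg (ζ : Cpx.pure (.id 0) ⟶ A.closure s) : sad B (-ζ) = -sad B ζ :=
  hom_ext fun i p => LinearMap.map_neg₂ (Hom.spread _ _ _) (mat ζ () p.1) (Mat.one B.X i p.2)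

theorem sad_zero : sad B (0 : Cpx.pure (.id 0) ⟶ A.closure s) = 0 :=
  hom_ext fun i p => LinearMap.map_zero₂ (Hom.spread _ _ _) (Mat.one B.X i p.2)

theorem sad_mem {ζ : Cpx.pure (.id 0) ⟶ A.closure n} {k d : ℤ} (hζ : ζ ∈ Bi _ _ k d) :
    sad B ζ ∈ Bi B (A.tensor B) k d := by
  refine ⟨fun i p => Hom.spread_mem (hζ.1 () p.1) ((id_mem B).1 i p.2) (by simp; ring),
    fun i p h => ?_, (sad B ζ).2⟩
  have h1 := hζ.2.1 () p.1 fun h0 => h (by rw [mat_sad, h0, LinearMap.map_zero₂])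
  have h2 := (id_mem B).2.1 i p.2 fun h0 => h (by
    rw [mat_sad, show Mat.one B.X i p.2 = 0 from h0, map_zero])
  change A.X.h p.1 = 0 + k at h1
  change A.X.h p.1 + B.X.h p.2 = _
  rw [h1, h2]
  ring

/-- The saddles are disjoint from the regions where `f` and `g` act. Applied to differentials this
naturality makes the saddle map a chain map, and applied to `ι` it computes restrictions to `1_n`.
-/
theorem sad_tens (ζ : Cpx.pure (.id 0) ⟶ A.closure s) (f : A ⟶ A') (g : B ⟶ B') :
    sad B ζ ≫ tens f g = g ≫ sad B' (ζ ≫ tr s f) := by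
  ext i p
  have hs : ∀ x, mat f x p.1 ≠ 0 → x ∈ (f.2 p.1).toFinset := fun x hx =>
    (f.2 p.1).mem_toFinset.2 hx
  have hs' : ∀ x, mat (tr s f) x p.1 ≠ 0 → x ∈ (f.2 p.1).toFinset := fun x hx =>
    hs x fun h0 => hx (by rw [mat_tr, h0, map_zero])
  trans ∑ x ∈ (f.2 p.1).toFinset, Hom.spread (A'.X.o p.1) (B.X.o i) (B'.X.o p.2)
      (Hom.comp (mat ζ () x) (Hom.trace (mat f x p.1))) (mat g i p.2)
  · have h1 : mat (sad B ζ ≫ tens f g) i p = ∑ᶠ q : A.X.I × B.X.I,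
        Hom.spread (A'.X.o p.1) (B.X.o i) (B'.X.o p.2)
          (Hom.comp (mat ζ () q.1) (Hom.trace (mat f q.1 p.1)))
          (Hom.comp (Mat.one B.X i q.2) (mat g q.2 p.2)) :=
      finsum_congr fun q => Hom.spread_hcomp _ _ _ _
    rw [h1, finsum_eq_of_injective _ (g := fun x : A.X.I => (x, i))
      (fun _ _ h => (Prod.ext_iff.1 h).1) fun q hq => ?_]
    · rw [finsum_eq_sum_of_support_subset (s := (f.2 p.1).toFinset)]
      · refine Finset.sum_congr rfl fun x _ => ?_
        rw [Mat.one_self, Hom.one_comp]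
      · intro x hx
        refine Finset.mem_coe.2 (hs x fun h0 => hx ?_)
        dsimp only
        rw [h0, map_zero, map_zero, LinearMap.map_zero₂]
    · rw [Mat.one_ne _ fun h => hq ⟨q.1, Prod.ext rfl h⟩, LinearMap.map_zero₂, map_zero]
  · rw [mat_comp, Mat.comp_eq_single _ _ i p p.2 fun q hq => ?_]
    · rw [mat_sad, Mat.one_self, Hom.comp_spread, Hom.comp_one, mat_comp,
        Mat.comp_eq_sum_right _ _ _ hs', map_sum, LinearMap.sum_apply]
      rfl
    · by_contra hc
      exact hq (by rw [mat_sad, Mat.one_ne _ hc, map_zero, map_zero])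

theorem sign_pure (a : Tangle n l) : (Cpx.pure a).sign = 𝟙 _ := by
  ext i j
  change (0 : ℤ).negOnePow • Mat.one (Cpx.pure a).X i j = _
  rw [Int.negOnePow_zero, one_smul]
  rfl

theorem tr_sign (A : Cpx n n) : tr s A.sign = (A.closure s).sign := by
  ext i j
  have h : Hom.trace (Mat.one A.X i j) = Mat.one (A.closure s).X i j :=
    congrFun (congrFun (congrArg mat (tr_id (s := s) A)) i) j
  change Hom.trace ((A.X.h i).negOnePow • Mat.one A.X i j) =
    (A.X.h i).negOnePow • Mat.one (A.closure s).X i j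
  rw [← h]
  rcases Int.units_eq_one_or (A.X.h i).negOnePow with h | h <;> simp [h]

/-- The sign matrix of `A ⊗ B` acts on the degree `k` map `ζ` as `(-1)^k`. So the `B`-part of the
differential of `A ⊗ B` cancels against `(-1)^k D ≫ sad B ζ`, and only the differential of `A`
remains. -/
theorem δ_sad {ζ : Cpx.pure (.id 0) ⟶ A.closure s} {k d : ℤ} (hζ : ζ ∈ Bi _ _ k d) :
    δ k (sad B ζ) = sad B (δ k ζ) := by
  have h1 : ζ ≫ tr s A.sign = k.negOnePow • ζ := by
    rw [tr_sign, comp_sign hζ, sign_pure, Category.id_comp]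
  have h2 : sad B (k.negOnePow • ζ) = k.negOnePow • sad B ζ := by
    rcases Int.units_eq_one_or k.negOnePow with h | h <;> simp [h, sad_neg]
  have h3 : tens A.sign B.D = tens A.sign (𝟙 B) ≫ tens (𝟙 A) B.D := by
    rw [tens_comp, Category.id_comp, Category.comp_id]
  rw [δ, δ, D_pure, Limits.zero_comp, smul_zero, sub_zero, D_tensor, Preadditive.comp_add, sad_tens,
    sad_tens, Category.id_comp, h1, h2, D_closure]
  simp

/-- `n` parallel disks. -/
def disksHom (n : ℕ) : Cpx.pure (.id 0) ⟶ (Cpx.pure (.id n)).closure n :=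
  ofMat (fun _ _ => cob (.disks n)) fun _ => Set.toFinite _

theorem disksHom_mem : disksHom n ∈ Bi _ _ 0 0 :=
  ⟨fun _ _ => Hom.cob_mem (by simp), fun _ _ _ => rfl, (disksHom n).2⟩

theorem δ_disksHom : δ 0 (disksHom n) = 0 := by
  rw [δ, D_closure, D_pure, D_pure, tr_zero]
  simp

theorem mat_sad_disksHom (u p) : mat (sad (Cpx.pure (.id n)) (disksHom n)) u p =
    Hom.iso (Isotopy.leftUnit (.id n)).symm := by
  rw [mat_sad]
  exact (congrArg _ (Mat.one_self (Cx.pure (.id n)) ())).trans (Hom.disks_merge (.id n))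

/-- This is `Hom.disks_beside_merge` entry by entry: filling the closed source `1_n` with disks
undoes the saddles and recovers `ζ`. -/
theorem disksHom_tr_sad (ζ : Cpx.pure (.id 0) ⟶ A.closure n) {g : A ⟶ A.tensor (Cpx.pure (.id n))}
    (hg : ∀ j p, mat g j p =
      Hom.comp (Mat.one A.X j p.1) (Hom.iso (Isotopy.rightUnit (A.X.o p.1)).symm)) :
    disksHom n ≫ tr n (sad (Cpx.pure (.id n)) ζ) = ζ ≫ tr n g := by
  ext u p
  rw [mat_comp, mat_comp, Mat.comp_eq_single _ _ u p () fun _ _ => rfl,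
    Mat.comp_eq_single _ _ u p p.1 fun q hq => ?_]
  · rw [mat_tr, mat_tr, hg, Mat.one_self, Hom.one_comp, mat_sad]
    have := Hom.disks_beside_merge (mat ζ () p.1)
    refine Eq.trans ?_ this
    change Hom.comp (cob (.disks n)) (Hom.trace (Hom.spread _ _ _ (mat ζ () p.1)
      (Mat.one (Cx.pure (.id n)) () ()))) = _
    rw [Mat.one_self]
    rfl
  · by_contra hc
    refine hq ?_
    rw [mat_tr, hg, Mat.one_ne A.X (show (q : A.X.I) ≠ p.1 from hc), map_zero, LinearMap.zero_apply, map_zero, map_zero]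

end Cpx
end Saddles

/-! ### Duality, absorption, and their composite -/

section Main
open CategoryTheory Cpx

theorem Hom.bend_comp_trace {n : ℕ} {a b c : Tangle n n} (x : Hom a b) (g : Hom b c) :
    comp (bend a b x) (trace (hcomp g (one _))) = bend a c (comp x g) := by
  rw [bend_apply, bend_apply, comp_assoc, ← trace_comp, hcomp_comp, one_comp]

/-- By `coev_slide`, a map on the dual side of the rotated diagram can be moved to the other side,
where it becomes precomposition. -/
theorem Hom.bend_comp_dual {n : ℕ} {a b c : Tangle n n} (d : Hom a b) (x : Hom b c) :
    comp (bend b c x) (trace (hcomp (one c) (dual d))) = bend a c (comp d x) := by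
  rw [← bend_comp_trace, bend_apply, bend_apply, coev_slide d, comp_assoc, comp_assoc, ← trace_comp,
    ← trace_comp, hcomp_comp, hcomp_comp, one_comp, comp_one, one_comp, comp_one]

namespace UniversalProjector

variable {n : ℕ} (P : UniversalProjector n)

/-- The complex `∅`. -/
abbrev void : Cpx 0 0 := Cpx.pure (.id 0)

/-- `q^n Tr(P)`. -/
abbrev loop : Cpx 0 0 := P.cpx.closure n

/-- `q^n Tr(P ⊗ P^∨)`. -/
abbrev dualLoop : Cpx 0 0 := (P.cpx.tensor P.mirror).closure n

/-- Duality, on the level of complexes. -/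
def bendHom (f : P.cpx ⟶ P.cpx) : void ⟶ P.dualLoop :=
  ofMat (fun _ p => Hom.bend (P.o p.2) (P.o p.1) (mat f p.2 p.1)) fun _ => Set.toFinite _

theorem mat_bendHom_apply (f : P.cpx ⟶ P.cpx) (u p) :
    mat (P.bendHom f) u p = Hom.bend (P.o p.2) (P.o p.1) (mat f p.2 p.1) := rfl

theorem bendHom_mem {f : P.cpx ⟶ P.cpx} {k l : ℤ} (hf : f ∈ Bi _ _ k l) :
    P.bendHom f ∈ Bi _ _ k l := by
  refine ⟨fun u p => ?_, fun u p h => ?_, (P.bendHom f).2⟩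
  · have h : Hom.bend (P.o p.2) (P.o p.1) (mat f p.2 p.1) ∈
        Hom.homog _ _ (P.q p.2 - P.q p.1 + l - n) := Hom.bend_mem (hf.1 p.2 p.1)
    have h2 : P.q p.2 - P.q p.1 + l - n = 0 - (P.q p.1 + -P.q p.2 + n) + l := by ring
    rwa [h2] at h
  · have := hf.2.1 p.2 p.1 fun h0 => h (by rw [mat_bendHom_apply, h0, map_zero])
    change P.h p.1 = P.h p.2 + k at this
    change P.h p.1 + -P.h p.2 = 0 + k
    omega

theorem bendHom_tr_left (f g : P.cpx ⟶ P.cpx) :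
    P.bendHom f ≫ tr n (tens g (𝟙 P.mirror)) = P.bendHom (f ≫ g) := by
  ext u ⟨j, i⟩
  rw [mat_comp, mat_bendHom_apply, mat_comp]
  refine (finsum_eq_of_injective _ (g := fun x : P.I => (x, i))
      (fun _ _ h => (Prod.ext_iff.1 h).1) fun q hq => ?_).trans ?_
  · rw [mat_tr, mat_tens_apply, mat_id, Mat.one_ne P.mirror.X (show q.2 ≠ i from fun h => hq ⟨q.1, Prod.ext rfl h.symm⟩),
      map_zero, map_zero, map_zero]
  · refine Eq.trans (finsum_congr fun x => ?_) ((Hom.bend (P.o i) (P.o j)).toAddMonoidHom.map_finsum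
      ((g.2 j).subset fun x hx h0 => hx ?_)).symm
    · rw [mat_tr, mat_tens_apply, mat_id]
      dsimp only
      rw [Mat.one_self]
      exact Hom.bend_comp_trace _ _
    · change Hom.comp _ (mat g x j) = 0
      rw [show mat g x j = 0 from h0, map_zero]

/-- Precomposition with the differential of `P` turns into the differential of `P^∨`. An entry of
`f` from `x` to `j` carries the sign `(-1)^(h j)` of the tensor product and `-(-1)^(-h x)` of the
dual; since `h j = h x + k`, their product is `-(-1)^k`. -/
theorem bendHom_tr_right {f : P.cpx ⟶ P.cpx} {k l : ℤ} (hf : f ∈ Bi _ _ k l) :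
    P.bendHom f ≫ tr n (tens P.cpx.sign P.mirror.D) = -(k.negOnePow • P.bendHom (P.cpx.D ≫ f)) := by
  ext u ⟨j, i⟩
  obtain ⟨L, hL⟩ : ∃ L : Hom (P.o i) (P.o j) →+ Hom (.id 0) (.trace (.comp (P.o j) (.dual (P.o i)))),
      ∀ x, L x = -(k.negOnePow • Hom.bend (P.o i) (P.o j) x) := by
    rcases Int.units_eq_one_or k.negOnePow with h | h
    · exact ⟨(-(Hom.bend (P.o i) (P.o j))).toAddMonoidHom, fun x => by simp [h]⟩
    · exact ⟨(Hom.bend (P.o i) (P.o j)).toAddMonoidHom, fun x => by simp [h]⟩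
  have h1 : mat (-(k.negOnePow • P.bendHom (P.cpx.D ≫ f))) u (j, i) = L (mat (P.cpx.D ≫ f) i j) := by
    rw [hL]
    rcases Int.units_eq_one_or k.negOnePow with h | h <;> simp [h] <;> rfl
  rw [h1, mat_comp, mat_comp]
  refine (finsum_eq_of_injective _ (g := fun x : P.I => (j, x))
      (fun _ _ h => (Prod.ext_iff.1 h).2) fun q hq => ?_).trans ?_
  · have : mat P.cpx.sign q.1 j = 0 := by
      change (P.h q.1).negOnePow • Mat.one P.toCx q.1 j = 0
      rw [Mat.one_ne _ fun h => hq ⟨q.2, Prod.ext h.symm rfl⟩, smul_zero]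
    rw [mat_tr, mat_tens_apply]
    dsimp only
    rw [this, LinearMap.map_zero₂, map_zero, map_zero]
  · refine Eq.trans (finsum_congr fun x => ?_) (L.map_finsum
      ((f.2 j).subset fun x hx h0 => hx ?_)).symm
    · rw [hL, mat_tr, mat_tens_apply, mat_bendHom_apply]
      change Hom.comp (Hom.bend (P.o x) (P.o j) (mat f x j)) (Hom.trace (Hom.hcomp
        ((P.h j).negOnePow • Mat.one P.toCx j j) (-((-P.h x).negOnePow • Hom.dual (P.d i x))))) =
        -(k.negOnePow • Hom.bend _ _ (Hom.comp (P.d i x) (mat f x j)))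
      rw [Mat.one_self, ← Hom.bend_comp_dual]
      by_cases h0 : mat f x j = 0
      · rw [h0, map_zero, LinearMap.map_zero₂, LinearMap.map_zero₂, smul_zero, neg_zero]
      · have h2 : P.h j = P.h x + k := hf.2.1 x j h0
        have h3 : k.negOnePow = (P.h j).negOnePow * (-P.h x).negOnePow := by
          rw [← Int.negOnePow_add, h2]
          congr 1
          ring
        rw [h3]
        rcases Int.units_eq_one_or (P.h j).negOnePow with h | h <;>
          rcases Int.units_eq_one_or (-P.h x).negOnePow with h' | h' <;> simp [h, h']
    · change Hom.comp _ (mat f x j) = 0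
      rw [show mat f x j = 0 from h0, map_zero]

theorem δ_bendHom {f : P.cpx ⟶ P.cpx} {k l : ℤ} (hf : f ∈ Bi _ _ k l) :
    δ k (P.bendHom f) = P.bendHom (δ k f) := by
  have h : P.bendHom (δ k f) = P.bendHom (f ≫ P.cpx.D) - k.negOnePow • P.bendHom (P.cpx.D ≫ f) := by
    rw [δ]
    ext u p
    rcases Int.units_eq_one_or k.negOnePow with h | h
    · simp only [h, one_smul]
      exact map_sub (Hom.bend _ _) (mat (f ≫ P.cpx.D) p.2 p.1) (mat (P.cpx.D ≫ f) p.2 p.1)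
    · simp only [h, Units.neg_smul, one_smul, sub_neg_eq_add]
      exact map_add (Hom.bend _ _) (mat (f ≫ P.cpx.D) p.2 p.1) (mat (P.cpx.D ≫ f) p.2 p.1)
  rw [h, ← P.bendHom_tr_left, δ, D_pure, Limits.zero_comp, smul_zero, sub_zero, D_closure, D_tensor,
    tr_add, Preadditive.comp_add, P.bendHom_tr_right hf, sub_eq_add_neg]

theorem isDGMap_duality : IsDGMap P.duality := by
  refine ⟨fun k l => ⟨fun f hf => ?_, fun f _ g _ => ?_⟩, fun k l f hf => ?_⟩
  · obtain ⟨f, hf, rfl⟩ := exists_mat (A := P.cpx) (B := P.cpx) hf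
    rw [add_zero]
    exact P.bendHom_mem hf
  · funext u p
    exact map_add (Hom.bend (P.o p.2) (P.o p.1)) (f p.2 p.1) (g p.2 p.1)
  · obtain ⟨f, hf, rfl⟩ := exists_mat (A := P.cpx) (B := P.cpx) hf
    exact congrArg mat (P.δ_bendHom hf).symm

/-- The inverse of duality. -/
def unduality (ζ : Mat empty P.dualUnknot) : Mat P.toCx P.toCx :=
  fun i j => Hom.unbend (P.o i) (P.o j) (ζ () (j, i))

/-- Column finiteness is automatic for maps out of `∅` but not for endomorphisms of `P`. There it
follows because a homogeneous map meets, for each target, a single chain group, which is finite. -/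
theorem unduality_mem {ζ : Mat empty P.dualUnknot} {k l : ℤ} (hζ : ζ ∈ HomBi _ _ k l) :
    P.unduality ζ ∈ HomBi _ _ k l := by
  have h : ∀ i j, P.unduality ζ i j ≠ 0 → P.h j = P.h i + k := fun i j h => by
    have := hζ.2.1 () (j, i) fun h0 => h ((congrArg (Hom.unbend _ _) h0).trans (map_zero _))
    change P.h j + -P.h i = 0 + k at this
    omega
  refine ⟨fun i j => ?_, h, fun j => (P.finite (P.h j - k)).subset fun i hi => ?_⟩
  · have h : Hom.unbend (P.o i) (P.o j) (ζ () (j, i)) ∈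
        Hom.homog _ _ (0 - (P.q j + -P.q i + n) + l + n) := Hom.unbend_mem (hζ.1 () (j, i))
    have h2 : 0 - (P.q j + -P.q i + n) + l + n = P.q i - P.q j + l := by ring
    rwa [h2] at h
  · have := h i j hi
    change P.h i = P.h j - k
    omega

theorem unduality_duality (f : Mat P.toCx P.toCx) : P.unduality (P.duality f) = f :=
  funext fun i => funext fun j => Hom.unbend_bend (f i j)

theorem duality_unduality (ζ : Mat empty P.dualUnknot) : P.duality (P.unduality ζ) = ζ :=
  funext fun _ => funext fun p => Hom.bend_unbend (ζ () p)

theorem isDGMap_unduality : IsDGMap P.unduality :=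
  IsDGMap.of_inverse (A := P.cpx) (B := P.cpx) (A' := void) (B' := P.dualLoop) P.isDGMap_duality
    (fun k l => ⟨fun ζ hζ => by rw [add_zero]; exact P.unduality_mem hζ, fun ζ _ ζ' _ =>
      funext fun i => funext fun j => map_add (Hom.unbend (P.o i) (P.o j)) (ζ () (j, i)) (ζ' () (j, i))⟩)
    P.unduality_duality P.duality_unduality

theorem isDGIso_duality : IsDGIso P.duality :=
  ⟨P.isDGMap_duality, fun k l => ⟨fun f hf => IsDGMap.mem (A := P.cpx) (B := P.cpx) (A' := void)
    (B' := P.dualLoop) P.isDGMap_duality hf, fun f _ g _ h => by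
      rw [← P.unduality_duality f, h, P.unduality_duality], fun ζ hζ =>
    ⟨P.unduality ζ, P.unduality_mem hζ, P.duality_unduality ζ⟩⟩⟩

/-- The absorption map is composition with a homotopy equivalence. -/
theorem exists_absorb_inverse : ∃ Θ, AreHomotopyInverse P.absorb Θ := by
  obtain ⟨π, hπ, σ, hσ, hπ0, hσ0, h1, h2, h3⟩ := P.exists_absorb
  -- The entry of `π` from `(i, x)` to `j` vanishes unless `i = j`, so the matrix product collapses
  -- to the sum over `x` that defines `absorb`.
  have hF : ∀ ζ, Mat.comp ζ (mat (tr n π)) = P.absorb ζ := fun ζ => by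
    funext u j
    refine finsum_eq_of_injective _ (g := fun x : P.I => (j, x))
      (fun _ _ h => (Prod.ext_iff.1 h).2) (fun q hq => ?_) |>.trans (finsum_congr fun x => ?_)
    · rw [mat_tr, h3, Mat.one_ne P.toCx fun h => hq ⟨q.2, Prod.ext h.symm rfl⟩, LinearMap.map_zero₂,
        LinearMap.map_zero₂, map_zero, map_zero]
    · rw [mat_tr, h3, Mat.one_self]
      rfl
  have hF' : P.absorb = fun ζ => Mat.comp ζ (mat (tr n π)) := funext fun ζ => (hF ζ).symm
  have hπ' := tr_mem (s := n) hπ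
  have hσ' := tr_mem (s := n) hσ
  have hπ0' : δ 0 (tr n π) = 0 := by rw [δ_tr, hπ0, tr_zero]
  have hσ0' : δ 0 (tr n σ) = 0 := by rw [δ_tr, hσ0, tr_zero]
  rw [hF']
  refine ⟨fun ζ => Mat.comp ζ (mat (tr n σ)), IsDGMap.postcomp (A := void) hπ' hπ0',
    IsDGMap.postcomp (A := void) hσ' hσ0', ?_, ?_⟩
  · have h : Htpc (tr n π ≫ tr n σ) (𝟙 P.dualLoop) := by
      obtain ⟨H, hH, h⟩ := h2
      refine ⟨-tr n H, neg_mem (tr_mem hH), ?_⟩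
      rw [δ_neg, δ_tr, ← h, tr_sub, tr_comp, tr_id, neg_sub]
    refine DGHomotopic.congr (A := void) (A' := void) (DGHomotopic.postcomp (A := void) h) (fun k l ζ _ => ?_) fun k l ζ _ => ?_
    · exact (Mat.comp_assoc ζ (tr n π).2 (tr n σ).2).symm
    · exact Mat.comp_one ζ
  · have h : tr n σ ≫ tr n π = 𝟙 P.loop := by rw [← tr_comp, h1, tr_id]
    have h' : ∀ ζ : Mat void.X P.loop.X, Mat.comp (Mat.comp ζ (mat (tr n σ))) (mat (tr n π)) = ζ :=
      fun ζ => (Mat.comp_assoc ζ (tr n σ).2 (tr n π).2).trans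
        ((congrArg (fun x => Mat.comp ζ (mat x)) h).trans (Mat.comp_one ζ))
    refine DGHomotopic.congr (A := void) (A' := void) (DGHomotopic.postcomp (A := void)
      (f := 𝟙 P.loop) (g := 𝟙 P.loop) ⟨0, zero_mem _, by simp⟩) (fun k l ζ _ => ?_) fun k l ζ _ => ?_
    · exact (Mat.comp_one ζ).trans (h' ζ).symm
    · exact Mat.comp_one ζ

/-- `η`, on the level of complexes. -/
def etaHom : void ⟶ P.loop := disksHom n ≫ tr n P.unit

theorem mat_etaHom : mat P.etaHom = P.eta := by
  funext u i
  rw [etaHom, mat_comp, Mat.comp_eq_single _ _ u i () fun _ _ => rfl, mat_tr, mat_unit]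
  rfl

theorem mat_etaHom_comp_tr (f : P.cpx ⟶ P.cpx) : mat (P.etaHom ≫ tr n f) = P.phi (mat f) :=
  congrArg (fun x => Mat.comp x (mat (tr n f))) P.mat_etaHom

/-- As `ι` and `ι^∨` are supported at the summand `1_n`, both sides involve only the entries of `f`
that start there. On the right, `ι^∨` slides around the rotated diagram and becomes precomposition
with `ι`; what is left is the rotation of `1_n`, and this consists of `n` disks (`Hom.coev_id`). -/
theorem phi_eq (f : Mat P.toCx P.toCx) : P.phi f = P.absorb (P.duality f) := by
  funext u j
  have h1 : P.phi f u j = Hom.comp (Hom.comp (cob (.disks n)) (Hom.trace (P.inc P.z)))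
      (Hom.trace (f P.z j)) := by
    refine finsum_eq_single _ P.z fun i hi => ?_
    change Hom.comp (Hom.comp (cob (.disks n)) (Hom.trace (P.inc i))) (Hom.trace (f i j)) = 0
    rw [P.inc_ne hi, map_zero, map_zero, LinearMap.map_zero₂]
  have h2 : P.absorb (P.duality f) u j = Hom.comp (Hom.bend (P.o P.z) (P.o j) (f P.z j))
      (Hom.trace (Hom.comp (Hom.hcomp (Hom.one _) (Hom.comp (Hom.dual (P.inc P.z)) (Hom.iso (.dualId n))))
        (Hom.iso (.rightUnit (P.o j))))) := by
    refine finsum_eq_single _ P.z fun i hi => ?_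
    change Hom.comp _ (Hom.trace (Hom.comp (Hom.hcomp (Hom.one _) (Hom.comp (Hom.dual (P.inc i))
      (Hom.iso (.dualId n)))) (Hom.iso (.rightUnit (P.o j))))) = 0
    rw [P.inc_ne hi, map_zero, LinearMap.map_zero₂, map_zero, LinearMap.map_zero₂, map_zero, map_zero]
  have h3 : Hom.hcomp (Hom.one (P.o j)) (Hom.comp (Hom.dual (P.inc P.z)) (Hom.iso (.dualId n))) =
      Hom.comp (Hom.hcomp (Hom.one _) (Hom.dual (P.inc P.z)))
        (Hom.hcomp (Hom.one _) (Hom.iso (.dualId n))) := by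
    rw [Hom.hcomp_comp, Hom.one_comp]
  have h4 : Hom.comp (Hom.hcomp (Hom.comp (P.inc P.z) (f P.z j)) (Hom.one _))
      (Hom.comp (Hom.hcomp (Hom.one (P.o j)) (Hom.iso (.dualId n))) (Hom.iso (.rightUnit (P.o j)))) =
      Hom.comp (Hom.comp (Hom.hcomp (Hom.one _) (Hom.iso (.dualId n))) (Hom.iso (.rightUnit (.id n))))
        (Hom.comp (P.inc P.z) (f P.z j)) := by
    rw [Hom.comp_assoc, ← Hom.rightUnit, ← Hom.comp_assoc, ← Hom.comp_assoc, Hom.hcomp_comp,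
      Hom.hcomp_comp]
    simp only [Hom.one_comp, Hom.comp_one]
  rw [h1, h2, h3, Hom.comp_assoc (Hom.hcomp _ _), Hom.trace_comp, ← Hom.comp_assoc (Hom.bend _ _ _),
    Hom.bend_comp_dual, Hom.bend_apply, Hom.comp_assoc (cob (.coev _)), ← Hom.trace_comp, h4, Hom.trace_comp,
    ← Hom.comp_assoc, Hom.coev_id, Hom.trace_comp, ← Hom.comp_assoc]

end UniversalProjector

end Main

/-! ### The maps `φ` and `ψ` are inverse up to homotopy -/

section Main
open CategoryTheory Cpx

theorem Isotopy.leftUnit_id (n : ℕ) : Isotopy.leftUnit (.id n) = Isotopy.rightUnit (.id n) :=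
  Isotopy.ext fun x => by rcases x with x | x <;> rfl

namespace UniversalProjector

variable {n : ℕ} (P : UniversalProjector n)

theorem etaHom_mem : P.etaHom ∈ Bi _ _ 0 0 := comp_mem disksHom_mem (tr_mem P.unit_mem) rfl rfl

theorem δ_etaHom : δ 0 P.etaHom = 0 := by
  rw [etaHom, δ_comp_of_left δ_disksHom, δ_tr, P.δ_unit, tr_zero, Limits.comp_zero]

theorem isDGMap_phi : IsDGMap P.phi := by
  refine ⟨fun k l => ⟨fun f hf => ?_, fun f hf g hg => ?_⟩, fun k l f hf => ?_⟩
  · obtain ⟨f, hf, rfl⟩ := exists_mat (A := P.cpx) (B := P.cpx) hf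
    dsimp only
    rw [← P.mat_etaHom_comp_tr]
    exact comp_mem P.etaHom_mem (tr_mem (f := f) hf) (by ring) (zero_add l)
  · obtain ⟨f, hf, rfl⟩ := exists_mat (A := P.cpx) (B := P.cpx) hf
    obtain ⟨g, hg, rfl⟩ := exists_mat (A := P.cpx) (B := P.cpx) hg
    have h : P.etaHom ≫ tr n (f + g) = P.etaHom ≫ tr n f + P.etaHom ≫ tr n g := by
      rw [tr_add, Preadditive.comp_add]
    have := congrArg mat h
    rw [map_add, P.mat_etaHom_comp_tr, P.mat_etaHom_comp_tr, P.mat_etaHom_comp_tr, map_add] at this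
    exact this
  · obtain ⟨f, hf, rfl⟩ := exists_mat (A := P.cpx) (B := P.cpx) hf
    have h : P.etaHom ≫ tr n (δ k f) = δ k (P.etaHom ≫ tr n f) := by
      rw [δ_comp_of_left P.δ_etaHom, δ_tr]
    have := congrArg mat h
    rw [P.mat_etaHom_comp_tr, mat_δ, mat_δ, P.mat_etaHom_comp_tr] at this
    exact this

/-- A homotopy retraction of `φ`. -/
theorem exists_phi_retraction : ∃ Θ : Mat empty P.unknot → Mat P.toCx P.toCx, IsDGMap Θ ∧
    DGHomotopic (fun f => Θ (P.phi f)) fun f => f := by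
  obtain ⟨Θ, h1, h2, h3, -⟩ := P.exists_absorb_inverse
  refine ⟨fun ζ => P.unduality (Θ ζ), IsDGMap.comp (A := void) (B := P.loop) (A' := void)
    (B' := P.dualLoop) (A'' := P.cpx) (B'' := P.cpx) P.isDGMap_unduality h2, ?_⟩
  have h4 := DGHomotopic.comp_left (A := P.cpx) (B := P.cpx) (A' := void) (B' := P.dualLoop)
    (A'' := P.cpx) (B'' := P.cpx) P.isDGMap_unduality
    (IsDGMap.comp (A := P.cpx) (B := P.cpx) (A' := void) (B' := P.dualLoop) (A'' := void)
      (B'' := P.dualLoop) (IsDGMap.comp (A := void) (B := P.dualLoop) (A' := void) (B' := P.loop)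
      (A'' := void) (B'' := P.dualLoop) h2 h1) P.isDGMap_duality) P.isDGMap_duality
    (DGHomotopic.comp_right (A := void) (B := P.dualLoop) (A' := void) (B' := P.dualLoop)
      (A'' := P.cpx) (B'' := P.cpx) P.isDGMap_duality h3)
  exact DGHomotopic.congr (A := P.cpx) (B := P.cpx) (A' := P.cpx) (B' := P.cpx) h4
    (fun k l f _ => by rw [P.phi_eq]) fun k l f _ => P.unduality_duality f

/-- Endomorphisms of `P` are determined up to homotopy by their restriction to `1_n`. -/
theorem htpc_of_unit_comp {e e' : P.cpx ⟶ P.cpx} (he : e ∈ Bi _ _ 0 0) (he' : e' ∈ Bi _ _ 0 0)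
    (h0 : δ 0 e = 0) (h0' : δ 0 e' = 0) (h : P.unit ≫ e = P.unit ≫ e') : Htpc e e' := by
  obtain ⟨Θ, hΘ, H, hH, hh⟩ := P.exists_phi_retraction
  have hΘ0 : Θ 0 = 0 := IsDGMap.map_zero (A := void) (B := P.loop) (A' := P.cpx) (B' := P.cpx) hΘ
  have hm : mat (e' - e) ∈ HomBi P.toCx P.toCx 0 0 := sub_mem he' he
  -- `φ` factors through restriction to `1_n`, where `e` and `e'` agree.
  have hphi : P.phi (mat (e' - e)) = 0 := by
    have : P.etaHom ≫ tr n (e' - e) = 0 := by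
      rw [etaHom, Category.assoc, ← tr_comp, Preadditive.comp_sub, h, sub_self, tr_zero,
        Limits.comp_zero]
    rw [← P.mat_etaHom_comp_tr, this]
    rfl
  have hd : diff 0 (mat (e' - e)) = 0 := by
    rw [← mat_δ, δ_sub, h0, h0', sub_self, map_zero]
  have hH0 : H (0 + 1) 0 0 = 0 := by
    have := (hH (0 + 1) 0).2 0 (zero_mem _) 0 (zero_mem _)
    have h1 : H (0 + 1) 0 0 = H (0 + 1) 0 0 + H (0 + 1) 0 0 :=
      (congrArg (H (0 + 1) 0) (@add_zero (Mat P.toCx P.toCx) _ 0)).symm.trans this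
    exact funext fun i => funext fun j => left_eq_add.1 (congrFun (congrFun h1 i) j)
  -- At the closed element `e' - e` the homotopy `Θφ ≃ 1` loses both `Θ(φ(e' - e))` and its second
  -- term, and exhibits `e - e'` as a boundary.
  have key := hh 0 0 _ hm
  dsimp only at key
  rw [hphi, hΘ0, hd, hH0] at key
  obtain ⟨K, hK, hK'⟩ := exists_mat (A := P.cpx) (B := P.cpx) ((hH 0 0).1 _ hm)
  rw [← hK'] at key
  have key' : 0 - (e' - e) = δ (0 - 1) K + 0 := mat_injective key
  refine ⟨K, hK, ?_⟩
  rw [add_zero, zero_sub, neg_sub, zero_sub] at key'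
  exact key'

section Psi

variable (μ : P.cpx.tensor P.cpx ⟶ P.cpx)

theorem mat_sad_comp (ζ : void ⟶ P.loop) : mat (sad P.cpx ζ ≫ μ) = P.psi (mat μ) (mat ζ) := rfl

variable {μ} (hμ : μ ∈ Bi _ _ 0 0) (hμ0 : δ 0 μ = 0)

include hμ hμ0

theorem isDGMap_psi : IsDGMap (P.psi (mat μ)) := by
  refine ⟨fun k l => ⟨fun ζ hζ => ?_, fun ζ hζ ζ' hζ' => ?_⟩, fun k l ζ hζ => ?_⟩
  · obtain ⟨ζ, hζ, rfl⟩ := exists_mat (A := void) (B := P.loop) hζ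
    exact comp_mem (sad_mem (A := P.cpx) hζ) hμ rfl (add_zero l)
  · obtain ⟨ζ, hζ, rfl⟩ := exists_mat (A := void) (B := P.loop) hζ
    obtain ⟨ζ', hζ', rfl⟩ := exists_mat (A := void) (B := P.loop) hζ'
    have h : sad P.cpx (ζ + ζ') ≫ μ = sad P.cpx ζ ≫ μ + sad P.cpx ζ' ≫ μ := by
      rw [sad_add, Preadditive.add_comp]
    exact congrArg mat h
  · obtain ⟨ζ, hζ, rfl⟩ := exists_mat (A := void) (B := P.loop) hζ
    have h : sad P.cpx (δ k ζ) ≫ μ = δ k (sad P.cpx ζ ≫ μ) := by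
      rw [δ_comp_of_right _ hμ0, δ_sad (A := P.cpx) hζ]
    exact congrArg mat h

variable (hμι : Mat.comp P.iotaTensor (mat μ) = P.iota)

include hμι

/-- On `1_n` the disks of `η` cancel the saddles, so the saddle map of `η` restricts to `ι ⊗ ι`,
which `μ` sends to `ι`. The rest is `htpc_of_unit_comp`. -/
theorem htpc_psi_eta : Htpc (sad P.cpx P.etaHom ≫ μ) (𝟙 _) := by
  refine P.htpc_of_unit_comp (comp_mem (sad_mem (A := P.cpx) P.etaHom_mem) hμ rfl rfl) (id_mem _) ?_
    δ_id ?_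
  · rw [δ_comp_of_right _ hμ0, δ_sad (A := P.cpx) P.etaHom_mem, P.δ_etaHom]
    rw [sad_zero, Limits.zero_comp]
  · have h : mat (P.unit ≫ sad P.cpx P.etaHom) = P.iotaTensor := by
      rw [etaHom, ← sad_tens]
      funext u p
      rw [mat_comp, Mat.comp_eq_single _ _ u p ((), ()) fun _ _ => rfl, mat_sad_disksHom,
        mat_tens_apply, mat_unit, mat_unit]
      rw [Isotopy.leftUnit_id]
      rfl
    refine mat_injective ?_
    rw [← Category.assoc, Category.comp_id]
    refine (congrArg (fun x => Mat.comp x (mat μ)) h).trans (hμι.trans ?_)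
    funext u i
    exact (P.mat_unit u i).symm

/-- By naturality of the saddles and `disksHom_tr_sad`, `φ(ψ(ζ))` equals `ζ` followed by the closure
of the composite `P = P ⊗ 1_n → P ⊗ P → P` of `1 ⊗ ι` and `μ`. This endomorphism restricts to `ι`,
so it is homotopic to the identity. -/
theorem exists_phi_psi : DGHomotopic (fun ζ => P.phi (P.psi (mat μ) ζ)) fun ζ => ζ := by
  obtain ⟨f, hf, g, hg, hf0, hg0, hfg, hgf, -, hg'⟩ := exists_rightUnit P.cpx
  have hι : tens (𝟙 P.cpx) P.unit ∈ Bi _ _ 0 0 := tens_mem (id_mem _) P.unit_mem rfl rfl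
  have hι0 : δ 0 (tens (𝟙 P.cpx) P.unit) = 0 := by rw [δ_tens_right, P.δ_unit, tens_zero]
  have h1 : Htpc (g ≫ tens (𝟙 P.cpx) P.unit ≫ μ) (𝟙 _) := by
    refine P.htpc_of_unit_comp (comp_mem hg (comp_mem hι hμ rfl rfl) rfl rfl) (id_mem _) ?_ δ_id ?_
    · rw [δ_comp_of_left hg0, δ_comp_of_left hι0, hμ0, Limits.comp_zero, Limits.comp_zero]
    · refine mat_injective ?_
      have := P.unit_comp (P.mat_comp_tens_unit hg')
      rw [Category.comp_id, ← Category.assoc g, ← Category.assoc]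
      refine (congrArg (fun x => Mat.comp x (mat μ)) this).trans (hμι.trans ?_)
      funext u i
      exact (P.mat_unit u i).symm
  have h2 : Htpc (tr n (g ≫ tens (𝟙 P.cpx) P.unit ≫ μ)) (𝟙 P.loop) := by
    obtain ⟨H, hH, h⟩ := h1
    exact ⟨tr n H, tr_mem hH, by rw [δ_tr, ← h, tr_sub, tr_id]⟩
  refine DGHomotopic.congr (A := void) (A' := void) (DGHomotopic.postcomp (A := void) h2)
    (fun k l ζ hζ => ?_) fun k l ζ _ => Mat.comp_one ζ
  obtain ⟨ζ, hζ, rfl⟩ := exists_mat (A := void) (B := P.loop) hζ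
  have h3 : P.unit ≫ sad P.cpx ζ = sad (Cpx.pure (.id n)) ζ ≫ tens (𝟙 P.cpx) P.unit := by
    rw [sad_tens, tr_id, Category.comp_id]
  have h4 : P.etaHom ≫ tr n (sad P.cpx ζ ≫ μ) = ζ ≫ tr n (g ≫ tens (𝟙 P.cpx) P.unit ≫ μ) := by
    rw [etaHom, Category.assoc, ← tr_comp, ← Category.assoc P.unit, h3, Category.assoc, tr_comp,
      ← Category.assoc, disksHom_tr_sad ζ hg', Category.assoc, ← tr_comp]
  exact (congrArg mat h4).symm.trans (P.mat_etaHom_comp_tr _)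

end Psi

/-- The equation `μ(ι ⊗ ι) = ι` has to hold on the nose, and it does because `J ≫ μ = 1` is strict.
-/
theorem exists_isStandard : ∃ μ, P.IsStandard μ := by
  obtain ⟨J, hJ, μ, hμ, hJ0, hμ0, h1, h2, h3⟩ := P.exists_standard
  have h2' : Htpc (μ ≫ J) (𝟙 _) := by
    obtain ⟨H, hH, h⟩ := h2
    exact ⟨-H, neg_mem hH, by rw [δ_neg, ← h, neg_sub]⟩
  have h1' : Htpc (J ≫ μ) (𝟙 _) := ⟨0, zero_mem _, by rw [h1]; simp⟩
  refine ⟨mat μ, ⟨⟨hμ, congrArg mat hμ0⟩, mat J, ⟨hJ, congrArg mat hJ0⟩, h2'.mapHomotopic,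
    h1'.mapHomotopic⟩, ?_⟩
  have h4 : P.unit ≫ J ≫ μ = P.unit := by rw [h1, Category.comp_id]
  rw [← h3]
  rw [← Category.assoc] at h4
  refine (congrArg mat h4).trans ?_
  funext u i
  exact P.mat_unit u i

/-- With `Θ` a homotopy left inverse of `φ`, one has `ψφ ≃ Θφψφ ≃ Θφ ≃ 1`; the middle step is
`exists_phi_psi`. -/
theorem areHomotopyInverse_phi_psi {μ : P.cpx.tensor P.cpx ⟶ P.cpx} (hμ : μ ∈ Bi _ _ 0 0)
    (hμ0 : δ 0 μ = 0) (hμι : Mat.comp P.iotaTensor (mat μ) = P.iota) :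
    AreHomotopyInverse P.phi (P.psi (mat μ)) := by
  have hphi := P.isDGMap_phi
  have hpsi := P.isDGMap_psi hμ hμ0
  have h1 := P.exists_phi_psi hμ hμ0 hμι
  refine ⟨hphi, hpsi, ?_, h1⟩
  obtain ⟨Θ, hΘ, h2⟩ := P.exists_phi_retraction
  have hpp : IsDGMap fun f => P.psi (mat μ) (P.phi f) := IsDGMap.comp (A := P.cpx) (B := P.cpx)
    (A' := void) (B' := P.loop) (A'' := P.cpx) (B'' := P.cpx) hpsi hphi
  have h3 := DGHomotopic.comp_right (A := P.cpx) (B := P.cpx) (A' := P.cpx) (B' := P.cpx)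
    (A'' := P.cpx) (B'' := P.cpx) hpp h2
  have h4 := DGHomotopic.comp_left (A := P.cpx) (B := P.cpx) (A' := void) (B' := P.loop)
    (A'' := P.cpx) (B'' := P.cpx) hΘ
    (IsDGMap.comp (A := P.cpx) (B := P.cpx) (A' := P.cpx) (B' := P.cpx) (A'' := void)
      (B'' := P.loop) hphi hpp) hphi
    (DGHomotopic.comp_right (A := void) (B := P.loop) (A' := void) (B' := P.loop)
      (A'' := P.cpx) (B'' := P.cpx) hphi h1)
  exact DGHomotopic.trans (A := P.cpx) (B := P.cpx) (A' := P.cpx) (B' := P.cpx)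
    (DGHomotopic.symm (A := P.cpx) (B := P.cpx) (A' := P.cpx) (B' := P.cpx) h3)
    (DGHomotopic.trans (A := P.cpx) (B := P.cpx) (A' := P.cpx) (B' := P.cpx) h4 h2)

/-- Homotopy inverses are unique up to homotopy. -/
theorem dgHomotopic_of_inverse {F : Mat P.toCx P.toCx → Mat empty P.unknot}
    {G Θ : Mat empty P.unknot → Mat P.toCx P.toCx} (hG : AreHomotopyInverse F G)
    (hΘ : AreHomotopyInverse F Θ) : DGHomotopic G Θ := by
  obtain ⟨hF, hG1, -, hG2⟩ := hG
  obtain ⟨-, hΘ1, hΘ2, -⟩ := hΘ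
  have hFG : IsDGMap fun ζ => F (G ζ) := IsDGMap.comp (A := void) (B := P.loop) (A' := P.cpx)
    (B' := P.cpx) (A'' := void) (B'' := P.loop) hF hG1
  -- `G ≃ ΘFG ≃ Θ`: the first homotopy comes from `ΘF ≃ 1`, the second from `FG ≃ 1`.
  have h1 := DGHomotopic.comp_right (A := P.cpx) (B := P.cpx) (A' := P.cpx) (B' := P.cpx)
    (A'' := void) (B'' := P.loop) hG1 hΘ2
  have h2 := DGHomotopic.comp_left (A := void) (B := P.loop) (A' := void) (B' := P.loop)
    (A'' := P.cpx) (B'' := P.cpx) (L := Θ) (G := fun ζ => ζ) hΘ1 hFG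
    ⟨fun k l => ⟨fun ζ hζ => by rwa [add_zero], fun _ _ _ _ => rfl⟩, fun _ _ _ _ => rfl⟩ hG2
  exact DGHomotopic.trans (A := void) (B := P.loop) (A' := P.cpx) (B' := P.cpx)
    (DGHomotopic.symm (A := void) (B := P.loop) (A' := P.cpx) (B' := P.cpx) h1) h2

end UniversalProjector

end Main

end BN

end

theorem mainTheorem7 (n : ℕ) (P : BN.UniversalProjector n) :
    (∃ μ, P.IsStandard μ) ∧
    ∀ μ, P.IsStandard μ →
      (BN.IsDGIso P.duality ∧ (∃ Θ, BN.AreHomotopyInverse P.absorb Θ) ∧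
        ∀ k l, ∀ f ∈ BN.HomBi P.toCx P.toCx k l, P.phi f = P.absorb (P.duality f)) ∧
      BN.MapHomotopic (P.psi μ P.eta) (BN.Mat.one P.toCx) ∧
      BN.AreHomotopyInverse P.phi (P.psi μ) ∧
      ∀ Θ, BN.AreHomotopyInverse (fun f => P.absorb (P.duality f)) Θ →
        BN.DGHomotopic (P.psi μ) Θ := by
  refine ⟨P.exists_isStandard, fun μ hμ => ?_⟩
  obtain ⟨⟨⟨hμ, hμ0⟩, -⟩, hμι⟩ := hμ
  obtain ⟨μ, hμ, rfl⟩ := BN.Cpx.exists_mat (A := P.cpx.tensor P.cpx) (B := P.cpx) hμ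
  have hμ0 : BN.Cpx.δ 0 μ = 0 := BN.Cpx.mat_injective hμ0
  have h := P.areHomotopyInverse_phi_psi hμ hμ0 hμι
  refine ⟨⟨P.isDGIso_duality, P.exists_absorb_inverse, fun _ _ f _ => P.phi_eq f⟩, ?_, h, fun Θ hΘ => ?_⟩
  · have := (P.htpc_psi_eta hμ hμ0 hμι).mapHomotopic
    rw [P.mat_sad_comp, P.mat_etaHom] at this
    exact this
  · have e : (fun f => P.absorb (P.duality f)) = P.phi := funext fun f => (P.phi_eq f).symm
    rw [e] at hΘ
    exact P.dgHomotopic_of_inverse h hΘ
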